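/- Notation. An $r$-colored permutation of $[n]=\{1,\dots,n\}$ is a pair $w=(\sigma,\varepsilon)$ with $\sigma\in\mathfrak S_n$ and $\varepsilon\in\{0,\dots,r-1\}^n$; the set of all of them is $\mathbb Z_r\wr\mathfrak S_n$. Put $\sigma(n+1)=n+1$, $\varepsilon_{n+1}=0$. An index $k\in[n]$ is a descent of $w$ if $\varepsilon_k>\varepsilon_{k+1}$, or $\varepsilon_k=\varepsilon_{k+1}$ and $\sigma(k)>\sigma(k+1)$; otherwise $k$ is an ascent, and $\mathrm{Asc}(w)\subseteq[n]$ is the set of ascents. Let $\xi^+_{n,r,i}$ be the number of $w\in\mathbb Z_r\wr\mathfrak S_n$ for which $\mathrm{Asc}(w)\subseteq\{2,\dots,n\}$ has exactly $i$ elements, no two consecutive, and contains $n$. Put $d^+_{0,r}(t)=1$ and, for $n\ge1$, $$d^+_{n,r}(t)=\sum_{i=1}^{\lfloor n/2\rfloor}\xi^+_{n,r,i}\,t^i(1+t)^{n-2i},$$ and for $n\ge 0$ $$A^+_{n,r}(t)=\sum_{k=0}^n\binom nk d^+_{k,r}(t),\qquad \widetilde A^+_{n,r}(t)=\sum_{m=0}^n\binom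 nm t^{n-m}A^+_{m,r}(t).$$ The $h$-polynomial of a finite abstract simplicial complex $\Delta$ of dimension $d-1$ is $h(\Delta,t)=\sum_{i=0}^d f_{i-1}(\Delta)\,t^i(1-t)^{d-i}$, where $f_{i-1}(\Delta)$ is the number of faces with $i$ vertices (the empty face included). Let $\Gamma_n$ be the barycentric subdivision of the $(n-1)$-dimensional simplex with vertex set $V=\{v_1,\dots,v_n\}$: its vertices are the nonempty subsets of $V$, each represented by the barycenter of the corresponding face, and its faces are the chains of such subsets. If $\Delta$ is a simplicial complex with linearly ordered vertex set $\{x_1,\dots,x_m\}$, its $r$-fold edgewise subdivision $\mathrm{esd}_r(\Delta)$ has as vertices the maps $f:\{x_1,\dots,x_m\}\to\mathbb N$ with $\sum_j f(x_j)=r$ whose support $\mathrm{supp}(f)$ is a face of $\Delta$; a set $E$ of vertices is a face if $\bigcup_{f\in E}\mathrm{supp}(f)\in\Delta$ and, for all $f,g\in E$, one of $\iota(f)-\iota(g)$, $\iota(g)-\iota(f)$ has all its values in $\{0,1\}$, where $\iota(f)(x_j)=f(x_1)+\cdots+f(x_j)$. The vertex $f$ is represented by the point $\sum_j\frac{f(x_j)}{r}\,x_j$.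 Let $\Gamma_{n,r}=\mathrm{esd}_r(\Gamma_n)$, where the vertex set of $\Gamma_n$ is linearly ordered arbitrarily. For a triangulation $\Gamma$ of the simplex on $V$ and $F\subseteq V$, let $\Gamma_F$ be the subcomplex of the faces of $\Gamma$ whose geometric simplices are contained in the face $F$ of the simplex (together with the empty face). Take an $n$-element set $U=\{u_1,\dots,u_n\}$ disjoint from the vertex set of $\Gamma$. The simplicial complex $\Delta(\Gamma)$ consists of all sets $\{u_i:i\in I\}\cup G$ with $I\subseteq[n]$ and $G\in\Gamma_F$, where $F=\{v_i:i\in[n]\setminus I\}$. A simplicial complex is flag if it contains every simplex whose one-dimensional skeleton is a subcomplex of it. **Statement.** For all positive integers $n,r$ (and every linear order on the vertices of $\Gamma_n$), $$\widetilde A^+_{n,r}(t)=h(\Delta(\Gamma_{n,r}),t).$$ In particular, for all positive integers $n,r$ there is an $n$-dimensional simplicial polytope whose boundary complex is flag and has $h$-polynomial equal to $\widetilde A^+_{n,r}(t)$. -/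

import Mathlib

open Polynomial

namespace BinomialEulerian

/-! ### Colored permutations and the polynomials -/

/-- An `r`-colored permutation `(σ, ε)` of `[n]`, that is, an element of `ℤ_r ≀ S_n`. -/
abbrev ColoredPerm (n r : ℕ) : Type := Equiv.Perm (Fin n) × (Fin n → Fin r)

/-- The letter `σ(k) ∈ [n]` at the position `k ∈ {1, …, n}`, with the convention
`σ(n + 1) = n + 1`. Positions and letters are counted from `1`, hence the shifts by one. -/
def ColoredPerm.letter {n r : ℕ} (w : ColoredPerm n r) (k : ℕ) : ℕ :=
  if h : k - 1 < n then (w.1 ⟨k - 1, h⟩ : ℕ) + 1 else n + 1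

/-- The color `ε_k ∈ {0, …, r - 1}` at the position `k ∈ {1, …, n}`, with the convention
`ε_{n + 1} = 0`. -/
def ColoredPerm.color {n r : ℕ} (w : ColoredPerm n r) (k : ℕ) : ℕ :=
  if h : k - 1 < n then (w.2 ⟨k - 1, h⟩ : ℕ) else 0

/-- `k` is a descent: `ε_k > ε_{k+1}`, or `ε_k = ε_{k+1}` and `σ(k) > σ(k+1)`. -/
def ColoredPerm.IsDescent {n r : ℕ} (w : ColoredPerm n r) (k : ℕ) : Prop :=
  w.color (k + 1) < w.color k ∨ (w.color k = w.color (k + 1) ∧ w.letter (k + 1) < w.letter k)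

instance {n r : ℕ} (w : ColoredPerm n r) (k : ℕ) : Decidable (w.IsDescent k) := by
  unfold ColoredPerm.IsDescent
  infer_instance

/-- The ascent set: the complement of the descent set in `[n]`. -/
def ColoredPerm.asc {n r : ℕ} (w : ColoredPerm n r) : Finset ℕ :=
  (Finset.Icc 1 n).filter (fun k => ¬ w.IsDescent k)

/-- The number of `w ∈ ℤ_r ≀ S_n` whose ascent set is contained in `[2, n]`, has exactly `i`
elements, no two of them consecutive, and contains `n`. -/
def xiPlus (n r i : ℕ) : ℕ :=
  (Finset.univ.filter (fun w : ColoredPerm n r =>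
    w.asc ⊆ Finset.Icc 2 n ∧ w.asc.card = i ∧ (∀ k ∈ w.asc, k + 1 ∉ w.asc) ∧ n ∈ w.asc)).card

/-- `d⁺_{n,r}(t) = ∑_{i=1}^{⌊n/2⌋} ξ⁺_{n,r,i} t^i (1+t)^{n-2i}` for `n ≥ 1`, and
`d⁺_{0,r}(t) = 1`. -/
noncomputable def dPlus (n r : ℕ) : ℤ[X] :=
  if n = 0 then 1
  else ∑ i ∈ Finset.Icc 1 (n / 2), C (xiPlus n r i : ℤ) * X ^ i * (1 + X) ^ (n - 2 * i)

/-- `A⁺_{n,r}(t) = ∑_{k=0}^n (n choose k) d⁺_{k,r}(t)`. -/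
noncomputable def eulerPlus (n r : ℕ) : ℤ[X] :=
  ∑ k ∈ Finset.range (n + 1), C (n.choose k : ℤ) * dPlus k r

/-- `Ã⁺_{n,r}(t) = ∑_{m=0}^n (n choose m) t^{n-m} A⁺_{m,r}(t)`. -/
noncomputable def binomEulerPlus (n r : ℕ) : ℤ[X] :=
  ∑ m ∈ Finset.range (n + 1), C (n.choose m : ℤ) * X ^ (n - m) * eulerPlus m r

/-! ### Simplicial complexes

Mathlib's abstract simplicial complexes record the nonempty faces only; the empty set is
always understood to be a face as well. -/

/-- `f_{i-1}`: the number of faces with `i` vertices, the empty face being counted for `i = 0`. -/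
noncomputable def faceCount {W : Type*} (K : PreAbstractSimplicialComplex W) (i : ℕ) : ℕ :=
  Set.ncard {s : Finset W | s.card = i ∧ (s = ∅ ∨ s ∈ K.faces)}

/-- The dimension of a finite complex plus one: the largest number of vertices of a face
(and `0` if the empty set is the only face). -/
noncomputable def rank {W : Type*} (K : PreAbstractSimplicialComplex W) : ℕ :=
  sSup (Finset.card '' K.faces)

/-- The `h`-polynomial `∑_{i=0}^d f_{i-1} t^i (1-t)^{d-i}` of a finite complex of
dimension `d - 1`. -/
noncomputable def hPoly {W : Type*} (K : PreAbstractSimplicialComplex W) : ℤ[X] :=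
  ∑ i ∈ Finset.range (rank K + 1), C (faceCount K i : ℤ) * X ^ i * (1 - X) ^ (rank K - i)

/-- A complex is flag if it contains every simplex whose vertices and edges all belong to it. -/
def IsFlag {W : Type*} (K : PreAbstractSimplicialComplex W) : Prop :=
  ∀ s : Finset W, s.Nonempty →
    (∀ v ∈ s, ∀ w ∈ s, ∃ e ∈ K.faces, (e : Set W) = {v, w}) → s ∈ K.faces

/-! ### Complexes realized in a simplex, and the complex `Δ(Γ)` -/

/-- An abstract simplicial complex with vertex set `W`, together with a point of the geometric
simplex with vertex set `V` for every vertex. -/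
structure PlacedComplex (V W : Type*) [Fintype V] where
  /-- the underlying abstract simplicial complex -/
  complex : AbstractSimplicialComplex W
  /-- the point representing a vertex -/
  pos : W → V → ℝ
  pos_mem : ∀ w, pos w ∈ stdSimplex ℝ V

/-- The face of the geometric simplex on `V` spanned by `F ⊆ V`. -/
def simplexFace {V : Type*} [DecidableEq V] (F : Finset V) : Set (V → ℝ) :=
  convexHull ℝ ((fun v => Pi.single v (1 : ℝ)) '' (F : Set V))

theorem simplexFace_univ {V : Type*} [Fintype V] [DecidableEq V] :
    simplexFace (Finset.univ : Finset V) = stdSimplex ℝ V := by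
  rw [simplexFace, ← convexHull_basis_eq_stdSimplex]
  congr 1
  ext x
  simp [Pi.single_apply, funext_iff, eq_comm]

theorem simplexFace_mono {V : Type*} [DecidableEq V] {F F' : Finset V} (h : F ⊆ F') :
    simplexFace F ⊆ simplexFace F' :=
  convexHull_mono (Set.image_mono (by exact_mod_cast h))

/-- The restriction `Γ_F`: the subcomplex of all simplices of `Γ` which are contained in the
face of the simplex spanned by `F`. -/
def PlacedComplex.restrict {V W : Type*} [Fintype V] [DecidableEq V]
    (Γ : PlacedComplex V W) (F : Finset V) : PreAbstractSimplicialComplex W where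
  faces := {G | G ∈ Γ.complex.faces ∧ convexHull ℝ (Γ.pos '' (G : Set W)) ⊆ simplexFace F}
  isRelLowerSet_faces := by
    rintro G ⟨hG, hF⟩
    refine ⟨(Γ.complex.isRelLowerSet_faces hG).1, fun G' hle hne => ⟨?_, ?_⟩⟩
    · exact (Γ.complex.isRelLowerSet_faces hG).2 hle hne
    · exact (convexHull_mono (Set.image_mono (by exact_mod_cast hle))).trans hF

/-- The complex `Δ(Γ)`. Its vertices are the new vertices `u_v` (that is, `Sum.inl v`), one for
every `v ∈ V`, and the vertices of `Γ` (that is, `Sum.inr w`). Its faces are the sets `E ∪ G`,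
where `E = {u_v : v ∈ I}` for some `I ⊆ V` and `G` is a (possibly empty) face of the restriction
of `Γ` to the complement of `I`. -/
def PlacedComplex.sphere {V W : Type*} [Fintype V] [DecidableEq V]
    (Γ : PlacedComplex V W) : AbstractSimplicialComplex (V ⊕ W) where
  faces := {S | S.Nonempty ∧ ∃ (I : Finset V) (G : Finset W),
    S = I.disjSum G ∧ (G = ∅ ∨ G ∈ (Γ.restrict Iᶜ).faces)}
  isRelLowerSet_faces := by
    rintro S ⟨hS, I, G, rfl, hG⟩
    refine ⟨hS, fun S' hle hne => ⟨hne, S'.toLeft, S'.toRight,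
      (Finset.toLeft_disjSum_toRight).symm, ?_⟩⟩
    have hI : S'.toLeft ⊆ I := fun v hv => by
      have := hle (Finset.mem_toLeft.1 hv)
      simpa using this
    have hG' : S'.toRight ⊆ G := fun v hv => by
      have := hle (Finset.mem_toRight.1 hv)
      simpa using this
    rcases S'.toRight.eq_empty_or_nonempty with h0 | h0
    · exact Or.inl h0
    · right
      rcases hG with rfl | hG
      · exact absurd (Finset.subset_empty.1 hG') h0.ne_empty
      · obtain ⟨h1, h2⟩ := ((Γ.restrict Iᶜ).isRelLowerSet_faces hG).2 hG' h0
        exact ⟨h1, h2.trans (simplexFace_mono (Finset.compl_subset_compl.2 hI))⟩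
  singleton_mem := by
    rintro (v | w)
    · refine ⟨Finset.singleton_nonempty _, {v}, ∅, ?_, Or.inl rfl⟩
      ext x
      cases x <;> simp
    · refine ⟨Finset.singleton_nonempty _, ∅, {w}, ?_, Or.inr ⟨Γ.complex.singleton_mem w, ?_⟩⟩
      · ext x
        cases x <;> simp
      · simp [simplexFace_univ, Γ.pos_mem w]

/-! ### Barycentric and edgewise subdivisions -/

/-- The vertices of the barycentric subdivision of the simplex on `[n]`: the nonempty subsets. -/
abbrev BaryVertex (n : ℕ) : Type := {S : Finset (Fin n) // S.Nonempty}

/-- The barycentric subdivision `Γ_n` of the `(n-1)`-dimensional simplex: its faces are the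
chains of nonempty subsets of `[n]`, and `S` is represented by the barycenter of the face
spanned by `S`. -/
noncomputable def barycentric (n : ℕ) : PlacedComplex (Fin n) (BaryVertex n) where
  complex :=
    { faces := {c | c.Nonempty ∧ ∀ S ∈ c, ∀ T ∈ c, S.1 ⊆ T.1 ∨ T.1 ⊆ S.1}
      isRelLowerSet_faces := fun c hc =>
        ⟨hc.1, fun _ hle hne => ⟨hne, fun S hS T hT => hc.2 S (hle hS) T (hle hT)⟩⟩
      singleton_mem := fun S =>
        ⟨Finset.singleton_nonempty _, fun A hA B hB => by
          rw [Finset.mem_singleton.1 hA, Finset.mem_singleton.1 hB]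
          exact Or.inl subset_rfl⟩ }
  pos := fun S v => if v ∈ S.1 then (S.1.card : ℝ)⁻¹ else 0
  pos_mem := fun S => by
    refine ⟨fun v => ?_, ?_⟩
    · dsimp only
      split_ifs <;> positivity
    · have : (S.1.card : ℝ) ≠ 0 := by exact_mod_cast S.2.card_pos.ne'
      simp [this]

/-- The support of `f : W → ℕ`. -/
def supp {W : Type*} [Fintype W] (f : W → ℕ) : Finset W :=
  Finset.univ.filter (fun v => f v ≠ 0)

/-- `V_r(Δ)`: the maps `f` from the vertex set of `Δ` to `ℕ` whose support is a face and whose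
values add up to `r`. -/
abbrev EdgewiseVertex {W : Type*} [Fintype W] (r : ℕ) (K : AbstractSimplicialComplex W) : Type _ :=
  {f : W → ℕ // supp f ∈ K.faces ∧ ∑ v, f v = r}

/-- The partial sums `ι(f)(v) = ∑_{u ≤ v} f(u)`. -/
def partialSums {W : Type*} [Fintype W] [LinearOrder W] (f : W → ℕ) (v : W) : ℕ :=
  ∑ u ∈ Finset.univ.filter (fun u => u ≤ v), f u

/-- The `r`-fold edgewise subdivision of an abstract simplicial complex whose vertex set is
linearly ordered. -/
def esd {W : Type*} [Fintype W] [LinearOrder W] (r : ℕ) (K : AbstractSimplicialComplex W) :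
    AbstractSimplicialComplex (EdgewiseVertex r K) where
  faces := {E | E.Nonempty ∧ E.biUnion (fun f => supp f.1) ∈ K.faces ∧
    ∀ f ∈ E, ∀ g ∈ E,
      (∀ v, (partialSums f.1 v : ℤ) - partialSums g.1 v ∈ ({0, 1} : Set ℤ)) ∨
      (∀ v, (partialSums g.1 v : ℤ) - partialSums f.1 v ∈ ({0, 1} : Set ℤ))}
  isRelLowerSet_faces := by
    rintro E ⟨hE, hU, hd⟩
    refine ⟨hE, fun E' hle hne => ⟨hne, ?_, fun f hf g hg => hd f (hle hf) g (hle hg)⟩⟩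
    refine (K.isRelLowerSet_faces hU).2 (Finset.biUnion_subset_biUnion_of_subset_left _ hle) ?_
    obtain ⟨f, hf⟩ := hne
    obtain ⟨v, hv⟩ := (K.isRelLowerSet_faces f.2.1).1
    exact ⟨v, Finset.mem_biUnion.2 ⟨f, hf, hv⟩⟩
  singleton_mem := fun f => by
    refine ⟨Finset.singleton_nonempty _, ?_, ?_⟩
    · simpa using f.2.1
    · simp

/-- The `r`-fold edgewise subdivision of a realized complex: the vertex `f` is represented by the
point with barycentric coordinates `f(v) / r`. -/
noncomputable def PlacedComplex.esd {V W : Type*} [Fintype V] [Fintype W] [LinearOrder W]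
    (r : ℕ) (Γ : PlacedComplex V W) : PlacedComplex V (EdgewiseVertex r Γ.complex) where
  complex := BinomialEulerian.esd r Γ.complex
  pos := fun f => ∑ v, ((f.1 v : ℝ) / r) • Γ.pos v
  pos_mem := fun f => by
    have hr : (r : ℝ) ≠ 0 := by
      obtain ⟨v, hv⟩ := (Γ.complex.isRelLowerSet_faces f.2.1).1
      have h1 : f.1 v ≠ 0 := by simpa [supp] using hv
      have h2 : f.1 v ≤ ∑ u, f.1 u :=
        Finset.single_le_sum (fun _ _ => Nat.zero_le _) (Finset.mem_univ v)
      rw [f.2.2] at h2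
      exact_mod_cast (by omega : r ≠ 0)
    refine (convex_stdSimplex ℝ V).sum_mem (fun v _ => by positivity) ?_
      (fun v _ => Γ.pos_mem v)
    rw [← Finset.sum_div, ← Nat.cast_sum, f.2.2, div_self hr]

/-- `Γ_{n,r}`: the `r`-fold edgewise subdivision of the barycentric subdivision of the
`(n-1)`-dimensional simplex, with respect to a linear order on the vertices of the latter. -/
noncomputable def gamma (n r : ℕ) (ord : LinearOrder (BaryVertex n)) :
    PlacedComplex (Fin n) (EdgewiseVertex r (barycentric n).complex) :=
  PlacedComplex.esd r (barycentric n)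

/-! ### Polytopes -/

/-- A convex polytope, given by its vertices: finitely many points, none of which lies in the
convex hull of the others. -/
structure Polytope (E : Type*) [AddCommGroup E] [Module ℝ E] where
  /-- the vertex set -/
  verts : Finset E
  convexIndependent : ConvexIndependent ℝ (Subtype.val : verts → E)

namespace Polytope

variable {E : Type*} [AddCommGroup E] [Module ℝ E] (P : Polytope E)

/-- The polytope as a set of points. -/
def carrier : Set E := convexHull ℝ (P.verts : Set E)

/-- The dimension of the affine hull. -/
noncomputable def dim : ℕ := Module.finrank ℝ (affineSpan ℝ (P.verts : Set E)).direction

variable [TopologicalSpace E]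

/-- A proper face: the set of maximizers of a linear functional over the polytope (or the empty
set), different from the whole polytope. -/
def IsProperFace (F : Set E) : Prop := IsExposed ℝ P.carrier F ∧ F ≠ P.carrier

/-- A polytope is simplicial if every proper face is a simplex. -/
def IsSimplicial : Prop :=
  ∀ F : Set E, P.IsProperFace F →
    AffineIndependent ℝ (Subtype.val : {v : E // v ∈ P.verts ∧ v ∈ F} → E)

/-- The boundary complex of a (simplicial) polytope, as an abstract simplicial complex on the
set of vertices: its faces are the sets of vertices which lie on a common proper face. -/
def boundaryComplex : PreAbstractSimplicialComplex P.verts where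
  faces := {s | s.Nonempty ∧ ∃ F : Set E, P.IsProperFace F ∧ ∀ v ∈ s, (v : E) ∈ F}
  isRelLowerSet_faces := fun _ ⟨hs, F, hF, h⟩ =>
    ⟨hs, fun _ hle hne => ⟨hne, F, hF, fun v hv => h v (hle hv)⟩⟩

/-- A flag simplicial polytope. -/
def IsFlagSimplicial : Prop :=
  P.IsSimplicial ∧ IsFlag P.boundaryComplex

end Polytope

end BinomialEulerian

namespace BinomialEulerian

/-! Multiplied by the right power of `1 - t`, the face enumerator `∑ (t / (1 - t)) ^ |G|` becomes
the $h$-polynomial, and its $t^m$-coefficient is the number of multisets of $m$ vertices whose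
support is a face. Everything rests on counting such multisets.

Let $F$ have $p$ elements. A multiset of pairwise adjacent functions is determined by its size and
its sum, being the even distribution of that sum (`Balanced.eq_evenPart`). Passing to partial sums,
multisets of size $m$ on faces of the edgewise subdivision become single maps of total $rm$
supported on a chain (`bijOn_edgewise`). Summing indicator vectors turns these into functions on $F$
with maximum exactly $rm$ (`bijOn_levelSum`). Hence for $m>0$ there are $(rm+1)^p-(rm)^p$ of them,
whatever the vertex order, and the enumerator of the restriction to $F$ is `shellSeries r p`.
Summing over $F$, with the new vertices contributing $(t/(1-t))^{n-|F|}$, leaves one identity to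
prove: $A^+_{p,r}(t)=(1-t)^p\cdot$`shellSeries r p` (`eulerPlus_eq_shellSeries`).

For that identity, cut a colored permutation at its ascents into decreasing runs. The conditions
defining $\xi^+$ say that all runs have length at least two and that the last color is zero, so
$d^+$ weighs a run of length $\ell$ by $t(1+t)^{\ell-2}$. Prefixing words with decreasing blocks
gives the recursion `dPlus_recursion`, that is, $D(x)(e^{rtx}-te^{rx})=e^{(r-1)tx}-te^{(r-1)x}$ for
the exponential generating function $D$ of $d^+$. Multiplied by $e^{(1-rt)x}$, it becomes the
equation that the shell series satisfies by the binomial theorem.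

For the polytope, $\Delta(\Gamma_{n,r})$ is replaced by another complex with the same enumerators.
Its vertices are the directions $-e_i$ and the lattice points of $[0,r]^n$ having some coordinate
$r$; lattice points are joined when adjacent, $-e_i$ is joined to $z$ when $z_i=0$, and faces are
the cliques, so flagness is automatic. The same counting (`bijOn_cubePoint`) gives the same
$h$-polynomial. The complex is polytopal because a convex quadratic height function induces it:
products $(z-a)(z-b)$ with $a,b$ the floor and ceiling of a rational number yield a supporting
functional for each cone (`exists_cube_functional`, `exists_support`), and `exists_polytope`
assembles the polytope from these. -/

/-! ### Face enumerators -/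

/-- The power series `t / (1 - t)`. -/
noncomputable def geomTail : PowerSeries ℤ := PowerSeries.X * PowerSeries.mk 1

theorem geomTail_mul : geomTail * (1 - PowerSeries.X) = PowerSeries.X := by
  rw [geomTail, mul_assoc, PowerSeries.mk_one_mul_one_sub_eq_one, mul_one]

theorem coeff_geomTail (m : ℕ) : PowerSeries.coeff m geomTail = if m = 0 then 0 else 1 := by
  cases m with
  | zero => simp [geomTail]
  | succ m => simp [geomTail, PowerSeries.coeff_succ_X_mul]

/-- Each factor $t/(1-t)$ chooses a positive multiplicity for one element of $G$, so only
multiplicity functions with full support $G$ survive. -/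
theorem coeff_geomTail_pow {W : Type*} [DecidableEq W] (G : Finset W) (m : ℕ) :
    PowerSeries.coeff m (geomTail ^ G.card) =
      ((G.finsuppAntidiag m).filter (fun l => l.support = G)).card := by
  rw [← Finset.prod_const, PowerSeries.coeff_prod, Finset.card_filter]
  push_cast
  refine Finset.sum_congr rfl fun l hl => ?_
  have hsub := (Finset.mem_finsuppAntidiag.1 hl).2
  simp only [coeff_geomTail]
  split_ifs with h
  · refine Finset.prod_eq_one fun i hi => ?_
    rw [← h, Finsupp.mem_support_iff] at hi
    simp [hi]
  · obtain ⟨i, hi, hi'⟩ : ∃ i ∈ G, i ∉ l.support := by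
      by_contra! hc
      exact h (hsub.antisymm hc)
    refine Finset.prod_eq_zero hi ?_
    simpa using hi'

/-- The face enumerator counts multisets by their support. -/
theorem coeff_sum_geomTail_pow {W : Type*} [DecidableEq W] (𝒢 : Finset (Finset W)) (m : ℕ) :
    PowerSeries.coeff m (∑ G ∈ 𝒢, geomTail ^ G.card) =
      (Set.ncard {M : Multiset W | M.card = m ∧ M.toFinset ∈ 𝒢} : ℤ) := by
  have h1 : {M : Multiset W | M.card = m ∧ M.toFinset ∈ 𝒢} =
      ((𝒢.biUnion fun G => (G.finsuppAntidiag m).filter (fun l => l.support = G)).image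
        Finsupp.toMultiset : Finset (Multiset W)) := by
    ext M
    simp only [Set.mem_ofPred_eq, Finset.coe_image, Finset.coe_biUnion, Set.mem_image,
      Set.mem_iUnion, Finset.mem_coe, Finset.mem_filter, exists_prop, Finset.mem_finsuppAntidiag]
    constructor
    · rintro ⟨hm, hM⟩
      refine ⟨Multiset.toFinsupp M, ⟨_, hM, ⟨?_, ?_⟩, ?_⟩, by simp⟩
      · exact (Multiset.toFinset_sum_count_eq M).trans hm
      · simp
      · simp
    · rintro ⟨l, ⟨G, hG, ⟨hl, -⟩, rfl⟩, rfl⟩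
      refine ⟨?_, by simpa using hG⟩
      rw [Finsupp.card_toMultiset, ← hl]
      rfl
  have hinj : Function.Injective (Finsupp.toMultiset : (W →₀ ℕ) → Multiset W) :=
    Multiset.toFinsupp.symm.injective
  rw [h1, Set.ncard_coe_finset, Finset.card_image_of_injective _ hinj,
    Finset.card_biUnion, map_sum]
  · push_cast
    exact Finset.sum_congr rfl fun G _ => coeff_geomTail_pow G m
  · intro G _ G' _ hne
    rw [Function.onFun, Finset.disjoint_left]
    intro l hl hl'
    exact hne ((Finset.mem_filter.1 hl).2.symm.trans (Finset.mem_filter.1 hl').2)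

/-- Termwise this is $(t/(1-t))^i(1-t)^d=t^i(1-t)^{d-i}$. Any upper bound $d$ on the face sizes will
do; it need not be attained. -/
theorem sum_faces_eq {W : Type*} [DecidableEq W] (𝒮 : Finset (Finset W)) (d : ℕ)
    (hd : ∀ S ∈ 𝒮, S.card ≤ d) :
    (∑ S ∈ 𝒮, geomTail ^ S.card) * (1 - PowerSeries.X) ^ d =
      ((∑ i ∈ Finset.range (d + 1),
        C ((𝒮.filter (fun S => S.card = i)).card : ℤ) * X ^ i * (1 - X) ^ (d - i) : ℤ[X]) :
          PowerSeries ℤ) := by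
  have h2 : (∑ i ∈ Finset.range (d + 1),
        C ((𝒮.filter (fun S => S.card = i)).card : ℤ) * X ^ i * (1 - X) ^ (d - i) : ℤ[X]) =
      ∑ S ∈ 𝒮, X ^ S.card * (1 - X) ^ (d - S.card) := by
    rw [← Finset.sum_fiberwise_of_maps_to (s := 𝒮) (t := Finset.range (d + 1))
      (g := fun S => S.card) (fun S hS => Finset.mem_range.2 (Nat.lt_succ_of_le (hd S hS)))]
    refine Finset.sum_congr rfl fun i _ => ?_
    rw [Finset.sum_congr rfl (g := fun _ => X ^ i * (1 - X) ^ (d - i))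
      (fun S hS => by rw [(Finset.mem_filter.1 hS).2])]
    simp [mul_assoc]
  rw [h2, Finset.sum_mul, ← Polynomial.coeToPowerSeries.ringHom_apply, map_sum]
  refine Finset.sum_congr rfl fun S hS => ?_
  simp only [map_mul, map_pow, map_sub, map_one, Polynomial.coeToPowerSeries.ringHom_apply,
    Polynomial.coe_X]
  nth_rw 1 [← Nat.add_sub_cancel' (hd S hS), pow_add, ← mul_assoc, ← mul_pow, geomTail_mul]

/-- The `h`-polynomial of a finite complex is determined by its face enumerator. -/
theorem hPoly_eq_of_enumerator {W : Type*} [DecidableEq W] (K : PreAbstractSimplicialComplex W)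
    (𝒮 : Finset (Finset W)) (h𝒮 : ∀ S, S ∈ 𝒮 ↔ S = ∅ ∨ S ∈ K.faces) (n : ℕ) (p : ℤ[X])
    (hn : ∃ S ∈ K.faces, S.card = n)
    (hp : (∑ S ∈ 𝒮, geomTail ^ S.card) * (1 - PowerSeries.X) ^ n = (p : PowerSeries ℤ)) :
    hPoly K = p := by
  obtain ⟨S₀, hS₀, rfl⟩ := hn
  have hfin : (Finset.card '' K.faces).Finite :=
    (𝒮.finite_toSet.subset fun S hS => Finset.mem_coe.2 ((h𝒮 S).2 (Or.inr hS))).image _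
  have hbdd : BddAbove (Finset.card '' K.faces) := hfin.bddAbove
  have hle : ∀ S ∈ 𝒮, S.card ≤ rank K := by
    intro S hS
    rcases (h𝒮 S).1 hS with rfl | hS
    · simp
    · exact le_csSup hbdd ⟨S, hS, rfl⟩
  obtain ⟨S₁, hS₁, hcard⟩ : rank K ∈ Finset.card '' K.faces :=
    Nat.sSup_mem ⟨_, S₀, hS₀, rfl⟩ hbdd
  have hcount : ∀ i, faceCount K i = (𝒮.filter (fun S => S.card = i)).card := by
    intro i
    rw [faceCount, ← Set.ncard_coe_finset]
    congr 1
    ext S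
    simp [h𝒮, and_comm]
  have hh : ((hPoly K : ℤ[X]) : PowerSeries ℤ) =
      (∑ S ∈ 𝒮, geomTail ^ S.card) * (1 - PowerSeries.X) ^ rank K := by
    rw [sum_faces_eq 𝒮 _ hle, hPoly]
    simp only [hcount]
  have hn' : S₀.card ≤ rank K := hle S₀ ((h𝒮 _).2 (Or.inr hS₀))
  -- The rank is so far only known to be at least `S₀.card`; the surplus shows up as a power of `1 -
  -- X`.
  have key : hPoly K = p * (1 - X) ^ (rank K - S₀.card) := by
    apply Polynomial.coe_injective
    rw [hh, ← Polynomial.coeToPowerSeries.ringHom_apply, map_mul, map_pow, map_sub, map_one]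
    simp only [Polynomial.coeToPowerSeries.ringHom_apply, Polynomial.coe_X]
    rw [← hp, mul_assoc, ← pow_add, Nat.add_sub_cancel' hn']
  -- At `1` only the faces of maximal size contribute, and there is at least one. A surplus factor
  -- `1 - X` would force the value zero, so the rank equals `S₀.card`.
  have heval : (hPoly K).eval 1 = faceCount K (rank K) := by
    rw [hPoly, Polynomial.eval_finsetSum, Finset.sum_eq_single (rank K)]
    · simp
    · intro i hi hne
      have : rank K - i ≠ 0 := by
        have := Finset.mem_range.1 hi
        omega
      simp [this]
    · simp
  have hpos : 0 < faceCount K (rank K) := by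
    rw [hcount, Finset.card_pos]
    exact ⟨S₁, Finset.mem_filter.2 ⟨(h𝒮 _).2 (Or.inr hS₁), hcard⟩⟩
  have hzero : rank K - S₀.card = 0 := by
    by_contra hne
    rw [key] at heval
    simp [hne] at heval
    omega
  rw [key, hzero, pow_zero, mul_one]

/-- The number of functions on a `p`-element set with values in `ℕ` and maximum `r * m`, with the
convention that the maximum of the empty function is `0`. -/
def shellCount (r p m : ℕ) : ℤ :=
  -- For `p = 0` the difference of powers vanishes for every `m`; the value `1` at `m = 0` accounts
  -- for the empty multiset.
  if p = 0 then (if m = 0 then 1 else 0) else (r * m + 1) ^ p - (r * m) ^ p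

/-- The generating function of `shellCount`. -/
noncomputable def shellSeries (r p : ℕ) : PowerSeries ℤ := PowerSeries.mk (shellCount r p)

/-- Only the enumerators of the pieces `Γ F` enter, not their structure. This lets one computation
serve both $\Delta(\Gamma_{n,r})$ and the boundary complex of the polytope. -/
theorem hPoly_eq_binomEulerPlus {V W U : Type*} [Fintype V] [DecidableEq V] [DecidableEq W]
    [Finite W] [DecidableEq U] [Nonempty V]
    (K : PreAbstractSimplicialComplex U) (e : V ⊕ W ≃ U) (Γ : Finset V → Finset (Finset W)) (r : ℕ)
    (hE : ∀ F, ∅ ∈ Γ F)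
    (hK : ∀ S : Finset (V ⊕ W), S.map e.toEmbedding ∈ K.faces ↔
      S.Nonempty ∧ S.toRight ∈ Γ (S.toLeft)ᶜ)
    (hΓ : ∀ F, ∑ G ∈ Γ F, geomTail ^ G.card = shellSeries r F.card)
    (hA : ∀ p, (eulerPlus p r : PowerSeries ℤ) = (1 - PowerSeries.X) ^ p * shellSeries r p) :
    hPoly K = binomEulerPlus (Fintype.card V) r := by
  classical
  have := Fintype.ofFinite W
  let 𝒯 : Finset (Finset (V ⊕ W)) := Finset.univ.filter (fun S => S.toRight ∈ Γ (S.toLeft)ᶜ)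
  refine hPoly_eq_of_enumerator K (𝒯.image (fun S => S.map e.toEmbedding)) ?_ (Fintype.card V) _ ?_ ?_
  · intro S
    obtain ⟨T, rfl⟩ : ∃ T : Finset (V ⊕ W), T.map e.toEmbedding = S :=
      ⟨S.map e.symm.toEmbedding, by ext; simp⟩
    rw [hK, Finset.mem_image]
    have hinj : ∀ a : Finset (V ⊕ W), a.map e.toEmbedding = T.map e.toEmbedding ↔ a = T :=
      fun a => Finset.map_inj
    simp only [hinj, exists_eq_right, 𝒯, Finset.mem_filter, Finset.mem_univ, true_and,
      Finset.map_eq_empty]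
    rcases T.eq_empty_or_nonempty with rfl | hT
    · have : (∅ : Finset (V ⊕ W)).toRight = ∅ := by ext; simp
      simpa [this] using hE _
    · simp [hT, hT.ne_empty]
  -- The set of all new vertices is a face with the required number of elements.
  · refine ⟨(Finset.univ.disjSum ∅).map e.toEmbedding, (hK _).2 ⟨?_, ?_⟩, ?_⟩
    · obtain ⟨v⟩ := ‹Nonempty V›
      exact ⟨Sum.inl v, by simp⟩
    · rw [Finset.toRight_disjSum]
      exact hE _
    · simp
  · rw [Finset.sum_image (fun a _ b _ h => Finset.map_injective _ h)]
    have h1 : ∑ S ∈ 𝒯, geomTail ^ (S.map e.toEmbedding).card =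
        ∑ F : Finset V, geomTail ^ (Fintype.card V - F.card) * shellSeries r F.card := by
      have : ∀ F : Finset V, geomTail ^ (Fintype.card V - F.card) * shellSeries r F.card =
          ∑ G ∈ Γ F, geomTail ^ (Fᶜ.card + G.card) := by
        intro F
        rw [← hΓ, Finset.mul_sum, Finset.card_compl]
        simp [pow_add]
      simp only [this]
      rw [Finset.sum_sigma']
      refine Finset.sum_bij' (fun S _ => ⟨(S.toLeft)ᶜ, S.toRight⟩)
        (fun P _ => (P.1)ᶜ.disjSum P.2) ?_ ?_ ?_ ?_ ?_
      · intro S hS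
        simpa [𝒯] using hS
      · rintro ⟨F, G⟩ h
        simpa [𝒯] using h
      · intro S _
        simp [Finset.toLeft_disjSum_toRight]
      · rintro ⟨F, G⟩ _
        simp
      · intro S _
        simp [Finset.card_toLeft_add_card_toRight]
    rw [h1, binomEulerPlus, ← Polynomial.coeToPowerSeries.ringHom_apply, map_sum, Finset.sum_mul]
    have h2 := Finset.sum_powerset_apply_card (fun m => geomTail ^ (Fintype.card V - m) *
      shellSeries r m * (1 - PowerSeries.X) ^ (Fintype.card V)) (x := (Finset.univ : Finset V))
    rw [Finset.powerset_univ] at h2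
    rw [h2, Finset.card_univ]
    refine Finset.sum_congr rfl fun m hm => ?_
    have hm' : m ≤ Fintype.card V := Nat.lt_succ_iff.1 (Finset.mem_range.1 hm)
    simp only [map_mul, map_pow, Polynomial.coeToPowerSeries.ringHom_apply, Polynomial.coe_X,
      Polynomial.coe_C, hA, nsmul_eq_mul]
    have hpow : (1 - PowerSeries.X : PowerSeries ℤ) ^ Fintype.card V =
        (1 - PowerSeries.X) ^ (Fintype.card V - m) * (1 - PowerSeries.X) ^ m := by
      rw [← pow_add, Nat.sub_add_cancel hm']
    rw [hpow]
    nth_rw 3 [← geomTail_mul]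
    rw [mul_pow]
    simp only [map_natCast]
    ring

/-! ### Balanced multisets of functions -/

/-- Two functions are adjacent if their difference, in one of the two orders, has all its values
in `{0, 1}`. -/
def Adjacent {A : Type*} (f g : A → ℕ) : Prop := (f ≤ g ∧ g ≤ f + 1) ∨ (g ≤ f ∧ f ≤ g + 1)

theorem Adjacent.refl {A : Type*} (f : A → ℕ) : Adjacent f f :=
  Or.inl ⟨le_rfl, fun _ => Nat.le_succ _⟩

/-- A multiset of functions is balanced if its members are pairwise adjacent. -/
def Balanced {A : Type*} (M : Multiset (A → ℕ)) : Prop := ∀ f ∈ M, ∀ g ∈ M, Adjacent f g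

/-- The `k`-th of the `m` functions into which `F` is distributed evenly. -/
def evenPart {A : Type*} (m : ℕ) (F : A → ℕ) (k : ℕ) : A → ℕ := fun a => (F a + k) / m

/-- Hermite's identity. Raising $F(a)$ by one shifts the list of summands by one place, and the
summand entering at the end exceeds the one dropped by exactly $1$. -/
theorem sum_evenPart {A : Type*} {m : ℕ} (hm : 0 < m) (F : A → ℕ) :
    ∑ k ∈ Finset.range m, evenPart m F k = F := by
  ext a
  rw [Finset.sum_apply]
  simp only [evenPart]
  induction F a with
  | zero =>
    refine Finset.sum_eq_zero fun k hk => ?_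
    rw [zero_add]
    exact Nat.div_eq_of_lt (Finset.mem_range.1 hk)
  | succ x ih =>
    have h1 := Finset.sum_range_succ' (fun k => (x + k) / m) m
    rw [Finset.sum_range_succ, ih, add_zero, Nat.add_div_right _ hm] at h1
    have h2 : ∀ k, x + 1 + k = x + (k + 1) := fun k => by ring
    simp only [h2]
    omega

theorem evenPart_mono {A : Type*} (m : ℕ) (F : A → ℕ) {j k : ℕ} (h : j ≤ k) :
    evenPart m F j ≤ evenPart m F k := fun a => Nat.div_le_div_right (by omega)

theorem evenPart_le_succ {A : Type*} {m : ℕ} (F : A → ℕ) {j k : ℕ} (hk : k < m) :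
    evenPart m F k ≤ evenPart m F j + 1 := fun a => by
  have hm : 0 < m := by omega
  simp only [evenPart, Pi.add_apply, Pi.one_apply]
  rw [← Nat.add_div_right _ hm]
  exact Nat.div_le_div_right (by omega)

theorem adjacent_evenPart {A : Type*} {m : ℕ} (F : A → ℕ) {j k : ℕ} (hj : j < m) (hk : k < m) :
    Adjacent (evenPart m F j) (evenPart m F k) := by
  rcases le_total j k with h | h
  · exact Or.inl ⟨evenPart_mono m F h, evenPart_le_succ F hk⟩
  · exact Or.inr ⟨evenPart_mono m F h, evenPart_le_succ F hj⟩

/-- Adjacent functions are comparable, so a balanced multiset is a chain. Sorting by any linear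
extension of the pointwise order therefore sorts it pointwise. -/
theorem exists_sorted {A : Type*} (M : Multiset (A → ℕ)) (hM : Balanced M) :
    ∃ l : List (A → ℕ), (l : Multiset (A → ℕ)) = M ∧ l.Pairwise (· ≤ ·) := by
  classical
  obtain ⟨s, hs, hle⟩ := extend_partialOrder ((· ≤ ·) : (A → ℕ) → (A → ℕ) → Prop)
  have : DecidableRel s := Classical.decRel s
  refine ⟨M.sort s, Multiset.sort_eq _ _, ?_⟩
  have h1 : (M.sort s).Pairwise s := Multiset.pairwise_sort _ _
  refine h1.imp_of_mem fun {a b} ha hb hab => ?_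
  rw [Multiset.mem_sort] at ha hb
  rcases hM a ha b hb with h | h
  · exact h.1
  · exact (antisymm hab (hle _ _ h.1)).le

/-- In the sorted list the members before the $k$-th lie at most one below it, and those after it at
most one above. Summing the values at a point $a$ pins the $k$-th value down as $\lfloor
(F(a)+k)/m\rfloor$, with $F$ the total. -/
theorem Balanced.eq_evenPart {A : Type*} {M : Multiset (A → ℕ)} (hM : Balanced M) :
    M = (Multiset.range M.card).map (evenPart M.card M.sum) := by
  obtain ⟨l, rfl, hl⟩ := exists_sorted M hM
  rw [Multiset.coe_card, Multiset.sum_coe, Multiset.range, Multiset.map_coe, Multiset.coe_eq_coe]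
  refine List.Perm.of_eq (List.ext_getElem (by simp) fun k hk _ => ?_)
  ext a
  simp only [List.getElem_map, List.getElem_range, evenPart]
  have hsum : l.sum a = ∑ j : Fin l.length, l[j] a := by
    have := congrFun (Fin.sum_univ_getElem l) a
    rw [Finset.sum_apply] at this
    exact this.symm
  have hmono : ∀ i j : Fin l.length, i ≤ j → l[i] a ≤ l[j] a := fun i j hij => by
    rcases hij.lt_or_eq with h | rfl
    · exact List.pairwise_iff_getElem.1 hl i j i.2 j.2 h a
    · exact le_rfl
  have hadj : ∀ i j : Fin l.length, l[i] a ≤ l[j] a + 1 := fun i j => by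
    rcases hM l[i] (by simp) l[j] (by simp) with h | h
    · exact (h.1 a).trans (Nat.le_succ _)
    · exact h.2 a
  have hcard : (Finset.univ.filter (fun j : Fin l.length => j < ⟨k, hk⟩)).card = k := by
    have : (Finset.univ.filter (fun j : Fin l.length => j < ⟨k, hk⟩)) = Finset.Iio ⟨k, hk⟩ := by
      ext; simp
    rw [this, Fin.card_Iio]
  have hcard' : (Finset.univ.filter (fun j : Fin l.length => ⟨k, hk⟩ < j)).card =
      l.length - 1 - k := by
    have : (Finset.univ.filter (fun j : Fin l.length => ⟨k, hk⟩ < j)) = Finset.Ioi ⟨k, hk⟩ := by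
      ext; simp
    rw [this, Fin.card_Ioi]
  have hlow : l.length * l[k] a ≤ l.sum a + k := by
    have : ∑ j : Fin l.length, l[k] a ≤
        ∑ j : Fin l.length, (l[j] a + if j < ⟨k, hk⟩ then 1 else 0) := by
      refine Finset.sum_le_sum fun j _ => ?_
      split_ifs with h
      · exact hadj ⟨k, hk⟩ j
      · exact hmono ⟨k, hk⟩ j (not_lt.1 h)
    rw [Finset.sum_add_distrib, ← hsum, ← Finset.card_filter, hcard] at this
    simpa using this
  have hupp : l.sum a ≤ l.length * l[k] a + (l.length - 1 - k) := by
    have : ∑ j : Fin l.length, l[j] a ≤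
        ∑ j : Fin l.length, (l[k] a + if ⟨k, hk⟩ < j then 1 else 0) := by
      refine Finset.sum_le_sum fun j _ => ?_
      split_ifs with h
      · exact hadj j ⟨k, hk⟩
      · exact hmono j ⟨k, hk⟩ (not_lt.1 h)
    rw [Finset.sum_add_distrib, ← hsum, ← Finset.card_filter, hcard'] at this
    simpa using this
  symm
  rw [Nat.div_eq_iff (by omega)]
  rw [mul_comm] at hlow hupp
  constructor <;> omega

theorem Balanced.ext {A : Type*} {M M' : Multiset (A → ℕ)} (hM : Balanced M) (hM' : Balanced M')
    (hc : M.card = M'.card) (hs : M.sum = M'.sum) : M = M' := by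
  rw [hM.eq_evenPart, hM'.eq_evenPart, hc, hs]

/-! ### Multisets on the faces of an edgewise subdivision -/

section Edgewise

variable {W : Type*} [Fintype W]

theorem mem_supp {f : W → ℕ} {v : W} : v ∈ supp f ↔ f v ≠ 0 := by simp [supp]

theorem supp_multiset_sum (M : Multiset (W → ℕ)) (v : W) :
    v ∈ supp M.sum ↔ ∃ f ∈ M, v ∈ supp f := by
  induction M using Multiset.induction_on with
  | empty => simp [mem_supp]
  | cons f M ih =>
    simp only [mem_supp, Multiset.sum_cons, Pi.add_apply, Multiset.mem_cons,
      exists_eq_or_imp] at ih ⊢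
    rw [← ih]
    omega

variable [LinearOrder W]

/-- `partialSums` as an additive homomorphism. -/
def partialSumsHom : (W → ℕ) →+ (W → ℕ) where
  toFun := partialSums
  map_zero' := by ext; simp [partialSums]
  map_add' f g := by ext; simp [partialSums, Finset.sum_add_distrib]

theorem partialSums_multiset_sum (M : Multiset (W → ℕ)) :
    partialSums M.sum = (M.map partialSums).sum :=
  map_multiset_sum (partialSumsHom : (W → ℕ) →+ (W → ℕ)) M

theorem partialSums_eq (f : W → ℕ) (v : W) :
    partialSums f v = f v + ∑ u ∈ Finset.univ.filter (fun u => u < v), f u := by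
  have : Finset.univ.filter (fun u => u ≤ v) =
      insert v (Finset.univ.filter (fun u => u < v)) := by
    ext u
    simp [le_iff_eq_or_lt]
  rw [partialSums, this, Finset.sum_insert (by simp)]

theorem partialSums_injective : Function.Injective (partialSums : (W → ℕ) → (W → ℕ)) := by
  intro f g h
  ext v
  induction v using WellFoundedLT.induction with
  | ind v ih =>
    have h1 := congrFun h v
    rw [partialSums_eq, partialSums_eq, Finset.sum_congr rfl
      (fun u hu => ih u (Finset.mem_filter.1 hu).2)] at h1
    exact Nat.add_right_cancel h1

theorem partialSums_mono (f : W → ℕ) : Monotone (partialSums f) := fun _ _ huv =>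
  Finset.sum_le_sum_of_subset fun w hw => by
    simp only [Finset.mem_filter, Finset.mem_univ, true_and] at hw ⊢
    exact hw.trans huv

theorem exists_partialSums_eq {G : W → ℕ} (hG : Monotone G) : ∃ g, partialSums g = G := by
  -- Consecutive differences: by monotonicity the supremum is the value of `G` at the predecessor,
  -- and it is `0` at the least element.
  refine ⟨fun v => G v - (Finset.univ.filter (fun u => u < v)).sup G, ?_⟩
  ext v
  induction v using WellFoundedLT.induction with
  | ind v ih =>
    rw [partialSums_eq]
    rcases (Finset.univ.filter (fun u => u < v)).eq_empty_or_nonempty with h | h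
    · simp [h]
    · obtain ⟨u, hu, hmax⟩ := Finset.exists_max_image _ id h
      have huv := (Finset.mem_filter.1 hu).2
      have h1 : Finset.univ.filter (fun w => w < v) = Finset.univ.filter (fun w => w ≤ u) := by
        ext w
        simp only [Finset.mem_filter, Finset.mem_univ, true_and]
        exact ⟨fun hw => hmax w (by simpa using hw), fun hw => hw.trans_lt huv⟩
      have h2 : (Finset.univ.filter (fun w => w < v)).sup G = G u :=
        le_antisymm (Finset.sup_le fun w hw => hG (hmax w hw)) (Finset.le_sup hu)
      have h3 := ih u huv
      rw [partialSums] at h3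
      rw [h2]
      nth_rw 1 [h1]
      rw [h3]
      exact Nat.sub_add_cancel (hG huv.le)

theorem adjacent_iff_int {A : Type*} (f g : A → ℕ) : Adjacent f g ↔
    (∀ v, (f v : ℤ) - g v ∈ ({0, 1} : Set ℤ)) ∨ (∀ v, (g v : ℤ) - f v ∈ ({0, 1} : Set ℤ)) := by
  simp only [Adjacent, Pi.le_def, ← forall_and, Set.mem_insert_iff, Set.mem_singleton_iff,
    Pi.add_apply, Pi.one_apply]
  rw [or_comm]
  refine or_congr (forall_congr' fun v => ?_) (forall_congr' fun v => ?_) <;> omega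

theorem partialSums_top [Nonempty W] (f : W → ℕ) :
    partialSums f (Finset.univ.max' Finset.univ_nonempty) = ∑ v, f v := by
  rw [partialSums]
  congr 1
  ext v
  simpa using Finset.le_max' _ v (Finset.mem_univ v)

/-- Summation is a bijection from the multisets of `m` vertices lying on a face of the edgewise
subdivision, with supports in `𝒰`, to the maps with sum `r * m` supported on a face. -/
theorem bijOn_edgewise {r m : ℕ} (hr : 0 < r) (hm : 0 < m)
    (K : AbstractSimplicialComplex W) (𝒰 : Set W) :
    Set.BijOn (fun M : Multiset (EdgewiseVertex r K) => (M.map Subtype.val).sum)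
      {M | M.card = m ∧ (∀ f ∈ M, ∀ v ∈ supp f.1, v ∈ 𝒰) ∧
        (∀ f ∈ M, ∀ g ∈ M, Adjacent (partialSums f.1) (partialSums g.1)) ∧
        supp (M.map Subtype.val).sum ∈ K.faces}
      {f | supp f ∈ K.faces ∧ (∀ v ∈ supp f, v ∈ 𝒰) ∧ ∑ v, f v = r * m} := by
  refine ⟨?_, ?_, ?_⟩
  · rintro M ⟨hc, hU, -, hK⟩
    refine ⟨hK, fun v hv => ?_, ?_⟩
    · obtain ⟨f, hf, hvf⟩ := (supp_multiset_sum _ v).1 hv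
      obtain ⟨g, hg, rfl⟩ := Multiset.mem_map.1 hf
      exact hU g hg v hvf
    · have h1 : ∑ v, (M.map Subtype.val).sum v = ((M.map Subtype.val).map
          (fun f : W → ℕ => ∑ v, f v)).sum :=
        map_multiset_sum (⟨⟨fun f : W → ℕ => ∑ v, f v, by simp⟩,
          by simp [Finset.sum_add_distrib]⟩ : (W → ℕ) →+ ℕ) _
      rw [h1, Multiset.map_map, Multiset.map_congr rfl (g := fun _ => r) (fun f _ => f.2.2)]
      simp [hc, mul_comm]
  · rintro M ⟨hc, -, hM, -⟩ M' ⟨hc', -, hM', -⟩ h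
    -- Adjacency is a condition on partial sums, so uniqueness of balanced multisets is applied to
    -- their images under `partialSums`.
    have hinj : Function.Injective (fun f : EdgewiseVertex r K => partialSums f.1) :=
      partialSums_injective.comp Subtype.val_injective
    apply Multiset.map_injective hinj
    have hbal : ∀ M : Multiset (EdgewiseVertex r K),
        (∀ f ∈ M, ∀ g ∈ M, Adjacent (partialSums f.1) (partialSums g.1)) →
        Balanced (M.map fun f => partialSums f.1) := by
      intro M hM x hx y hy
      obtain ⟨f, hf, rfl⟩ := Multiset.mem_map.1 hx
      obtain ⟨g, hg, rfl⟩ := Multiset.mem_map.1 hy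
      exact hM f hf g hg
    refine Balanced.ext (hbal M hM) (hbal M' hM') (by simp [hc, hc']) ?_
    · have := congrArg partialSums h
      simpa [partialSums_multiset_sum] using this
  · rintro f ⟨hK, hU, hsum⟩
    -- The even parts of a monotone function are monotone, hence are themselves partial sums of
    -- functions `g k`.
    have hmono : ∀ k, Monotone (evenPart m (partialSums f) k) := fun k u v huv =>
      Nat.div_le_div_right (Nat.add_le_add_right (partialSums_mono f huv) k)
    choose g hg using fun k => exists_partialSums_eq (hmono k)
    have hgsum : ∑ k ∈ Finset.range m, g k = f := by
      apply partialSums_injective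
      have := map_sum (partialSumsHom : (W → ℕ) →+ (W → ℕ)) g (Finset.range m)
      refine this.trans ?_
      refine (Finset.sum_congr rfl fun k _ => hg k).trans (sum_evenPart hm _)
    have hsub : ∀ k < m, ∀ v ∈ supp (g k), v ∈ supp f := fun k hk v hv => by
      rw [mem_supp, ← hgsum, Finset.sum_apply]
      have h1 := Finset.single_le_sum (f := fun k => g k v) (fun _ _ => Nat.zero_le _)
        (Finset.mem_range.2 hk)
      have h2 := mem_supp.1 hv
      omega
    have hne : Nonempty W := by
      obtain ⟨v, -⟩ := (K.isRelLowerSet_faces hK).1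
      exact ⟨v⟩
    -- The last partial sum is the total $rm$, and $\lfloor (rm+k)/m\rfloor=r$ for $k<m$.
    have htot : ∀ k < m, ∑ v, g k v = r := fun k hk => by
      rw [← partialSums_top, hg, evenPart, partialSums_top, hsum, mul_comm,
        Nat.mul_add_div hm, Nat.div_eq_of_lt hk, add_zero]
    have hface : ∀ k < m, supp (g k) ∈ K.faces := fun k hk => by
      refine (K.isRelLowerSet_faces hK).2 (hsub k hk) ?_
      by_contra hcon
      have h0 : ∑ v, g k v = 0 := Finset.sum_eq_zero fun v _ => by
        by_contra hv
        exact hcon ⟨v, mem_supp.2 hv⟩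
      have := htot k hk
      omega
    let M : Multiset (EdgewiseVertex r K) := (Multiset.range m).attach.map fun k =>
      ⟨g k.1, hface k.1 (Multiset.mem_range.1 k.2), htot k.1 (Multiset.mem_range.1 k.2)⟩
    have hMsum : (M.map Subtype.val).sum = f := by
      rw [Multiset.map_map]
      simp only [Function.comp_def]
      rw [Multiset.attach_map_val' (Multiset.range m) (fun k => g k)]
      exact hgsum
    have hmem : ∀ x ∈ M, ∃ k < m, x.1 = g k := by
      intro x hx
      obtain ⟨k, -, rfl⟩ := Multiset.mem_map.1 hx
      exact ⟨k.1, Multiset.mem_range.1 k.2, rfl⟩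
    refine ⟨M, ⟨by simp [M], ?_, ?_, hMsum ▸ hK⟩, hMsum⟩
    · intro x hx v hv
      obtain ⟨k, hk, h⟩ := hmem x hx
      exact hU v (hsub k hk v (h ▸ hv))
    · intro x hx y hy
      obtain ⟨k, hk, h⟩ := hmem x hx
      obtain ⟨j, hj, h'⟩ := hmem y hy
      rw [h, h', hg, hg]
      exact adjacent_evenPart _ hk hj

end Edgewise

/-! ### Chains of subsets -/

section Chains

variable {n : ℕ}

/-- The sum of the indicator vectors of a family of sets with multiplicities. -/
def levelSum (f : BaryVertex n → ℕ) (i : Fin n) : ℕ := ∑ S, if i ∈ S.1 then f S else 0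

/-- Some $i\in S$ lies only in those support sets that contain all of $S$. Otherwise every element
of $S$ lies in a support set not containing $S$; in a chain the largest such set would contain all
these elements, hence $S$. -/
theorem exists_sum_superset_eq {f : BaryVertex n → ℕ}
    (hf : ∀ S ∈ supp f, ∀ T ∈ supp f, S.1 ⊆ T.1 ∨ T.1 ⊆ S.1) (S : BaryVertex n) :
    ∃ i ∈ S.1, (∑ T, if S.1 ⊆ T.1 then f T else 0) = levelSum f i := by
  by_contra! hcon
  have h1 : ∀ i ∈ S.1, ∃ T ∈ supp f, i ∈ T.1 ∧ ¬ S.1 ⊆ T.1 := by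
    intro i hi
    by_contra! h
    refine hcon i hi (Finset.sum_congr rfl fun T _ => ?_)
    by_cases hT : f T = 0
    · simp [hT]
    · have : S.1 ⊆ T.1 ↔ i ∈ T.1 := ⟨fun hST => hST hi, fun hiT => h T (mem_supp.2 hT) hiT⟩
      simp only [this]
  obtain ⟨i₀, hi₀⟩ := S.2
  obtain ⟨T₀, hT₀, -, hT₀'⟩ := h1 i₀ hi₀
  obtain ⟨T, hT, hmax⟩ := Finset.exists_max_image
    ((supp f).filter (fun T => ¬ S.1 ⊆ T.1)) (fun T => T.1.card)
    ⟨T₀, Finset.mem_filter.2 ⟨hT₀, hT₀'⟩⟩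
  obtain ⟨hTf, hTS⟩ := Finset.mem_filter.1 hT
  refine hTS fun i hi => ?_
  obtain ⟨T', hT', hiT', hST'⟩ := h1 i hi
  rcases hf T hTf T' hT' with h | h
  · have := Finset.eq_of_subset_of_card_le h (hmax T' (Finset.mem_filter.2 ⟨hT', hST'⟩))
    rwa [this]
  · exact h hiT'

/-- The sum of $f$ over the supersets of $S$ is the minimum of `levelSum f` on $S$, so it is
determined by `levelSum f`. Induction from large sets to small ones then recovers $f(S)$. -/
theorem levelSum_injOn : Set.InjOn (levelSum (n := n))
    {f | ∀ S ∈ supp f, ∀ T ∈ supp f, S.1 ⊆ T.1 ∨ T.1 ⊆ S.1} := by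
  have hle : ∀ (f : BaryVertex n → ℕ) (S : BaryVertex n), ∀ i ∈ S.1,
      (∑ T, if S.1 ⊆ T.1 then f T else 0) ≤ levelSum f i := fun f S i hi => by
    refine Finset.sum_le_sum fun T _ => ?_
    by_cases h : S.1 ⊆ T.1
    · simp [h, h hi]
    · simp [h]
  intro f hf g hg h
  have key : ∀ S : BaryVertex n, (∑ T, if S.1 ⊆ T.1 then f T else 0) =
      ∑ T, if S.1 ⊆ T.1 then g T else 0 := by
    intro S
    obtain ⟨i, hi, h1⟩ := exists_sum_superset_eq hf S
    obtain ⟨j, hj, h2⟩ := exists_sum_superset_eq hg S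
    refine le_antisymm ?_ ?_
    · rw [h2, ← h]
      exact hle f S j hj
    · rw [h1, h]
      exact hle g S i hi
  have main : ∀ (d : ℕ) (S : BaryVertex n), n - S.1.card = d → f S = g S := by
    intro d
    induction d using Nat.strong_induction_on with
    | _ d ih =>
      intro S hS
      have hsplit : ∀ u : BaryVertex n → ℕ, (∑ T, if S.1 ⊆ T.1 then u T else 0) =
          u S + ∑ T ∈ Finset.univ.erase S, if S.1 ⊆ T.1 then u T else 0 := fun u => by
        rw [← Finset.add_sum_erase _ _ (Finset.mem_univ S)]
        simp
      have h1 := key S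
      rw [hsplit, hsplit] at h1
      have h2 : (∑ T ∈ Finset.univ.erase S, if S.1 ⊆ T.1 then f T else 0) =
          ∑ T ∈ Finset.univ.erase S, if S.1 ⊆ T.1 then g T else 0 := by
        refine Finset.sum_congr rfl fun T hT => ?_
        split_ifs with hST
        · have hss : S.1 ⊂ T.1 := lt_of_le_of_ne hST fun he =>
            (Finset.mem_erase.1 hT).1 (Subtype.ext he.symm)
          have hc := Finset.card_lt_card hss
          have hc' : T.1.card ≤ n := by simpa using Finset.card_le_univ T.1
          exact ih (n - T.1.card) (by omega) T rfl
        · rfl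
      omega
  ext S
  exact main _ S rfl

/-- `levelSum` is a bijection from the maps supported on chains of subsets of `F`, with sum `N`,
to the maps supported on `F` with maximum `N`. -/
theorem bijOn_levelSum {N : ℕ} (hN : 0 < N) (F : Finset (Fin n)) :
    Set.BijOn (levelSum (n := n))
      {f | supp f ∈ (barycentric n).complex.faces ∧ (∀ S ∈ supp f, S.1 ⊆ F) ∧ ∑ S, f S = N}
      {x | (∀ i ∉ F, x i = 0) ∧ (∀ i, x i ≤ N) ∧ ∃ i, x i = N} := by
  refine ⟨?_, levelSum_injOn.mono fun f hf => hf.1.2, ?_⟩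
  · rintro f ⟨⟨⟨S₀, hS₀⟩, hc⟩, hF, hsum⟩
    refine ⟨fun i hi => ?_, fun i => ?_, ?_⟩
    · refine Finset.sum_eq_zero fun S _ => ?_
      split_ifs with h
      · by_contra hS
        exact hi (hF S (mem_supp.2 hS) h)
      · rfl
    · rw [← hsum]
      refine Finset.sum_le_sum fun S _ => ?_
      split_ifs <;> simp
    -- The smallest support set is contained in all others, so each of its elements receives the
    -- whole sum $N$.
    · obtain ⟨S, hS, hmin⟩ := Finset.exists_min_image (supp f) (fun T => T.1.card) ⟨S₀, hS₀⟩
      obtain ⟨i, hi⟩ := S.2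
      refine ⟨i, ?_⟩
      rw [← hsum]
      refine Finset.sum_congr rfl fun T _ => ?_
      by_cases hT : f T = 0
      · simp [hT]
      · have hT' := mem_supp.2 hT
        have : S.1 ⊆ T.1 := by
          rcases hc S hS T hT' with h | h
          · exact h
          · rw [Finset.eq_of_subset_of_card_le h (hmin T hT')]
        simp [this hi]
  · rintro x ⟨hF, hle, i₀, hi₀⟩
    -- The inverse takes the superlevel sets at heights $0,\dots,N-1$ with multiplicity. They form a
    -- chain, and they are nonempty because the maximum $N$ is attained.
    let L : ℕ → Finset (Fin n) := fun k => Finset.univ.filter (fun i => k < x i)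
    have hL : ∀ k ∈ Finset.range N, (L k).Nonempty := fun k hk =>
      ⟨i₀, by simpa [L, hi₀] using hk⟩
    let f : BaryVertex n → ℕ := fun S => ((Finset.range N).filter (fun k => L k = S.1)).card
    have hsuppf : ∀ S ∈ supp f, ∃ k < N, L k = S.1 := fun S hS => by
      have h0 : f S ≠ 0 := mem_supp.1 hS
      obtain ⟨k, hk⟩ := Finset.card_pos.1 (Nat.pos_of_ne_zero h0)
      exact ⟨k, by simpa using (Finset.mem_filter.1 hk).1, (Finset.mem_filter.1 hk).2⟩
    have hLmono : ∀ j k, j ≤ k → L k ⊆ L j := fun j k hjk i hi => by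
      simp only [L, Finset.mem_filter, Finset.mem_univ, true_and] at hi ⊢
      omega
    have hsum : ∀ p : BaryVertex n → Prop, ∀ [DecidablePred p], ∀ q : ℕ → Prop,
        ∀ [DecidablePred q],
        (∀ k < N, ∀ S : BaryVertex n, L k = S.1 → (p S ↔ q k)) →
        (∑ S, if p S then f S else 0) = ((Finset.range N).filter q).card := by
      intro p _ q _ hpq
      rw [← Finset.sum_filter, ← Finset.card_biUnion]
      · congr 1
        ext k
        simp only [Finset.mem_biUnion, Finset.mem_filter, Finset.mem_univ, true_and,
          Finset.mem_range]
        constructor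
        · rintro ⟨S, hS, hk, hkS⟩
          exact ⟨hk, (hpq k hk S hkS).1 hS⟩
        · rintro ⟨hk, hq⟩
          have h1 := hL k (Finset.mem_range.2 hk)
          exact ⟨⟨L k, h1⟩, (hpq k hk ⟨L k, h1⟩ rfl).2 hq, hk, rfl⟩
      · intro S _ T _ hST
        rw [Function.onFun, Finset.disjoint_left]
        intro k hk hk'
        exact hST (Subtype.ext ((Finset.mem_filter.1 hk).2.symm.trans (Finset.mem_filter.1 hk').2))
    have htot : ∑ S, f S = N := by
      have := hsum (fun _ => True) (fun _ => True) (fun _ _ _ _ => Iff.rfl)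
      simpa using this
    refine ⟨f, ⟨⟨?_, ?_⟩, ?_, htot⟩, ?_⟩
    · by_contra hcon
      have h0 : ∑ S, f S = 0 := Finset.sum_eq_zero fun S _ => by
        by_contra hS
        exact hcon ⟨S, mem_supp.2 hS⟩
      omega
    · intro S hS T hT
      obtain ⟨k, -, hk⟩ := hsuppf S hS
      obtain ⟨j, -, hj⟩ := hsuppf T hT
      rw [← hk, ← hj]
      exact (le_total j k).imp (hLmono j k) (hLmono k j)
    · intro S hS i hi
      obtain ⟨k, -, hk⟩ := hsuppf S hS
      rw [← hk] at hi
      by_contra hiF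
      simp [L, hF i hiF] at hi
    · ext i
      have h1 := hsum (fun S => i ∈ S.1) (fun k => k < x i) (fun k _ S hS => by
        rw [← hS]
        simp [L])
      rw [levelSum, h1]
      have : (Finset.range N).filter (fun k => k < x i) = Finset.range (x i) := by
        ext k
        have := hle i
        simp only [Finset.mem_filter, Finset.mem_range]
        omega
      rw [this, Finset.card_range]

/-- The set is a difference of two boxes, with values below $rm+1$ and below $rm$. Positivity of
$rm$ makes the prescribed zeros outside $F$ compatible with both bounds. -/
theorem ncard_shell {r m : ℕ} (hr : 0 < r) (hm : 0 < m) (F : Finset (Fin n)) :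
    (Set.ncard {x : Fin n → ℕ | (∀ i ∉ F, x i = 0) ∧ (∀ i, x i ≤ r * m) ∧ ∃ i, x i = r * m} : ℤ) =
      shellCount r F.card m := by
  have hN : 0 < r * m := Nat.mul_pos hr hm
  let B : ℕ → Finset (Fin n → ℕ) := fun k =>
    Fintype.piFinset fun i => if i ∈ F then Finset.range k else {0}
  have hB : ∀ k, (B k).card = k ^ F.card := fun k => by
    rw [Fintype.card_piFinset]
    have : ∀ i, (if i ∈ F then Finset.range k else {0}).card = if i ∈ F then k else 1 := by
      intro i
      split_ifs <;> simp
    simp only [this]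
    rw [Finset.prod_ite_mem, Finset.univ_inter, Finset.prod_const]
  have hmemB : ∀ k, 0 < k → ∀ x : Fin n → ℕ, x ∈ B k ↔ (∀ i ∉ F, x i = 0) ∧ ∀ i, x i < k := by
    intro k hk x
    rw [Fintype.mem_piFinset]
    constructor
    · intro h
      refine ⟨fun i hi => by simpa [hi] using h i, fun i => ?_⟩
      by_cases hi : i ∈ F
      · simpa [hi] using h i
      · have := h i
        simp only [hi, if_false, Finset.mem_singleton] at this
        omega
    · rintro ⟨h1, h2⟩ i
      by_cases hi : i ∈ F
      · simpa [hi] using h2 i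
      · simpa [hi] using h1 i hi
  have hset : {x : Fin n → ℕ | (∀ i ∉ F, x i = 0) ∧ (∀ i, x i ≤ r * m) ∧ ∃ i, x i = r * m} =
      (B (r * m + 1) \ B (r * m) : Finset (Fin n → ℕ)) := by
    ext x
    rw [Finset.mem_coe, Finset.mem_sdiff, hmemB _ (Nat.succ_pos _), hmemB _ hN]
    simp only [Set.mem_ofPred_eq, Nat.lt_succ_iff]
    constructor
    · rintro ⟨h1, h2, i, hi⟩
      exact ⟨⟨h1, h2⟩, fun h => (h.2 i).ne hi⟩
    · rintro ⟨⟨h1, h2⟩, h3⟩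
      refine ⟨h1, h2, ?_⟩
      by_contra! hcon
      exact h3 ⟨h1, fun i => lt_of_le_of_ne (h2 i) (hcon i)⟩
  have hsub : B (r * m) ⊆ B (r * m + 1) := fun x hx => by
    rw [hmemB _ hN] at hx
    rw [hmemB _ (Nat.succ_pos _)]
    exact ⟨hx.1, fun i => (hx.2 i).trans (Nat.lt_succ_self _)⟩
  rw [hset, Set.ncard_coe_finset, Finset.cast_card_sdiff hsub, hB, hB, shellCount]
  split_ifs with h1 h2
  · omega
  · simp [h1]
  · push_cast
    ring

end Chains

/-! ### The face enumerators of the restrictions of `Γ_{n,r}` -/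

/-- The coefficient at $m=0$ counts the empty multiset alone and agrees with the convention in
`shellCount`, so only positive $m$ need counting. -/
theorem sum_geomTail_pow_eq_shellSeries {W : Type*} [DecidableEq W] {r p : ℕ}
    {𝒢 : Finset (Finset W)} (h0 : ∅ ∈ 𝒢)
    (h : ∀ m, 0 < m →
      (Set.ncard {M : Multiset W | M.card = m ∧ M.toFinset ∈ 𝒢} : ℤ) = shellCount r p m) :
    ∑ G ∈ 𝒢, geomTail ^ G.card = shellSeries r p := by
  ext m
  rw [coeff_sum_geomTail_pow, shellSeries, PowerSeries.coeff_mk]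
  rcases Nat.eq_zero_or_pos m with rfl | hm
  · have : {M : Multiset W | M.card = 0 ∧ M.toFinset ∈ 𝒢} = {0} := by
      ext M
      simp only [Multiset.card_eq_zero, Set.mem_ofPred_eq, Set.mem_singleton_iff,
        and_iff_left_iff_imp]
      rintro rfl
      simpa using h0
    rw [this, Set.ncard_singleton, shellCount]
    split_ifs with hp h
    · rfl
    · omega
    · simp [zero_pow hp]
  · exact h m hm

theorem mem_simplexFace {V : Type*} [Fintype V] [DecidableEq V] {F : Finset V} {p : V → ℝ}
    (hp : p ∈ stdSimplex ℝ V) : p ∈ simplexFace F ↔ ∀ v ∉ F, p v = 0 := by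
  constructor
  · intro h v hv
    have hsub : simplexFace F ⊆ {p : V → ℝ | p v = 0} := by
      refine convexHull_min ?_ ?_
      · rintro _ ⟨w, hw, rfl⟩
        have : v ≠ w := fun h => hv (h ▸ hw)
        simp [this]
      · intro x hx y hy a b _ _ _
        simp only [Set.mem_ofPred_eq] at hx hy ⊢
        simp [hx, hy]
    exact hsub h
  · intro h
    have h1 : p = ∑ v ∈ F, p v • (Pi.single v 1 : V → ℝ) := by
      ext w
      by_cases hw : w ∈ F
      · simp [Finset.sum_apply, Pi.single_apply, hw]
      · simp [Finset.sum_apply, Pi.single_apply, hw, h w hw]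
    rw [h1]
    refine (convex_convexHull ℝ _).sum_mem (fun v _ => hp.1 v) ?_ fun v hv =>
      subset_convexHull ℝ _ ⟨v, hv, rfl⟩
    rw [← hp.2]
    exact Finset.sum_subset (Finset.subset_univ F) fun v _ hv => h v hv

theorem finite_edgewiseVertex {W : Type*} [Fintype W] (r : ℕ) (K : AbstractSimplicialComplex W) :
    Finite (EdgewiseVertex r K) := by
  refine Finite.of_injective (β := W → Fin (r + 1))
    (fun f v => ⟨f.1 v, Nat.lt_succ_of_le ?_⟩) fun f g h => ?_
  · exact (Finset.single_le_sum (f := f.1) (fun _ _ => Nat.zero_le _) (Finset.mem_univ v)).trans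
      f.2.2.le
  · ext v
    simpa using congrArg Fin.val (congrFun h v)

/-- The coordinates of a vertex $f$ are sums of nonnegative terms, so nothing cancels: the
$v$-coordinate vanishes exactly when no set in the support of $f$ contains $v$. -/
theorem mem_restrict_gamma {n r : ℕ} (hr : 0 < r) (ord : LinearOrder (BaryVertex n))
    (F : Finset (Fin n)) (G : Finset (EdgewiseVertex r (barycentric n).complex)) :
    G ∈ ((gamma n r ord).restrict F).faces ↔
      G ∈ (gamma n r ord).complex.faces ∧ ∀ f ∈ G, ∀ S ∈ supp f.1, S.1 ⊆ F := by
  refine and_congr_right fun _ => ?_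
  have hpos : ∀ f : EdgewiseVertex r (barycentric n).complex,
      (gamma n r ord).pos f ∈ simplexFace F ↔ ∀ S ∈ supp f.1, S.1 ⊆ F := by
    intro f
    rw [mem_simplexFace ((gamma n r ord).pos_mem f)]
    have hr' : (r : ℝ) ≠ 0 := by exact_mod_cast hr.ne'
    have hval : ∀ v, (gamma n r ord).pos f v = ∑ S : BaryVertex n, (f.1 S : ℝ) / r *
        (if v ∈ S.1 then (S.1.card : ℝ)⁻¹ else 0) := by
      intro v
      change (∑ S : BaryVertex n, ((f.1 S : ℝ) / r) • (barycentric n).pos S) v = _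
      rw [Finset.sum_apply]
      rfl
    have hzero : ∀ v, (gamma n r ord).pos f v = 0 ↔ ∀ S ∈ supp f.1, v ∉ S.1 := by
      intro v
      rw [hval, Finset.sum_eq_zero_iff_of_nonneg]
      · simp only [Finset.mem_univ, forall_const, mul_eq_zero, div_eq_zero_iff, hr', or_false,
          Nat.cast_eq_zero, mem_supp]
        refine forall_congr' fun S => ?_
        have hS : (S.1.card : ℝ) ≠ 0 := by exact_mod_cast S.2.card_pos.ne'
        by_cases hv : v ∈ S.1
        · simp [hv, hS]
        · simp [hv]
      · intro S _
        split_ifs <;> positivity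
    simp only [hzero]
    constructor
    · intro h S hS v hv
      by_contra hvF
      exact h v hvF S hS hv
    · intro h v hv S hS hvS
      exact hv (h S hS hvS)
  constructor
  · intro h f hf
    exact (hpos f).1 (h (subset_convexHull ℝ _ ⟨f, hf, rfl⟩))
  · intro h
    refine convexHull_min ?_ (convex_convexHull ℝ _)
    rintro _ ⟨f, hf, rfl⟩
    exact (hpos f).2 (h f hf)

theorem mem_esd_faces {W : Type*} [Fintype W] [LinearOrder W] {r : ℕ}
    (K : AbstractSimplicialComplex W) (G : Finset (EdgewiseVertex r K)) :
    G ∈ (esd r K).faces ↔ G.Nonempty ∧ G.biUnion (fun f => supp f.1) ∈ K.faces ∧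
      ∀ f ∈ G, ∀ g ∈ G, Adjacent (partialSums f.1) (partialSums g.1) := by
  simp only [adjacent_iff_int]
  rfl

theorem biUnion_supp_toFinset {W : Type*} [Fintype W] [LinearOrder W] {r : ℕ}
    {K : AbstractSimplicialComplex W} [DecidableEq (EdgewiseVertex r K)]
    (M : Multiset (EdgewiseVertex r K)) :
    M.toFinset.biUnion (fun f => supp f.1) = supp (M.map Subtype.val).sum := by
  ext v
  rw [supp_multiset_sum]
  simp

/-- The composition of `bijOn_edgewise` and `bijOn_levelSum`; the ordering of the barycentric
vertices drops out of the count. -/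
theorem ncard_restrict_esd {n r m : ℕ} (hr : 0 < r) (hm : 0 < m) [LinearOrder (BaryVertex n)]
    [DecidableEq (EdgewiseVertex r (barycentric n).complex)] (F : Finset (Fin n)) :
    (Set.ncard {M : Multiset (EdgewiseVertex r (barycentric n).complex) | M.card = m ∧
      M.toFinset ∈ (BinomialEulerian.esd r (barycentric n).complex).faces ∧
      ∀ f ∈ M.toFinset, ∀ S ∈ supp f.1, S.1 ⊆ F} : ℤ) = shellCount r F.card m := by
  have h1 := bijOn_edgewise hr hm (barycentric n).complex {S | S.1 ⊆ F}
  have h2 := bijOn_levelSum (Nat.mul_pos hr hm) F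
  rw [← ncard_shell hr hm F, ← h2.image_eq, h2.injOn.ncard_image]
  have h3 : {f : BaryVertex n → ℕ | supp f ∈ (barycentric n).complex.faces ∧
      (∀ S ∈ supp f, S.1 ⊆ F) ∧ ∑ S, f S = r * m} =
      {f | supp f ∈ (barycentric n).complex.faces ∧
      (∀ S ∈ supp f, S ∈ {S : BaryVertex n | S.1 ⊆ F}) ∧ ∑ S, f S = r * m} := rfl
  rw [h3, ← h1.image_eq, h1.injOn.ncard_image]
  congr 2
  ext M
  simp only [Set.mem_ofPred_eq, mem_esd_faces, Multiset.mem_toFinset]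
  refine and_congr_right fun hc => ?_
  have hne : M.toFinset.Nonempty := by
    obtain ⟨f, hf⟩ := Multiset.card_pos_iff_exists_mem.1 (hc ▸ hm)
    exact ⟨f, Multiset.mem_toFinset.2 hf⟩
  rw [biUnion_supp_toFinset]
  tauto

theorem sum_restrict_gamma {n r : ℕ} (hr : 0 < r) (ord : LinearOrder (BaryVertex n))
    [DecidableEq (EdgewiseVertex r (barycentric n).complex)] (F : Finset (Fin n))
    (𝒢 : Finset (Finset (EdgewiseVertex r (barycentric n).complex)))
    (h𝒢 : ∀ G, G ∈ 𝒢 ↔ G = ∅ ∨ G ∈ ((gamma n r ord).restrict F).faces) :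
    ∑ G ∈ 𝒢, geomTail ^ G.card = shellSeries r F.card := by
  refine sum_geomTail_pow_eq_shellSeries ((h𝒢 _).2 (Or.inl rfl)) fun m hm => ?_
  rw [← @ncard_restrict_esd n r m hr hm ord _ F]
  congr 2
  ext M
  simp only [Set.mem_ofPred_eq, h𝒢, mem_restrict_gamma hr]
  refine and_congr_right fun hc => ?_
  have hne : M.toFinset ≠ ∅ := by
    obtain ⟨f, hf⟩ := Multiset.card_pos_iff_exists_mem.1 (hc ▸ hm)
    exact Finset.ne_empty_of_mem (Multiset.mem_toFinset.2 hf)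
  simp only [hne, false_or]
  rfl

theorem hPoly_sphere_gamma {n r : ℕ} (hn : 0 < n) (hr : 0 < r)
    (hA : ∀ p, (eulerPlus p r : PowerSeries ℤ) = (1 - PowerSeries.X) ^ p * shellSeries r p)
    (ord : LinearOrder (BaryVertex n)) :
    hPoly (gamma n r ord).sphere.toPreAbstractSimplicialComplex = binomEulerPlus n r := by
  classical
  have := finite_edgewiseVertex r (barycentric n).complex
  have := Fintype.ofFinite (EdgewiseVertex r (barycentric n).complex)
  have : Nonempty (Fin n) := ⟨⟨0, hn⟩⟩
  have h := hPoly_eq_binomEulerPlus (gamma n r ord).sphere.toPreAbstractSimplicialComplex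
    (Equiv.refl _) (fun F => Finset.univ.filter fun G => G = ∅ ∨
      G ∈ ((gamma n r ord).restrict F).faces) r (by simp) ?_ ?_ hA
  · rw [h, Fintype.card_fin]
  · intro S
    rw [Equiv.refl_toEmbedding, Finset.map_refl]
    simp only [Finset.mem_filter, Finset.mem_univ, true_and]
    refine and_congr_right fun _ => ⟨?_, fun h => ?_⟩
    · rintro ⟨I, G, rfl, h⟩
      rwa [Finset.toLeft_disjSum, Finset.toRight_disjSum]
    · exact ⟨S.toLeft, S.toRight, Finset.toLeft_disjSum_toRight.symm, h⟩
  · intro F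
    exact sum_restrict_gamma hr ord F _ (by simp)

/-! ### Words of colored letters, weighted by their runs -/

section Words

variable {r n : ℕ}

/-- A colored letter; letters are compared by color first. -/
abbrev Letter (r n : ℕ) : Type := Fin r ×ₗ Fin n

/-- The color of a letter. -/
def Letter.color (z : Letter r n) : Fin r := (ofLex z).1

/-- The letter without its color. -/
def Letter.idx (z : Letter r n) : Fin n := (ofLex z).2

open Letter

/-- The weight of the words starting with the letter `x`: a word is weighted by the product of the
weights `t (1 + t) ^ (ℓ - 2)` of its maximal decreasing runs, where `ℓ` is the length of the run;
runs of length one have weight zero, and the last letter has to have color zero. With `b` set to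
`true`, the letter `x` is not the first one of its run, and only a factor `t (1 + t) ^ j` of the
weight of this run is counted, where `j` is the number of the letters following `x`. -/
noncomputable def runWeight : Bool → Letter r n → List (Letter r n) → ℤ[X]
  | b, x, [] => if b = true ∧ (x.color : ℕ) = 0 then X else 0
  | b, x, y :: l =>
    if y < x then (if b then 1 + X else 1) * runWeight true y l
    else if b then X * runWeight false y l else 0

/-- The weight of a word. -/
noncomputable def wordWeight : List (Letter r n) → ℤ[X]
  | [] => 1
  | x :: l => runWeight false x l

/-- The letters, with all their colors, of a given set. -/
def letters (s : Finset (Fin n)) : Finset (Letter r n) := Finset.univ.filter (fun z => z.idx ∈ s)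

/-- The words of length `k` with distinct letters from `s`. -/
def words : ℕ → Finset (Fin n) → Finset (List (Letter r n))
  | 0, _ => {[]}
  | k + 1, s => (letters s).biUnion fun z => (words k (s.erase z.idx)).image (z :: ·)

theorem mem_words (k : ℕ) (s : Finset (Fin n)) (l : List (Letter r n)) :
    l ∈ words k s ↔ l.length = k ∧ (l.map idx).Nodup ∧ ∀ z ∈ l, z.idx ∈ s := by
  induction k generalizing s l with
  | zero =>
    simp only [words, Finset.mem_singleton, List.length_eq_zero_iff]
    constructor
    · rintro rfl
      simp
    · exact fun h => h.1
  | succ k ih =>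
    simp only [words, Finset.mem_biUnion, Finset.mem_image, ih, letters, Finset.mem_filter,
      Finset.mem_univ, true_and, Finset.mem_erase]
    constructor
    · rintro ⟨z, hz, l, ⟨hlen, hnd, hl⟩, rfl⟩
      refine ⟨by simp [hlen], ?_, ?_⟩
      · rw [List.map_cons, List.nodup_cons]
        refine ⟨fun h => ?_, hnd⟩
        obtain ⟨y, hy, hyz⟩ := List.mem_map.1 h
        exact (hl y hy).1 hyz
      · intro y hy
        rcases List.mem_cons.1 hy with rfl | hy
        · exact hz
        · exact (hl y hy).2
    · rintro ⟨hlen, hnd, hl⟩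
      cases l with
      | nil => simp at hlen
      | cons z l =>
        rw [List.map_cons, List.nodup_cons] at hnd
        refine ⟨z, hl z (by simp), l, ⟨by simpa using hlen, hnd.2, fun y hy => ⟨?_, ?_⟩⟩, rfl⟩
        · intro h
          exact hnd.1 (List.mem_map.2 ⟨y, hy, h⟩)
        · exact hl y (List.mem_cons_of_mem _ hy)

theorem sum_words_succ (k : ℕ) (s : Finset (Fin n)) (f : List (Letter r n) → ℤ[X]) :
    ∑ l ∈ words (k + 1) s, f l = ∑ z ∈ letters s, ∑ l ∈ words k (s.erase z.idx), f (z :: l) := by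
  rw [words, Finset.sum_biUnion]
  · refine Finset.sum_congr rfl fun z _ => Finset.sum_image fun a _ b _ h => by simpa using h
  · intro z _ z' _ hne
    rw [Function.onFun, Finset.disjoint_left]
    intro l hl hl'
    obtain ⟨a, -, rfl⟩ := Finset.mem_image.1 hl
    obtain ⟨b, -, hb⟩ := Finset.mem_image.1 hl'
    exact hne (List.cons.inj hb).1.symm

/-- The total weight of the words of length `k` with letters in `s`, when preceded by `x`. -/
noncomputable def runSum (b : Bool) (x : Letter r n) (k : ℕ) (s : Finset (Fin n)) : ℤ[X] :=
  ∑ l ∈ words k s, runWeight b x l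

/-- The total weight of the words with the set `s` of letters. -/
noncomputable def wordSum (r : ℕ) (s : Finset (Fin n)) : ℤ[X] :=
  ∑ l ∈ words (r := r) s.card s, wordWeight l

theorem runSum_zero (b : Bool) (x : Letter r n) (s : Finset (Fin n)) :
    runSum b x 0 s = if b = true ∧ (x.color : ℕ) = 0 then X else 0 := by
  simp [runSum, words, runWeight]

theorem runSum_true_succ (x : Letter r n) (k : ℕ) (s : Finset (Fin n)) :
    runSum true x (k + 1) s = ∑ z ∈ letters s, if z < x then
      (1 + X) * runSum true z k (s.erase z.idx) else X * runSum false z k (s.erase z.idx) := by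
  rw [runSum, sum_words_succ]
  refine Finset.sum_congr rfl fun z _ => ?_
  split_ifs with h <;> simp [runWeight, h, runSum, Finset.mul_sum]

theorem runSum_false_succ (x : Letter r n) (k : ℕ) (s : Finset (Fin n)) :
    runSum false x (k + 1) s = ∑ z ∈ letters s, if z < x then
      runSum true z k (s.erase z.idx) else 0 := by
  rw [runSum, sum_words_succ]
  refine Finset.sum_congr rfl fun z _ => ?_
  split_ifs with h <;> simp [runWeight, h, runSum]

theorem wordSum_empty : wordSum r (∅ : Finset (Fin n)) = 1 := by
  simp [wordSum, words, wordWeight]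

theorem wordSum_eq {k : ℕ} {s : Finset (Fin n)} (hs : s.card = k + 1) :
    wordSum r s = ∑ z ∈ letters (r := r) s, runSum false z k (s.erase z.idx) := by
  rw [wordSum, hs, sum_words_succ]
  rfl

/-- The number of colorings of `A` by which all colored letters come to lie in `D`. -/
def colorings (D : Finset (Letter r n)) (A : Finset (Fin n)) : ℕ :=
  ∏ a ∈ A, (D.filter (fun z => z.idx = a)).card

/-- Classification of the colorings by the largest colored letter. -/
theorem colorings_eq_sum (D : Finset (Letter r n)) {A : Finset (Fin n)} (hA : A.Nonempty) :
    colorings D A = ∑ z ∈ D, if z.idx ∈ A then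
      colorings (D.filter (fun w => w < z)) (A.erase z.idx) else 0 := by
  induction D using Finset.induction_on_max with
  | empty =>
    obtain ⟨a, ha⟩ := hA
    rw [Finset.sum_empty, colorings]
    exact Finset.prod_eq_zero ha (by simp)
  -- Adding a new maximum `z` leaves the old terms unchanged. The new colorings are those using `z`,
  -- with all other letters colored inside `D`.
  | insert z D hz ih =>
    have hzD : z ∉ D := fun h => lt_irrefl _ (hz z h)
    have h1 : (insert z D).filter (fun w => w < z) = D := by
      rw [Finset.filter_insert, if_neg (lt_irrefl _)]
      exact Finset.filter_true_of_mem hz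
    have h2 : ∀ y ∈ D, (insert z D).filter (fun w => w < y) = D.filter (fun w => w < y) := by
      intro y hy
      rw [Finset.filter_insert, if_neg (hz y hy).le.not_gt]
    have h3 : (∑ y ∈ D, if y.idx ∈ A then
        colorings ((insert z D).filter (fun w => w < y)) (A.erase y.idx) else 0) =
        colorings D A := by
      rw [ih]
      exact Finset.sum_congr rfl fun y hy => by rw [h2 y hy]
    have h4 : ∀ a, ((insert z D).filter (fun w => w.idx = a)).card =
        (D.filter (fun w => w.idx = a)).card + if z.idx = a then 1 else 0 := by
      intro a
      rw [Finset.filter_insert]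
      split_ifs with h
      · rw [Finset.card_insert_of_notMem (fun hmem => hzD (Finset.mem_filter.1 hmem).1)]
      · rfl
    rw [Finset.sum_insert hzD, h3, h1]
    split_ifs with hzA
    · rw [colorings, colorings, colorings, ← Finset.mul_prod_erase A _ hzA,
        ← Finset.mul_prod_erase A _ hzA, h4, if_pos rfl,
        Finset.prod_congr rfl (g := fun a => (D.filter (fun w => w.idx = a)).card)]
      · ring
      · intro a ha
        rw [h4, if_neg (Finset.ne_of_mem_erase ha).symm, add_zero]
    · rw [zero_add, colorings, colorings]
      refine Finset.prod_congr rfl fun a ha => ?_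
      rw [h4, if_neg (by rintro rfl; exact hzA ha), add_zero]

/-- The total weight of the words on `s` that are preceded by a decreasing block of letters
from `D`, a letter of the block being weighted by `c`. -/
noncomputable def blockSum (c : ℤ[X]) (D : Finset (Letter r n)) (s : Finset (Fin n)) : ℤ[X] :=
  ∑ A ∈ s.powerset, c ^ A.card * colorings D A * wordSum r (s \ A)

/-- The block is either empty or begins with its largest letter $z$; what remains is a block of
letters below $z$. A decreasing block is determined by its set of colored letters, which is why
`colorings` counts blocks. -/
theorem blockSum_eq (c : ℤ[X]) (D : Finset (Letter r n)) (s : Finset (Fin n)) :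
    blockSum c D s = wordSum r s + ∑ z ∈ letters s, if z ∈ D then
      c * blockSum c (D.filter (fun w => w < z)) (s.erase z.idx) else 0 := by
  have h1 : ∀ A ∈ s.powerset, c ^ A.card * colorings D A * wordSum r (s \ A) =
      (if A = ∅ then wordSum r s else 0) + ∑ z ∈ D, if z.idx ∈ A then c ^ A.card *
        (colorings (D.filter (fun w => w < z)) (A.erase z.idx) : ℤ[X]) * wordSum r (s \ A)
        else 0 := by
    intro A _
    split_ifs with h
    · subst h
      simp [colorings]
    · rw [zero_add, colorings_eq_sum D (Finset.nonempty_iff_ne_empty.2 h)]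
      push_cast
      rw [Finset.mul_sum, Finset.sum_mul]
      refine Finset.sum_congr rfl fun z _ => ?_
      split_ifs <;> simp
  have h2 : ∀ z : Letter r n, (∑ A ∈ s.powerset, if z.idx ∈ A then c ^ A.card *
        (colorings (D.filter (fun w => w < z)) (A.erase z.idx) : ℤ[X]) * wordSum r (s \ A)
        else 0) = if z.idx ∈ s then
          c * blockSum c (D.filter (fun w => w < z)) (s.erase z.idx) else 0 := by
    intro z
    split_ifs with hz
    · nth_rw 1 [← Finset.insert_erase hz]
      rw [Finset.sum_powerset_insert (Finset.notMem_erase _ _)]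
      rw [Finset.sum_eq_zero (s := (s.erase z.idx).powerset), zero_add, blockSum, Finset.mul_sum]
      · refine Finset.sum_congr rfl fun A hA => ?_
        have hzA : z.idx ∉ A := fun h => Finset.notMem_erase _ _ (Finset.mem_powerset.1 hA h)
        rw [if_pos (Finset.mem_insert_self _ _), Finset.card_insert_of_notMem hzA,
          Finset.erase_insert hzA]
        have : s \ insert z.idx A = s.erase z.idx \ A := by
          ext a
          simp only [Finset.mem_sdiff, Finset.mem_insert, Finset.mem_erase]
          tauto
        rw [this]
        ring
      · intro A hA
        rw [if_neg fun h => Finset.notMem_erase _ _ (Finset.mem_powerset.1 hA h)]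
    · refine Finset.sum_eq_zero fun A hA => if_neg fun h => hz (Finset.mem_powerset.1 hA h)
  rw [blockSum, Finset.sum_congr rfl h1, Finset.sum_add_distrib, Finset.sum_comm,
    Finset.sum_ite_eq' s.powerset ∅, if_pos (Finset.empty_mem_powerset s),
    Finset.sum_congr rfl (fun z _ => h2 z), ← Finset.sum_filter, ← Finset.sum_filter]
  congr 1
  refine Finset.sum_congr ?_ fun _ _ => rfl
  ext z
  simp [letters, and_comm]

/-- The letters smaller than `y`. -/
def below (y : Letter r n) : Finset (Letter r n) := Finset.univ.filter (fun z => z < y)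

theorem filter_below {y z : Letter r n} (h : z < y) :
    (below y).filter (fun w => w < z) = below z := by
  ext w
  simp only [below, Finset.mem_filter, Finset.mem_univ, true_and]
  exact ⟨fun h => h.2, fun hw => ⟨hw.trans h, hw⟩⟩

theorem blockSum_below (c : ℤ[X]) (y : Letter r n) (s : Finset (Fin n)) :
    blockSum c (below y) s = wordSum r s + ∑ z ∈ letters s, if z < y then
      c * blockSum c (below z) (s.erase z.idx) else 0 := by
  rw [blockSum_eq]
  congr 1
  refine Finset.sum_congr rfl fun z _ => ?_
  by_cases h : z < y
  · rw [if_pos (by simpa [below] using h), if_pos h, filter_below h]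
  · rw [if_neg (by simpa [below] using h), if_neg h]

theorem blockSum_univ (c : ℤ[X]) (s : Finset (Fin n)) :
    blockSum c (Finset.univ : Finset (Letter r n)) s = wordSum r s + ∑ z ∈ letters (r := r) s,
      c * blockSum c (below z) (s.erase z.idx) := by
  rw [blockSum_eq]
  simp [below]

/-- The letters of nonzero color. -/
def colored (D : Finset (Letter r n)) : Finset (Letter r n) :=
  D.filter (fun z => (z.color : ℕ) ≠ 0)

/-- The number of decreasing words beginning with `y`, followed by the letters of `s`, in which the
last letter has nonzero color. -/
def coloredRuns (y : Letter r n) (s : Finset (Fin n)) : ℕ :=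
  if (y.color : ℕ) = 0 then 0 else colorings (colored (below y)) s

theorem color_mono {y z : Letter r n} (h : z < y) : z.color ≤ y.color := by
  rcases Prod.Lex.lt_iff.1 h with h | h
  · exact h.le
  · exact h.1.le

/-- Colors weakly decrease along a decreasing run, so the last color is nonzero only if all are.
Continuations by a letter of color zero contribute nothing. -/
theorem coloredRuns_eq (y : Letter r n) {s : Finset (Fin n)} (hs : s.Nonempty) :
    coloredRuns y s = ∑ z ∈ letters s, if z < y then coloredRuns z (s.erase z.idx) else 0 := by
  rw [coloredRuns]
  split_ifs with hy
  · symm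
    refine Finset.sum_eq_zero fun z _ => ?_
    split_ifs with h
    · have : (z.color : ℕ) ≤ y.color := color_mono h
      rw [coloredRuns, if_pos (by omega)]
    · rfl
  · rw [colorings_eq_sum _ hs, ← Finset.sum_filter, ← Finset.sum_filter]
    have : (letters s).filter (fun z : Letter r n => z < y) =
        ((letters s).filter (fun z => z < y)).filter (fun z => (z.color : ℕ) = 0) ∪
          (colored (below y)).filter (fun z => z.idx ∈ s) := by
      ext z
      simp only [Finset.mem_union, Finset.mem_filter, letters, colored, below, Finset.mem_univ,
        true_and]
      tauto
    rw [this, Finset.sum_union]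
    · rw [Finset.sum_eq_zero (s := Finset.filter _ (Finset.filter _ _)), zero_add]
      · refine Finset.sum_congr rfl fun z hz => ?_
        obtain ⟨h1, h2⟩ := Finset.mem_filter.1 hz
        obtain ⟨h3, h4⟩ := Finset.mem_filter.1 h1
        rw [coloredRuns, if_neg h4, colored, Finset.filter_comm,
          filter_below (by simpa [below] using h3), colored]
      · intro z hz
        rw [coloredRuns, if_pos (Finset.mem_filter.1 hz).2]
    · rw [Finset.disjoint_left]
      intro z hz hz'
      simp only [Finset.mem_filter, colored] at hz hz'
      exact hz'.1.2 hz.2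

/-- Expand everything by the next letter $z$, writing $T,F,B,c$ for the values at $z$ of `runSum
true`, `runSum false`, `blockSum 1` and `coloredRuns`. If $z$ is not below $y$, both sides have the
term $tF$. If $z<y$, the left side has $t(T+F+B-c)$, which by induction is $tT+T=(1+t)T$, the term
on the right. The term $c$ repairs the words ending in a nonzero color. -/
theorem X_mul_runSum (k : ℕ) (s : Finset (Fin n)) (hs : s.card = k) (y : Letter r n) :
    X * (runSum false y k s + blockSum 1 (below y) s - (coloredRuns y s : ℤ[X])) =
      runSum true y k s := by
  induction k generalizing s y with
  | zero =>
    obtain rfl := Finset.card_eq_zero.1 hs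
    rw [blockSum_below, wordSum_empty, runSum_zero, runSum_zero]
    by_cases h : (y.color : ℕ) = 0 <;> simp [coloredRuns, colorings, letters, h]
  | succ k ih =>
    have hne : s.Nonempty := Finset.card_pos.1 (by omega)
    rw [runSum_true_succ, runSum_false_succ, blockSum_below, wordSum_eq hs, coloredRuns_eq y hne]
    push_cast
    rw [← Finset.sum_add_distrib, ← Finset.sum_add_distrib, ← Finset.sum_sub_distrib,
      Finset.mul_sum]
    refine Finset.sum_congr rfl fun z hz => ?_
    have hz' : z.idx ∈ s := (Finset.mem_filter.1 hz).2
    have := ih (s.erase z.idx) (by rw [Finset.card_erase_of_mem hz', hs]; rfl) z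
    split_ifs
    · linear_combination this
    · ring

/-- Only letters $z<y$ survive the expansion, the contributions of `wordSum` cancelling. For each of
these the claim is $t$ times the inductive instance minus $1-t$ times `X_mul_runSum`. -/
theorem runSum_add_blockSum (k : ℕ) (s : Finset (Fin n)) (hs : s.card = k) (y : Letter r n) :
    runSum false y k s + X * blockSum X (below y) s
      - X * (runSum false y k s + blockSum 1 (below y) s) =
      (X ^ (k + 1) - X) * (coloredRuns y s : ℤ[X]) := by
  induction k generalizing s y with
  | zero =>
    obtain rfl := Finset.card_eq_zero.1 hs
    rw [blockSum_below, blockSum_below, wordSum_empty, runSum_zero]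
    simp [letters]
  | succ k ih =>
    have hne : s.Nonempty := Finset.card_pos.1 (by omega)
    rw [runSum_false_succ, blockSum_below, blockSum_below, coloredRuns_eq y hne]
    push_cast
    have key : ∀ z ∈ letters s, (if z < y then runSum true z k (s.erase z.idx) else 0)
        + X * (if z < y then X * blockSum X (below z) (s.erase z.idx) else 0)
        - X * ((if z < y then runSum true z k (s.erase z.idx) else 0)
          + (if z < y then 1 * blockSum 1 (below z) (s.erase z.idx) else 0)) =
        (X ^ (k + 1 + 1) - X) * (if z < y then (coloredRuns z (s.erase z.idx) : ℤ[X]) else 0) := by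
      intro z hz
      have hz' : z.idx ∈ s := (Finset.mem_filter.1 hz).2
      have hc : (s.erase z.idx).card = k := by rw [Finset.card_erase_of_mem hz', hs]; rfl
      have h1 := ih (s.erase z.idx) hc z
      have h2 := X_mul_runSum k (s.erase z.idx) hc z
      split_ifs
      · linear_combination X * h1 - (1 - X) * h2
      · ring
    have := Finset.sum_congr rfl key
    simp only [Finset.sum_sub_distrib, Finset.sum_add_distrib, ← Finset.mul_sum] at this
    linear_combination this

/-- The preceding identity with no initial letter: sum it over all choices of the first letter. -/
theorem blockSum_univ_sub (s : Finset (Fin n)) :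
    blockSum X (Finset.univ : Finset (Letter r n)) s
      - X * blockSum 1 (Finset.univ : Finset (Letter r n)) s =
      (X ^ s.card - X) *
        (colorings (colored (Finset.univ : Finset (Letter r n))) s : ℤ[X]) := by
  rcases s.eq_empty_or_nonempty with rfl | hne
  · simp [blockSum, colorings, wordSum_empty]
  · obtain ⟨k, hk⟩ : ∃ k, s.card = k + 1 :=
      ⟨s.card - 1, (Nat.sub_add_cancel (Finset.card_pos.2 hne)).symm⟩
    have h1 : (colorings (colored (Finset.univ : Finset (Letter r n))) s : ℤ[X]) =
        ∑ z ∈ letters (r := r) s, (coloredRuns z (s.erase z.idx) : ℤ[X]) := by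
      rw [colorings_eq_sum _ hne]
      push_cast
      rw [colored, Finset.sum_filter, letters, Finset.sum_filter]
      refine Finset.sum_congr rfl fun z _ => ?_
      by_cases h : (z.color : ℕ) = 0
      · simp [h, coloredRuns]
      · simp only [ne_eq, h, not_false_eq_true, if_true, coloredRuns, if_false]
        rw [Finset.filter_comm]
        rfl
    rw [blockSum_univ, blockSum_univ, h1, wordSum_eq hk, hk]
    have key : ∀ z ∈ letters (r := r) s, runSum false z k (s.erase z.idx)
        + X * blockSum X (below z) (s.erase z.idx)
        - X * (runSum false z k (s.erase z.idx) + 1 * blockSum 1 (below z) (s.erase z.idx)) =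
        (X ^ (k + 1) - X) * (coloredRuns z (s.erase z.idx) : ℤ[X]) := by
      intro z hz
      have hz' : z.idx ∈ s := (Finset.mem_filter.1 hz).2
      have hc : (s.erase z.idx).card = k := by rw [Finset.card_erase_of_mem hz', hk]; rfl
      rw [one_mul]
      exact runSum_add_blockSum k _ hc z
    have := Finset.sum_congr rfl key
    simp only [Finset.sum_sub_distrib, Finset.sum_add_distrib, ← Finset.mul_sum] at this ⊢
    exact this

theorem card_filter_idx (a : Fin n) :
    ((Finset.univ : Finset (Letter r n)).filter (fun z => z.idx = a)).card = r := by
  have : (Finset.univ : Finset (Letter r n)).filter (fun z => z.idx = a) =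
      Finset.univ.image (fun c : Fin r => (toLex (c, a) : Letter r n)) := by
    ext z
    simp only [Finset.mem_filter, Finset.mem_univ, true_and, Finset.mem_image]
    constructor
    · rintro rfl
      exact ⟨z.color, rfl⟩
    · rintro ⟨c, rfl⟩
      rfl
  rw [this, Finset.card_image_of_injective, Finset.card_univ, Fintype.card_fin]
  intro c c' h
  exact congrArg Letter.color h

theorem card_filter_colored (a : Fin n) :
    ((colored (Finset.univ : Finset (Letter r n))).filter (fun z => z.idx = a)).card = r - 1 := by
  have : (colored (Finset.univ : Finset (Letter r n))).filter (fun z => z.idx = a) =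
      (Finset.univ.filter (fun c : Fin r => (c : ℕ) ≠ 0)).image
        (fun c : Fin r => (toLex (c, a) : Letter r n)) := by
    ext z
    simp only [colored, Finset.mem_filter, Finset.mem_univ, true_and, Finset.mem_image]
    constructor
    · rintro ⟨h, rfl⟩
      exact ⟨z.color, h, rfl⟩
    · rintro ⟨c, h, rfl⟩
      exact ⟨h, rfl⟩
  have hinj : Function.Injective (fun c : Fin r => (toLex (c, a) : Letter r n)) :=
    fun c c' h => congrArg Letter.color h
  rw [this, Finset.card_image_of_injective _ hinj]
  cases r with
  | zero => rfl
  | succ r =>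
    have : Finset.univ.filter (fun c : Fin (r + 1) => (c : ℕ) ≠ 0) = Finset.univ.erase 0 := by
      ext c
      simp only [Finset.mem_filter, Finset.mem_univ, true_and, Finset.mem_erase, and_true, ne_eq,
        Fin.ext_iff, Fin.val_zero]
    rw [this, Finset.card_erase_of_mem (Finset.mem_univ _)]
    simp

end Words

/-! ### Words and colored permutations -/

/-- The weight of a word in terms of its ascents: `p j` says that there is an ascent after the
letter number `j`. With `b` set to `true`, the word continues a decreasing run. -/
noncomputable def ascWeight : Bool → ℕ → (ℕ → Prop) → ℤ[X]
  | b, 0, _ => if b then 0 else 1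
  | b, k + 1, p => open Classical in
    if p 0 then (if b then X * ascWeight false k (fun j => p (j + 1)) else 0)
    else (if b then 1 + X else 1) * ascWeight true k (fun j => p (j + 1))

/-- No two consecutive ascents, an ascent at the end, and no ascent at the beginning. -/
def IsSparse (b : Bool) (k : ℕ) (p : ℕ → Prop) : Prop :=
  (∀ j, j + 1 < k → p j → ¬ p (j + 1)) ∧ (0 < k → p (k - 1)) ∧ if b then 0 < k else 0 < k → ¬ p 0

theorem isSparse_false_succ (k : ℕ) (p : ℕ → Prop) :
    IsSparse false (k + 1) p ↔ ¬ p 0 ∧ IsSparse true k (fun j => p (j + 1)) := by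
  simp only [IsSparse, Bool.false_eq_true, if_false, if_true, Nat.succ_pos, true_imp_iff,
    Nat.add_sub_cancel]
  constructor
  · rintro ⟨h1, h2, h3⟩
    have hk : 0 < k := by
      rcases Nat.eq_zero_or_pos k with rfl | hk
      · exact absurd h2 h3
      · exact hk
    refine ⟨h3, fun j hj => h1 (j + 1) (by omega), fun _ => ?_, hk⟩
    rwa [Nat.sub_add_cancel hk]
  · rintro ⟨h1, h2, h3, hk⟩
    refine ⟨fun j hj => ?_, ?_, h1⟩
    · cases j with
      | zero => exact fun h => absurd h h1
      | succ j => exact h2 j (by omega)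
    · have := h3 hk
      rwa [Nat.sub_add_cancel hk] at this

theorem isSparse_true_succ (k : ℕ) (p : ℕ → Prop) [Decidable (p 0)] : IsSparse true (k + 1) p ↔
    if p 0 then IsSparse false k (fun j => p (j + 1))
      else IsSparse true k (fun j => p (j + 1)) := by
  simp only [IsSparse, Bool.false_eq_true, if_false, if_true, Nat.succ_pos, true_imp_iff,
    Nat.add_sub_cancel, and_true, zero_add]
  split_ifs with h0
  · constructor
    · rintro ⟨h1, h2⟩
      refine ⟨fun j hj => h1 (j + 1) (by omega), fun hk => ?_, fun hk => h1 0 (by omega) h0⟩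
      rwa [Nat.sub_add_cancel hk]
    · rintro ⟨h1, h2, h3⟩
      refine ⟨fun j hj => ?_, ?_⟩
      · cases j with
        | zero => exact fun _ => h3 (by omega)
        | succ j => exact h1 j (by omega)
      · rcases Nat.eq_zero_or_pos k with rfl | hk
        · exact h0
        · have := h2 hk
          rwa [Nat.sub_add_cancel hk] at this
  · constructor
    · rintro ⟨h1, h2⟩
      have hk : 0 < k := by
        rcases Nat.eq_zero_or_pos k with rfl | hk
        · exact absurd h2 h0
        · exact hk
      refine ⟨fun j hj => h1 (j + 1) (by omega), fun _ => ?_, hk⟩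
      rwa [Nat.sub_add_cancel hk]
    · rintro ⟨h1, h2, hk⟩
      refine ⟨fun j hj => ?_, ?_⟩
      · cases j with
        | zero => exact fun h => absurd h h0
        | succ j => exact h1 j (by omega)
      · have := h2 hk
        rwa [Nat.sub_add_cancel hk] at this

-- Each ascent closes a run and contributes a factor $t$; every letter of a run other than its first
-- and last contributes $1+t$. With `b` set, the first letter of the current run has already been
-- read, whence the shift by `b.toNat`.
open Classical in
theorem ascWeight_eq (k : ℕ) : ∀ (b : Bool) (p : ℕ → Prop),
    (¬ IsSparse b k p → ascWeight b k p = 0) ∧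
    (IsSparse b k p → 2 * ((Finset.range k).filter p).card ≤ k + b.toNat ∧
      ascWeight b k p = X ^ ((Finset.range k).filter p).card *
        (1 + X) ^ (k + b.toNat - 2 * ((Finset.range k).filter p).card)) := by
  induction k with
  | zero =>
    intro b p
    cases b <;> simp [IsSparse, ascWeight]
  | succ k ih =>
    intro b p
    have hc : ((Finset.range (k + 1)).filter p).card =
        ((Finset.range k).filter (fun j => p (j + 1))).card + if p 0 then 1 else 0 := by
      rw [Finset.card_filter, Finset.card_filter, Finset.sum_range_succ']
    obtain ⟨hf, hf'⟩ := ih false (fun j => p (j + 1))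
    obtain ⟨ht, ht'⟩ := ih true (fun j => p (j + 1))
    rw [hc]
    generalize ((Finset.range k).filter (fun j => p (j + 1))).card = c at hf' ht' ⊢
    cases b with
    | false =>
      rw [isSparse_false_succ]
      by_cases h0 : p 0
      · simp [h0, ascWeight]
      · simp only [h0, not_false_eq_true, true_and, ascWeight, if_false, Bool.false_eq_true,
          one_mul, Bool.toNat_true, Bool.toNat_false, add_zero] at ht ht' ⊢
        exact ⟨ht, ht'⟩
    | true =>
      rw [isSparse_true_succ]
      by_cases h0 : p 0
      · simp only [h0, if_true, ascWeight, Bool.toNat_true, Bool.toNat_false, add_zero] at hf hf' ⊢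
        refine ⟨fun h => by rw [hf h, mul_zero], fun h => ?_⟩
        obtain ⟨h1, h2⟩ := hf' h
        refine ⟨by omega, ?_⟩
        rw [h2, show k + 1 + 1 - 2 * (c + 1) = k - 2 * c by omega]
        ring
      · simp only [h0, if_false, if_true, ascWeight, Bool.toNat_true, add_zero] at ht ht' ⊢
        refine ⟨fun h => by rw [ht h, mul_zero], fun h => ?_⟩
        obtain ⟨h1, h2⟩ := ht' h
        refine ⟨by omega, ?_⟩
        rw [h2, show k + 1 + 1 - 2 * c = (k + 1 - 2 * c) + 1 by omega]
        ring

/-- The weight depends only on the positions of the ascents. The final position counts as an ascent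
exactly when the last color is zero. -/
theorem runWeight_ofFn {r n : ℕ} (k : ℕ) : ∀ (b : Bool) (u : Fin (k + 1) → Letter r n)
    (p : ℕ → Prop) (_ : ∀ j (h : j < k), p j ↔ ¬ u ⟨j + 1, by omega⟩ < u ⟨j, by omega⟩)
    (_ : p k ↔ ((u (Fin.last k)).color : ℕ) = 0),
    runWeight b (u 0) (List.ofFn fun i : Fin k => u i.succ) = ascWeight b (k + 1) p := by
  induction k with
  | zero =>
    intro b u p _ h
    have h' : p 0 ↔ ((u 0).color : ℕ) = 0 := h
    cases b <;> by_cases h0 : p 0 <;>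
      simp [runWeight, ascWeight, h0, h'.1, mt h'.2]
  | succ k ih =>
    intro b u p hp hlast
    rw [List.ofFn_succ, runWeight]
    have h1 := fun b => ih b (fun i => u i.succ) (fun j => p (j + 1))
      (fun j hj => hp (j + 1) (by omega)) hlast
    have h0 : p 0 ↔ ¬ u 1 < u 0 := hp 0 (by omega)
    have h2 : (u (Fin.succ 0)) = u 1 := rfl
    rw [ascWeight, ← h1, ← h1]
    by_cases h : p 0
    · simp [h, h0.1 h]
    · have : u 1 < u 0 := by
        by_contra hc
        exact h (h0.2 hc)
      simp [h, this]

/-- The word of a colored permutation on the set `s` of letters. -/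
def ColoredPerm.word {r n k : ℕ} (w : ColoredPerm k r) (s : Finset (Fin n)) (hs : s.card = k) :
    List (Letter r n) :=
  List.ofFn fun j => toLex (w.2 j, s.orderEmbOfFin hs (w.1 j))

/-- Standardization: the increasing enumeration of $s$ carries permutations of positions to
arrangements of $s$ and preserves all comparisons of letters. -/
theorem sum_words_eq {r n k : ℕ} (s : Finset (Fin n)) (hs : s.card = k)
    (f : List (Letter r n) → ℤ[X]) :
    ∑ l ∈ words k s, f l = ∑ w : ColoredPerm k r, f (w.word s hs) := by
  symm
  refine Finset.sum_bij (fun w _ => w.word s hs) ?_ ?_ ?_ (fun _ _ => rfl)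
  · intro w _
    rw [mem_words]
    refine ⟨by simp [ColoredPerm.word], ?_, ?_⟩
    · rw [ColoredPerm.word, List.map_ofFn, List.nodup_ofFn]
      exact (s.orderEmbOfFin hs).injective.comp w.1.injective
    · intro z hz
      obtain ⟨j, rfl⟩ := List.mem_ofFn.1 hz
      exact s.orderEmbOfFin_mem hs _
  · intro w _ w' _ h
    have h1 := List.ofFn_injective h
    refine Prod.ext (Equiv.ext fun j => ?_) (funext fun j => ?_)
    · exact (s.orderEmbOfFin hs).injective (congrArg Letter.idx (congrFun h1 j))
    · exact congrArg Letter.color (congrFun h1 j)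
  · intro l hl
    obtain ⟨rfl, hnd, hmem⟩ := (mem_words _ _ _).1 hl
    have hsurj : ∀ j : Fin l.length, ∃ i, s.orderEmbOfFin hs i = l[j].idx := by
      intro j
      have : l[j].idx ∈ Set.range (s.orderEmbOfFin hs) := by
        rw [Finset.range_orderEmbOfFin]
        exact hmem _ (List.getElem_mem _)
      exact this
    choose σ hσ using hsurj
    have hinj : Function.Injective σ := by
      intro i j hij
      have h1 : l[i].idx = l[j].idx := by rw [← hσ, ← hσ, hij]
      have h2 := List.nodup_iff_injective_get.1 hnd
      have h3 : (l.map Letter.idx).get ⟨i, by simp⟩ = (l.map Letter.idx).get ⟨j, by simp⟩ := by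
        simpa using h1
      simpa [Fin.ext_iff] using h2 h3
    refine ⟨(Equiv.ofBijective σ (Finite.injective_iff_bijective.1 hinj),
      fun j => l[j].color), Finset.mem_univ _, ?_⟩
    refine List.ext_getElem (by simp [ColoredPerm.word]) fun j hj hj' => ?_
    simp only [ColoredPerm.word, List.getElem_ofFn, Equiv.ofBijective_apply, hσ]
    rfl

/-! ### Ascent sets of colored permutations and the polynomials $d^+$. -/

section Perm

variable {k r : ℕ}

theorem ColoredPerm.mem_asc_succ (w : ColoredPerm k r) {j : ℕ} (hj : j + 1 < k) :
    j + 1 ∈ w.asc ↔ ¬ ((w.2 ⟨j + 1, hj⟩ < w.2 ⟨j, by omega⟩) ∨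
      (w.2 ⟨j + 1, hj⟩ = w.2 ⟨j, by omega⟩ ∧ w.1 ⟨j + 1, hj⟩ < w.1 ⟨j, by omega⟩)) := by
  have h1 : j < k := by omega
  simp only [ColoredPerm.asc, Finset.mem_filter, Finset.mem_Icc, ColoredPerm.IsDescent,
    ColoredPerm.color, ColoredPerm.letter, Nat.add_sub_cancel, hj, h1, dif_pos, Fin.lt_def,
    Fin.ext_iff]
  omega

/-- The virtual letter after the end has color $0$ and exceeds all letters, so only a positive last
color can produce a descent there. -/
theorem ColoredPerm.mem_asc_last (w : ColoredPerm (k + 1) r) :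
    k + 1 ∈ w.asc ↔ (w.2 (Fin.last k) : ℕ) = 0 := by
  simp only [ColoredPerm.asc, Finset.mem_filter, Finset.mem_Icc, ColoredPerm.IsDescent,
    ColoredPerm.color, ColoredPerm.letter, Nat.add_sub_cancel, lt_irrefl, dif_neg, not_false_eq_true,
    Nat.lt_succ_self, dif_pos]
  have h := (w.1 (Fin.last k)).2
  simp only [Fin.last] at h ⊢
  omega

theorem ColoredPerm.wordWeight_word {n : ℕ} (w : ColoredPerm (k + 1) r) (s : Finset (Fin n))
    (hs : s.card = k + 1) :
    wordWeight (w.word s hs) = ascWeight false (k + 1) (fun j => j + 1 ∈ w.asc) := by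
  rw [ColoredPerm.word, List.ofFn_succ, wordWeight]
  refine runWeight_ofFn k false
    (fun j => (toLex (w.2 j, s.orderEmbOfFin hs (w.1 j)) : Letter r n)) _ ?_ ?_
  · intro j hj
    rw [w.mem_asc_succ (by omega), Prod.Lex.toLex_lt_toLex]
    simp
  · exact w.mem_asc_last

theorem ColoredPerm.asc_subset (w : ColoredPerm k r) : w.asc ⊆ Finset.Icc 1 k :=
  Finset.filter_subset _ _

theorem ColoredPerm.isSparse_iff (w : ColoredPerm k r) (hk : 0 < k) :
    IsSparse false k (fun j => j + 1 ∈ w.asc) ↔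
      w.asc ⊆ Finset.Icc 2 k ∧ (∀ j ∈ w.asc, j + 1 ∉ w.asc) ∧ k ∈ w.asc := by
  simp only [IsSparse, hk, true_imp_iff, Bool.false_eq_true, if_false]
  rw [Nat.sub_add_cancel hk]
  constructor
  · rintro ⟨h1, h2, h3⟩
    refine ⟨fun j hj => ?_, fun j hj hj' => ?_, h2⟩
    · have := Finset.mem_Icc.1 (w.asc_subset hj)
      refine Finset.mem_Icc.2 ⟨?_, this.2⟩
      by_contra hc
      obtain rfl : j = 1 := by omega
      exact h3 hj
    · have h4 := Finset.mem_Icc.1 (w.asc_subset hj)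
      have h5 := Finset.mem_Icc.1 (w.asc_subset hj')
      obtain ⟨i, rfl⟩ : ∃ i, j = i + 1 := ⟨j - 1, by omega⟩
      exact h1 i (by omega) hj hj'
  · rintro ⟨h1, h2, h3⟩
    refine ⟨fun j _ hj => h2 _ hj, h3, fun h => ?_⟩
    have := Finset.mem_Icc.1 (h1 h)
    omega

theorem ColoredPerm.card_filter_asc (w : ColoredPerm k r)
    [DecidablePred (fun j => j + 1 ∈ w.asc)] :
    ((Finset.range k).filter (fun j => j + 1 ∈ w.asc)).card = w.asc.card := by
  rw [← Finset.card_map ⟨Nat.succ, Nat.succ_injective⟩]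
  congr 1
  ext j
  simp only [Finset.mem_map, Finset.mem_filter, Finset.mem_range, Function.Embedding.coeFn_mk]
  constructor
  · rintro ⟨i, ⟨-, hi⟩, rfl⟩
    exact hi
  · intro hj
    have := Finset.mem_Icc.1 (w.asc_subset hj)
    have h1 : j - 1 + 1 = j := by omega
    exact ⟨j - 1, ⟨by omega, by rwa [h1]⟩, h1⟩

/-- The polynomial `d⁺` is the generating polynomial of the words by the weights of their runs. -/
theorem wordSum_eq_dPlus {n : ℕ} (s : Finset (Fin n)) : wordSum r s = dPlus s.card r := by
  rcases s.eq_empty_or_nonempty with rfl | hs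
  · simp [wordSum_empty, dPlus]
  obtain ⟨k, hk⟩ : ∃ k, s.card = k + 1 :=
    ⟨s.card - 1, (Nat.sub_add_cancel (Finset.card_pos.2 hs)).symm⟩
  rw [wordSum, hk, sum_words_eq s hk, dPlus, if_neg (Nat.succ_ne_zero k)]
  simp only [ColoredPerm.wordWeight_word]
  let P : ColoredPerm (k + 1) r → Prop := fun w =>
    w.asc ⊆ Finset.Icc 2 (k + 1) ∧ (∀ j ∈ w.asc, j + 1 ∉ w.asc) ∧ k + 1 ∈ w.asc
  have h1 : ∀ w : ColoredPerm (k + 1) r, ¬ P w →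
      ascWeight false (k + 1) (fun j => j + 1 ∈ w.asc) = 0 := fun w hw =>
    (ascWeight_eq _ _ _).1 (mt (w.isSparse_iff (Nat.succ_pos k)).1 hw)
  have h2 : ∀ w : ColoredPerm (k + 1) r, P w → 2 * w.asc.card ≤ k + 1 ∧
      ascWeight false (k + 1) (fun j => j + 1 ∈ w.asc) =
        X ^ w.asc.card * (1 + X) ^ (k + 1 - 2 * w.asc.card) := fun w hw => by
    have := (ascWeight_eq _ _ _).2 ((w.isSparse_iff (Nat.succ_pos k)).2 hw)
    rw [@ColoredPerm.card_filter_asc _ _ w (fun j => Classical.propDecidable _)] at this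
    exact this
  have : DecidablePred P := fun w => by
    unfold P
    infer_instance
  rw [← Finset.sum_filter_add_sum_filter_not Finset.univ P,
    Finset.sum_eq_zero (s := Finset.univ.filter (fun w => ¬ P w))
      (fun w hw => h1 w (Finset.mem_filter.1 hw).2), add_zero,
    ← Finset.sum_fiberwise_of_maps_to (s := Finset.univ.filter P)
      (t := Finset.Icc 1 ((k + 1) / 2)) (g := fun w => w.asc.card)]
  · refine Finset.sum_congr rfl fun i _ => ?_
    rw [Finset.sum_congr rfl (g := fun _ => X ^ i * (1 + X) ^ (k + 1 - 2 * i))]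
    · rw [Finset.sum_const, xiPlus, Finset.filter_filter, nsmul_eq_mul, mul_assoc]
      congr 1
      have : Finset.univ.filter (fun w : ColoredPerm (k + 1) r => P w ∧ w.asc.card = i) =
          Finset.univ.filter (fun w : ColoredPerm (k + 1) r => w.asc ⊆ Finset.Icc 2 (k + 1) ∧
            w.asc.card = i ∧ (∀ j ∈ w.asc, j + 1 ∉ w.asc) ∧ k + 1 ∈ w.asc) := by
        ext w
        simp only [P, Finset.mem_filter, Finset.mem_univ, true_and]
        tauto
      rw [this]
      simp
    · intro w hw
      obtain ⟨hw', rfl⟩ := Finset.mem_filter.1 hw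
      exact (h2 w (Finset.mem_filter.1 hw').2).2
  · intro w hw
    have hP := (Finset.mem_filter.1 hw).2
    have h3 := (h2 w hP).1
    have h4 : 0 < w.asc.card := Finset.card_pos.2 ⟨_, hP.2.2⟩
    rw [Finset.mem_Icc]
    omega

end Perm

/-- `blockSum_univ_sub` for the full alphabet: a $k$-element block has $r^k$ colorings, and all $n$
letters have $(r-1)^n$ colorings avoiding color zero. -/
theorem dPlus_recursion (n : ℕ) {r : ℕ} (hr : 0 < r) :
    ∑ k ∈ Finset.range (n + 1), (n.choose k : ℤ[X]) * ((r : ℤ[X]) * X) ^ k * dPlus (n - k) r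
      - X * ∑ k ∈ Finset.range (n + 1), (n.choose k : ℤ[X]) * (r : ℤ[X]) ^ k * dPlus (n - k) r =
      (X ^ n - X) * ((r : ℤ[X]) - 1) ^ n := by
  have h := blockSum_univ_sub (r := r) (Finset.univ : Finset (Fin n))
  have hb : ∀ c : ℤ[X], blockSum c (Finset.univ : Finset (Letter r n)) Finset.univ =
      ∑ k ∈ Finset.range (n + 1), (n.choose k : ℤ[X]) * ((r : ℤ[X]) * c) ^ k * dPlus (n - k) r := by
    intro c
    have h1 := Finset.sum_powerset_apply_card (fun m => ((r : ℤ[X]) * c) ^ m * dPlus (n - m) r)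
      (x := (Finset.univ : Finset (Fin n)))
    rw [Finset.card_univ, Fintype.card_fin] at h1
    simp only [nsmul_eq_mul, ← mul_assoc] at h1
    rw [blockSum, ← h1]
    refine Finset.sum_congr rfl fun A _ => ?_
    rw [wordSum_eq_dPlus, Finset.card_sdiff_of_subset (Finset.subset_univ _), Finset.card_univ,
      Fintype.card_fin, colorings, Finset.prod_congr rfl (fun a _ => card_filter_idx a),
      Finset.prod_const]
    push_cast
    ring
  rw [hb, hb, mul_one, colorings, Finset.prod_congr rfl (fun a _ => card_filter_colored a),
    Finset.prod_const, Finset.card_univ, Fintype.card_fin] at h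
  rw [h]
  push_cast [Nat.cast_sub (show 1 ≤ r from hr)]
  rfl

/-! ### Exponential generating functions -/

/-- The binomial convolution of two sequences. -/
def binomConv {R : Type*} [CommRing R] (f g : ℕ → R) (n : ℕ) : R :=
  ∑ k ∈ Finset.range (n + 1), (n.choose k : R) * f k * g (n - k)

/-- The exponential generating function of a sequence of power series. -/
noncomputable def egf (f : ℕ → PowerSeries ℤ) : PowerSeries (PowerSeries ℚ) :=
  PowerSeries.mk fun n => ((n.factorial : ℚ)⁻¹) • PowerSeries.map (Int.castRingHom ℚ) (f n)

theorem egf_injective : Function.Injective egf := by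
  intro f g h
  ext1 n
  have h1 := congrArg (PowerSeries.coeff n) h
  simp only [egf, PowerSeries.coeff_mk] at h1
  have h2 : ((n.factorial : ℚ)⁻¹) ≠ 0 := inv_ne_zero (by exact_mod_cast n.factorial_ne_zero)
  have h3 := smul_right_injective (PowerSeries ℚ) h2 h1
  ext m
  have h4 := congrArg (PowerSeries.coeff m) h3
  simpa using h4

theorem egf_mul (f g : ℕ → PowerSeries ℤ) : egf f * egf g = egf (binomConv f g) := by
  ext1 n
  rw [PowerSeries.coeff_mul, Finset.Nat.sum_antidiagonal_eq_sum_range_succ_mk]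
  simp only [egf, PowerSeries.coeff_mk, binomConv, map_sum, Finset.smul_sum]
  refine Finset.sum_congr rfl fun k hk => ?_
  have hk' : k ≤ n := Nat.lt_succ_iff.1 (Finset.mem_range.1 hk)
  rw [smul_mul_smul_comm, map_mul, map_mul, map_natCast, ← nsmul_eq_mul, smul_mul_assoc,
    ← Nat.cast_smul_eq_nsmul ℚ, smul_smul]
  congr 1
  rw [Nat.cast_choose ℚ hk']
  have : (n.factorial : ℚ) ≠ 0 := by exact_mod_cast n.factorial_ne_zero
  field_simp

theorem egf_sub (f g : ℕ → PowerSeries ℤ) : egf f - egf g = egf (f - g) := by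
  ext1 n
  simp [egf, smul_sub]

/-- Multiplication by a constant on the level of exponential generating functions. -/
noncomputable def egfConst (c : PowerSeries ℤ) : PowerSeries (PowerSeries ℚ) :=
  PowerSeries.C (PowerSeries.map (Int.castRingHom ℚ) c)

theorem egfConst_mul (c : PowerSeries ℤ) (f : ℕ → PowerSeries ℤ) :
    egfConst c * egf f = egf (fun n => c * f n) := by
  ext1 n
  rw [egfConst, PowerSeries.coeff_C_mul]
  simp [egf]

/-- The exponential function with parameter `a`. -/
noncomputable def egfExp (a : PowerSeries ℤ) : PowerSeries (PowerSeries ℚ) := egf fun n => a ^ n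

theorem egfExp_mul (a b : PowerSeries ℤ) : egfExp a * egfExp b = egfExp (a + b) := by
  rw [egfExp, egfExp, egf_mul, egfExp]
  congr 1
  ext1 n
  rw [binomConv, add_pow]
  exact Finset.sum_congr rfl fun k _ => by ring

theorem shellCount_eq (r p m : ℕ) : shellCount r p m =
    ((r * m + 1) ^ p - (r * m) ^ p : ℤ) + if p = 0 ∧ m = 0 then 1 else 0 := by
  rw [shellCount]
  rcases Nat.eq_zero_or_pos p with rfl | hp
  · simp
  · simp [hp.ne']

/-- At $t^{m+1}$ this is the binomial expansion of the powers of $r(m+1)+1=(rm+1)+r$ and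
$r(m+1)=rm+r$. The exceptional value of `shellCount` at $p=m=0$ produces the term $tr^n$. -/
theorem shellSeries_recursion (r n : ℕ) :
    shellSeries r n - PowerSeries.X * binomConv (shellSeries r) (fun k => (r : PowerSeries ℤ) ^ k) n
      = 1 - PowerSeries.X * (r : PowerSeries ℤ) ^ n := by
  ext m
  cases m with
  | zero =>
    simp only [map_sub, PowerSeries.coeff_zero_X_mul, sub_zero, shellSeries, PowerSeries.coeff_mk,
      PowerSeries.coeff_zero_one, shellCount]
    split_ifs with h
    · rfl
    · simp [zero_pow h]
  | succ m =>
    have hpow : ∀ k, (r : PowerSeries ℤ) ^ k = PowerSeries.C ((r : ℤ) ^ k) := fun k => by simp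
    have hcoe : ∀ k : ℕ, (k : PowerSeries ℤ) = PowerSeries.C (k : ℤ) := fun k => by simp
    have h1 : PowerSeries.coeff m (binomConv (shellSeries r) (fun k => (r : PowerSeries ℤ) ^ k) n) =
        ∑ k ∈ Finset.range (n + 1), (n.choose k : ℤ) * shellCount r k m * (r : ℤ) ^ (n - k) := by
      rw [binomConv, map_sum]
      refine Finset.sum_congr rfl fun k _ => ?_
      rw [hpow, hcoe, PowerSeries.coeff_mul_C, PowerSeries.coeff_C_mul, shellSeries,
        PowerSeries.coeff_mk]
    have h2 : ∑ k ∈ Finset.range (n + 1), (n.choose k : ℤ) * shellCount r k m * (r : ℤ) ^ (n - k) =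
        (r * m + 1 + r : ℤ) ^ n - (r * m + r : ℤ) ^ n + if m = 0 then (r : ℤ) ^ n else 0 := by
      simp only [shellCount_eq, mul_add, mul_sub, add_mul, sub_mul, Finset.sum_add_distrib,
        Finset.sum_sub_distrib]
      rw [add_pow, add_pow]
      congr 1
      · congr 1 <;> exact Finset.sum_congr rfl fun k _ => by ring
      · rw [Finset.sum_eq_single 0]
        · by_cases hm : m = 0 <;> simp [hm]
        · intro k _ hk
          simp [hk]
        · simp
    rw [map_sub, map_sub, PowerSeries.coeff_succ_X_mul, PowerSeries.coeff_succ_X_mul, h1, h2, hpow,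
      PowerSeries.coeff_C, shellSeries, PowerSeries.coeff_mk, shellCount_eq, PowerSeries.coeff_one,
      if_neg (Nat.succ_ne_zero m), if_neg (fun h => Nat.succ_ne_zero m h.2)]
    push_cast
    ring

/-- The polynomial `A⁺_{p,r}` is the numerator of the generating function of the numbers of
functions with prescribed maximum. -/
theorem eulerPlus_eq_shellSeries {r : ℕ} (hr : 0 < r) (p : ℕ) :
    (eulerPlus p r : PowerSeries ℤ) = (1 - PowerSeries.X) ^ p * shellSeries r p := by
  set t : PowerSeries ℤ := PowerSeries.X with ht
  set ρ : PowerSeries ℤ := (r : PowerSeries ℤ) with hρ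
  let d : ℕ → PowerSeries ℤ := fun n => (dPlus n r : PowerSeries ℤ)
  let a : ℕ → PowerSeries ℤ := fun n => (eulerPlus n r : PowerSeries ℤ)
  let g : ℕ → PowerSeries ℤ := fun n => (1 - t) ^ n * shellSeries r n
  -- `dPlus_recursion` as $(e^{rtx}-te^{rx})D=e^{(r-1)tx}-te^{(r-1)x}$.
  have hd : (egfExp (ρ * t) - egfConst t * egfExp ρ) * egf d =
      egfExp ((ρ - 1) * t) - egfConst t * egfExp (ρ - 1) := by
    rw [egfExp, egfExp, egfExp, egfExp, egfConst_mul, egfConst_mul, egf_sub, egf_sub, egf_mul]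
    congr 1
    ext1 n
    have h := congrArg (Polynomial.coeToPowerSeries.ringHom (R := ℤ)) (dPlus_recursion n hr)
    simp only [map_sub, map_mul, map_sum, map_pow, map_natCast, map_one,
      Polynomial.coeToPowerSeries.ringHom_apply, Polynomial.coe_X] at h
    rw [Finset.mul_sum, ← Finset.sum_sub_distrib] at h
    simp only [binomConv, Pi.sub_apply]
    rw [mul_pow, show (ρ - 1) ^ n * t ^ n - t * (ρ - 1) ^ n = (t ^ n - t) * (ρ - 1) ^ n by ring,
      ← h]
    exact Finset.sum_congr rfl fun k _ => by ring
  have ha : egf d * egfExp 1 = egf a := by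
    rw [egfExp, egf_mul]
    congr 1
    ext1 n
    simp only [a, eulerPlus, binomConv]
    rw [← Polynomial.coeToPowerSeries.ringHom_apply, map_sum]
    refine Finset.sum_congr rfl fun k _ => ?_
    simp only [d, map_mul, Polynomial.coeToPowerSeries.ringHom_apply, mul_one,
      one_pow, map_natCast]
  -- `shellSeries_recursion` scaled by $(1-t)^n$; this replaces $x$ by $(1-t)x$ in the generating
  -- function.
  have hg : (1 - egfConst t * egfExp (ρ * (1 - t))) * egf g =
      egfExp (1 - t) - egfConst t * egfExp (ρ * (1 - t)) := by
    rw [sub_mul, one_mul, mul_assoc, mul_comm (egfExp _) (egf g), egfExp, egfExp, egf_mul,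
      egfConst_mul, egfConst_mul, egf_sub, egf_sub]
    congr 1
    ext1 n
    simp only [Pi.sub_apply, binomConv, g]
    have h1 : ∑ k ∈ Finset.range (n + 1), (n.choose k : PowerSeries ℤ) *
        ((1 - t) ^ k * shellSeries r k) * (ρ * (1 - t)) ^ (n - k) =
        (1 - t) ^ n * binomConv (shellSeries r) (fun k => ρ ^ k) n := by
      rw [binomConv, Finset.mul_sum]
      refine Finset.sum_congr rfl fun k hk => ?_
      have hk' : k ≤ n := Nat.lt_succ_iff.1 (Finset.mem_range.1 hk)
      rw [← Nat.add_sub_cancel' hk', pow_add (1 - t), mul_pow, Nat.add_sub_cancel' hk']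
      ring
    rw [h1, mul_pow]
    linear_combination (1 - t) ^ n * shellSeries_recursion r n
  -- Multiplying `hd` by $e^{(1-rt)x}$ turns it into the same equation for $e^xD$, the generating
  -- function of $A^+$.
  have hprod : (1 - egfConst t * egfExp (ρ * (1 - t))) * egf a =
      egfExp (1 - t) - egfConst t * egfExp (ρ * (1 - t)) := by
    have e1 : egfExp (1 - ρ * t) * egfExp (ρ * t) = egfExp 1 := by
      rw [egfExp_mul]
      congr 1
      ring
    have e2 : egfExp (1 - ρ * t) * egfExp ρ = egfExp 1 * egfExp (ρ * (1 - t)) := by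
      rw [egfExp_mul, egfExp_mul]
      congr 1
      ring
    have e3 : egfExp (1 - ρ * t) * egfExp ((ρ - 1) * t) = egfExp (1 - t) := by
      rw [egfExp_mul]
      congr 1
      ring
    have e4 : egfExp (1 - ρ * t) * egfExp (ρ - 1) = egfExp (ρ * (1 - t)) := by
      rw [egfExp_mul]
      congr 1
      ring
    rw [← ha]
    linear_combination egfExp (1 - ρ * t) * hd - egf d * e1 + egfConst t * egf d * e2 + e3
      - egfConst t * e4
  -- The common factor has constant term $1-t\ne0$, so it cancels in the domain of power series.
  have hne : (1 - egfConst t * egfExp (ρ * (1 - t))) ≠ 0 := by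
    intro h0
    have h1 := congrArg (fun s => PowerSeries.coeff 0 (PowerSeries.coeff 0 s)) h0
    simp [egfConst, egfExp, egf, ht] at h1
  exact congrFun (egf_injective (mul_left_cancel₀ hne (hprod.trans hg.symm))) p

/-! ### Triangulations of the boundary of a cube -/

/-- The lattice points of the cube `[0, r]^n` with at least one coordinate equal to `r`. -/
abbrev CubePoint (n r : ℕ) : Type := {z : Fin n → ℕ // (∀ i, z i ≤ r) ∧ ∃ i, z i = r}

instance (n r : ℕ) : Finite (CubePoint n r) := by
  refine Finite.of_injective (β := Fin n → Fin (r + 1))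
    (fun z i => ⟨z.1 i, Nat.lt_succ_of_le (z.2.1 i)⟩) fun f g h => ?_
  ext i
  simpa using congrArg Fin.val (congrFun h i)

theorem Adjacent.le_of_sum_le {n : ℕ} {f g : Fin n → ℕ} (h : Adjacent f g)
    (hs : ∑ i, f i ≤ ∑ i, g i) : f ≤ g := by
  rcases h with h | h
  · exact h.1
  · have h1 : ∑ i, g i = ∑ i, f i := le_antisymm (Finset.sum_le_sum fun i _ => h.1 i) hs
    intro i
    exact ((Finset.sum_eq_sum_iff_of_le fun i _ => h.1 i).1 h1 i (Finset.mem_univ i)).ge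

/-- Pairwise adjacent points form a chain. A coordinate equal to $r$ at the smallest point is equal
to $r$ at all of them. -/
theorem exists_common_max {n r : ℕ} (G : Finset (CubePoint n r)) (hne : G.Nonempty)
    (hG : ∀ z ∈ G, ∀ w ∈ G, Adjacent z.1 w.1) : ∃ i, ∀ z ∈ G, z.1 i = r := by
  obtain ⟨w, hw, hmin⟩ := Finset.exists_min_image G (fun z => ∑ i, z.1 i) hne
  obtain ⟨i, hi⟩ := w.2.2
  refine ⟨i, fun z hz => le_antisymm (z.2.1 i) ?_⟩
  exact hi.ge.trans ((hG w hw z hz).le_of_sum_le (hmin z hz) i)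

/-- The target is that of `bijOn_levelSum` for $N=rm$, so this simpler complex has the same
enumerators as the restrictions of $\Gamma_{n,r}$. The inverse is even distribution: a maximum $rm$
splits into $m$ maxima $r$. -/
theorem bijOn_cubePoint {n r m : ℕ} (hm : 0 < m) (F : Finset (Fin n)) :
    Set.BijOn (fun M : Multiset (CubePoint n r) => (M.map Subtype.val).sum)
      {M | M.card = m ∧ (∀ z ∈ M, ∀ w ∈ M, Adjacent z.1 w.1) ∧ ∀ z ∈ M, ∀ i ∉ F, z.1 i = 0}
      {x | (∀ i ∉ F, x i = 0) ∧ (∀ i, x i ≤ r * m) ∧ ∃ i, x i = r * m} := by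
  classical
  have heval : ∀ (M : Multiset (CubePoint n r)) (i : Fin n),
      (M.map Subtype.val).sum i = (M.map fun z => z.1 i).sum := fun M i => by
    refine (map_multiset_sum (Pi.evalAddMonoidHom (fun _ => ℕ) i) _).trans ?_
    rw [Multiset.map_map]
    rfl
  refine ⟨?_, ?_, ?_⟩
  · rintro M ⟨hc, hM, hF⟩
    refine ⟨fun i hi => ?_, fun i => ?_, ?_⟩
    · dsimp only
      rw [heval]
      refine Multiset.sum_eq_zero fun y hy => ?_
      obtain ⟨z, hz, rfl⟩ := Multiset.mem_map.1 hy
      exact hF z hz i hi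
    · dsimp only
      rw [heval]
      have := Multiset.sum_le_card_nsmul (M.map fun z => z.1 i) r (fun y hy => by
        obtain ⟨z, -, rfl⟩ := Multiset.mem_map.1 hy
        exact z.2.1 i)
      simpa [hc, mul_comm] using this
    · have hne : M.toFinset.Nonempty := by
        obtain ⟨f, hf⟩ := Multiset.card_pos_iff_exists_mem.1 (hc ▸ hm)
        exact ⟨f, Multiset.mem_toFinset.2 hf⟩
      obtain ⟨i, hi⟩ := exists_common_max M.toFinset hne (by simpa using hM)
      refine ⟨i, ?_⟩
      dsimp only
      rw [heval, Multiset.map_congr rfl (g := fun _ => r)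
        (fun z hz => hi z (Multiset.mem_toFinset.2 hz))]
      simp [hc, mul_comm]
  · rintro M ⟨hc, hM, -⟩ M' ⟨hc', hM', -⟩ h
    have hbal : ∀ M : Multiset (CubePoint n r), (∀ z ∈ M, ∀ w ∈ M, Adjacent z.1 w.1) →
        Balanced (M.map Subtype.val) := by
      intro M hM x hx y hy
      obtain ⟨f, hf, rfl⟩ := Multiset.mem_map.1 hx
      obtain ⟨g, hg, rfl⟩ := Multiset.mem_map.1 hy
      exact hM f hf g hg
    exact Multiset.map_injective Subtype.val_injective
      (Balanced.ext (hbal M hM) (hbal M' hM') (by simp [hc, hc']) h)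
  · rintro x ⟨hF, hle, i, hi⟩
    have hcube : ∀ k < m, (∀ i, evenPart m x k i ≤ r) ∧ ∃ i, evenPart m x k i = r := by
      intro k hk
      have hval : ∀ j, evenPart m x k j ≤ r := fun j => by
        have := hle j
        rw [evenPart, Nat.div_le_iff_le_mul_add_pred hm]
        rw [mul_comm] at this
        omega
      refine ⟨hval, i, ?_⟩
      rw [evenPart, hi, mul_comm, Nat.mul_add_div hm, Nat.div_eq_of_lt hk, add_zero]
    let M : Multiset (CubePoint n r) := (Multiset.range m).attach.map fun k =>
      ⟨evenPart m x k.1, hcube k.1 (Multiset.mem_range.1 k.2)⟩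
    have hMsum : (M.map Subtype.val).sum = x := by
      rw [Multiset.map_map]
      simp only [Function.comp_def]
      rw [Multiset.attach_map_val' (Multiset.range m) (fun k => evenPart m x k)]
      exact sum_evenPart hm x
    have hmem : ∀ z ∈ M, ∃ k < m, z.1 = evenPart m x k := by
      intro z hz
      obtain ⟨k, -, rfl⟩ := Multiset.mem_map.1 hz
      exact ⟨k.1, Multiset.mem_range.1 k.2, rfl⟩
    refine ⟨M, ⟨by simp [M], ?_, ?_⟩, hMsum⟩
    · intro z hz w hw
      obtain ⟨k, hk, h⟩ := hmem z hz
      obtain ⟨j, hj, h'⟩ := hmem w hw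
      rw [h, h']
      exact adjacent_evenPart _ hk hj
    · intro z hz j hj
      obtain ⟨k, hk, h⟩ := hmem z hz
      rw [h, evenPart, hF j hj, zero_add, Nat.div_eq_of_lt hk]

/-- The vertices of the triangulated sphere: the new vertices, and the lattice points. -/
abbrev CubeVertex (n r : ℕ) : Type := Fin n ⊕ CubePoint n r

/-- The graph of the triangulated sphere (with a loop at every vertex). -/
def CubeAdj {n r : ℕ} : CubeVertex n r → CubeVertex n r → Prop
  | Sum.inl _, Sum.inl _ => True
  | Sum.inl i, Sum.inr z => z.1 i = 0
  | Sum.inr z, Sum.inl i => z.1 i = 0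
  | Sum.inr z, Sum.inr w => Adjacent z.1 w.1

/-- The faces of the triangulated sphere, including the empty one, are the cliques. -/
def IsCubeFace {n r : ℕ} (s : Finset (CubeVertex n r)) : Prop := ∀ v ∈ s, ∀ w ∈ s, CubeAdj v w

theorem IsCubeFace.subset {n r : ℕ} {s t : Finset (CubeVertex n r)} (hs : IsCubeFace s)
    (h : t ⊆ s) : IsCubeFace t := fun v hv w hw => hs v (h hv) w (h hw)

theorem isCubeFace_iff {n r : ℕ} (s : Finset (CubeVertex n r)) : IsCubeFace s ↔
    (∀ z ∈ s.toRight, ∀ w ∈ s.toRight, Adjacent z.1 w.1) ∧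
      ∀ z ∈ s.toRight, ∀ i ∈ s.toLeft, z.1 i = 0 := by
  constructor
  · intro h
    exact ⟨fun z hz w hw => h _ (Finset.mem_toRight.1 hz) _ (Finset.mem_toRight.1 hw),
      fun z hz i hi => h _ (Finset.mem_toRight.1 hz) _ (Finset.mem_toLeft.1 hi)⟩
  · rintro ⟨h1, h2⟩ (i | z) hv (j | w) hw
    · trivial
    · exact h2 w (Finset.mem_toRight.2 hw) i (Finset.mem_toLeft.2 hv)
    · exact h2 z (Finset.mem_toRight.2 hv) j (Finset.mem_toLeft.2 hw)
    · exact h1 z (Finset.mem_toRight.2 hv) w (Finset.mem_toRight.2 hw)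

theorem hPoly_eq_of_isCubeFace {n r : ℕ} (hn : 0 < n) (hr : 0 < r) {U : Type*}
    (K : PreAbstractSimplicialComplex U) (e : CubeVertex n r ≃ U)
    (hK : ∀ s : Finset (CubeVertex n r), s.map e.toEmbedding ∈ K.faces ↔
      s.Nonempty ∧ IsCubeFace s) : hPoly K = binomEulerPlus n r := by
  classical
  have := Fintype.ofFinite (CubePoint n r)
  have : Nonempty (Fin n) := ⟨⟨0, hn⟩⟩
  have h := hPoly_eq_binomEulerPlus K e (fun F => Finset.univ.filter fun G =>
    (∀ z ∈ G, ∀ w ∈ G, Adjacent z.1 w.1) ∧ ∀ z ∈ G, ∀ i ∉ F, z.1 i = 0) r (by simp) ?_ ?_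
    (eulerPlus_eq_shellSeries hr)
  · rw [h, Fintype.card_fin]
  · intro s
    rw [hK, isCubeFace_iff]
    simp
  · intro F
    refine sum_geomTail_pow_eq_shellSeries (by simp) fun m hm => ?_
    have h1 := bijOn_cubePoint (r := r) hm F
    rw [← ncard_shell hr hm F, ← h1.image_eq, h1.injOn.ncard_image]
    simp

/-! ### Polytopes from supporting functionals -/

section Abstract

variable {E V : Type*} [NormedAddCommGroup E] [NormedSpace ℝ E] [FiniteDimensional ℝ E] [Fintype V]

/-- A finite complex is the boundary complex of a simplicial polytope whose vertices are the points
`(φ v)⁻¹ • x v` if it can be recognized by supporting functionals. -/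
theorem exists_polytope [Nonempty V] [DecidableEq V] (x : V → E) (φ : V → ℝ) (hφ : ∀ v, 0 < φ v)
    (face : Finset V → Prop) (hsub : ∀ s t, face s → t ⊆ s → face t)
    (hsupp : ∀ t : Finset V, ∃ (l : StrongDual ℝ E) (s : Finset V), face s ∧
      (∀ v, l (x v) ≤ φ v) ∧ (∀ v, l (x v) = φ v ↔ v ∈ s) ∧
      ∑ v ∈ t, x v ∈ Submodule.span NNReal (x '' s) ∧ (face t → t ⊆ s) ∧ ∀ v, t = {v} → s = {v})
    (hli : ∀ s, face s → ∀ a : V → ℝ, ∑ v ∈ s, a v • x v = 0 → ∀ v ∈ s, a v = 0)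
    (hspan : ∀ l : StrongDual ℝ E, (∀ v, l (x v) ≤ 0) → l = 0) :
    ∃ (P : Polytope E) (e : V ≃ P.verts), P.dim = Module.finrank ℝ E ∧ P.IsSimplicial ∧
      ∀ s : Finset V, s.map e.toEmbedding ∈ P.boundaryComplex.faces ↔ s.Nonempty ∧ face s := by
  classical
  let p : V → E := fun v => (φ v)⁻¹ • x v
  have hlp : ∀ (l : StrongDual ℝ E) v, l (p v) * φ v = l (x v) := fun l v => by
    have := (hφ v).ne'
    simp only [p, map_smul, smul_eq_mul]
    field_simp
  have hle1 : ∀ (l : StrongDual ℝ E) v, l (x v) ≤ φ v → l (p v) ≤ 1 := fun l v h => by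
    rw [← hlp] at h
    have := hφ v
    by_contra! hc
    nlinarith
  have heq1 : ∀ (l : StrongDual ℝ E) v, l (p v) = 1 ↔ l (x v) = φ v := fun l v => by
    rw [← hlp]
    have := (hφ v).ne'
    constructor
    · intro h
      rw [h, one_mul]
    · intro h
      exact mul_right_cancel₀ this (by rw [h, one_mul])
  have hinj : Function.Injective p := by
    intro v w h
    obtain ⟨l, s, -, -, heq, -, -, hs⟩ := hsupp {v}
    have hs := hs v rfl
    have h1 : l (p v) = 1 := (heq1 l v).2 ((heq v).2 (by simp [hs]))
    rw [h, heq1, heq, hs, Finset.mem_singleton] at h1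
    exact h1.symm
  let verts : Finset E := Finset.univ.image p
  have hverts : (verts : Set E) = Set.range p := by simp [verts]
  have hmem : ∀ v, p v ∈ verts := fun v => Finset.mem_image_of_mem _ (Finset.mem_univ v)
  have hci : ConvexIndependent ℝ (Subtype.val : verts → E) := by
    refine (convexIndependent_set_iff_notMem_convexHull_sdiff (s := (verts : Set E))).2 ?_
    intro y hy hhull
    rw [hverts] at hy
    obtain ⟨v, rfl⟩ := hy
    obtain ⟨l, s, -, hle, heq, -, -, hs⟩ := hsupp {v}
    have hs := hs v rfl
    have h1 : l (p v) = 1 := (heq1 l v).2 ((heq v).2 (by simp [hs]))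
    have hsubset : convexHull ℝ ((verts : Set E) \ {p v}) ⊆ {y | l y < 1} := by
      refine convexHull_min ?_ (convex_halfSpace_lt l.toLinearMap.isLinear 1)
      rintro y ⟨hy, hyv⟩
      rw [hverts] at hy
      obtain ⟨w, rfl⟩ := hy
      refine lt_of_le_of_ne (hle1 l w (hle w)) fun h => hyv ?_
      rw [heq1, heq, hs, Finset.mem_singleton] at h
      simp [h]
    exact absurd h1 (hsubset hhull).ne
  let P : Polytope E := ⟨verts, hci⟩
  have hcar : P.carrier = convexHull ℝ (Set.range p) := by rw [← hverts]; rfl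
  have hpC : ∀ v, p v ∈ P.carrier := fun v => by
    rw [hcar]
    exact subset_convexHull ℝ _ ⟨v, rfl⟩
  have hCle : ∀ (l : StrongDual ℝ E) (c : ℝ), (∀ v, l (p v) ≤ c) → ∀ y ∈ P.carrier, l y ≤ c := by
    intro l c h
    rw [hcar]
    refine convexHull_min ?_ (convex_halfSpace_le l.toLinearMap.isLinear c)
    rintro _ ⟨v, rfl⟩
    exact h v
  have hnonpos : ∀ (l : StrongDual ℝ E), (∀ v, l (p v) ≤ 0) → l = 0 := fun l h =>
    hspan l fun v => by
      rw [← hlp]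
      exact mul_nonpos_of_nonpos_of_nonneg (h v) (hφ v).le
  -- Every proper face is contained in a face of the complex. Its exposing functional `l` is
  -- compared with the given functional `l'` for the sum of the vertex directions lying on it.
  have hA : ∀ F, P.IsProperFace F → ∃ s, face s ∧ ∀ v, p v ∈ F → v ∈ s := by
    rintro F ⟨hexp, hprop⟩
    by_cases hne : ∃ v, p v ∈ F
    · obtain ⟨v₀, hv₀⟩ := hne
      obtain ⟨l, hl⟩ := hexp ⟨_, hv₀⟩
      let t := Finset.univ.filter fun v => p v ∈ F
      set c := l (p v₀) with hc
      have hlc : ∀ v, l (p v) ≤ c := fun v => by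
        rw [hl] at hv₀
        exact hv₀.2 _ (hpC v)
      have htc : ∀ v ∈ t, l (p v) = c := fun v hv => by
        have hv := (Finset.mem_filter.1 hv).2
        rw [hl] at hv
        exact le_antisymm (hlc v) (hv.2 _ (hpC v₀))
      -- Otherwise `l` is nonpositive on all directions, hence zero, and exposes the whole polytope.
      have hcpos : 0 < c := by
        by_contra! hneg
        have h0 := hnonpos l fun v => (hlc v).trans hneg
        refine hprop (hl.trans ?_)
        simp [h0]
      obtain ⟨l', s, hs, hle, heq, hcone, -, -⟩ := hsupp t
      -- On the generators of the cone, `l (x v) ≤ c * φ v = c * l' (x v)`. Applied to the sum over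
      -- `t`, this forces `l' (x v) = φ v` for every `v` in `t`.
      have hineq : ∀ y ∈ Submodule.span NNReal (x '' s), l y ≤ c * l' y := by
        intro y hy
        induction hy using Submodule.span_induction with
        | mem y hy =>
          obtain ⟨v, hv, rfl⟩ := hy
          rw [(heq v).2 hv, ← hlp]
          exact mul_le_mul_of_nonneg_right (hlc v) (hφ v).le
        | zero => simp
        | add y z _ _ hy hz =>
          rw [map_add, map_add, mul_add]
          exact add_le_add hy hz
        | smul a y _ hy =>
          rw [NNReal.smul_def, map_smul, map_smul, smul_eq_mul, smul_eq_mul, mul_left_comm]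
          exact mul_le_mul_of_nonneg_left hy a.2
      have h1 := hineq _ hcone
      have h2 : l (∑ v ∈ t, x v) = c * ∑ v ∈ t, φ v := by
        rw [map_sum, Finset.mul_sum]
        refine Finset.sum_congr rfl fun v hv => ?_
        rw [← hlp, htc v hv]
      rw [h2, map_sum] at h1
      have h3 := le_of_mul_le_mul_left h1 hcpos
      have h4 := (Finset.sum_eq_sum_iff_of_le fun v (_ : v ∈ t) => hle v).1
        (le_antisymm (Finset.sum_le_sum fun v _ => hle v) h3)
      exact ⟨s, hs, fun v hv => (heq v).1 (h4 v (by simpa [t] using hv))⟩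
    -- No vertex lies in `F`, as for the empty face; any face of the complex serves.
    · obtain ⟨-, s, hs, -⟩ := hsupp ∅
      exact ⟨s, hs, fun v hv => absurd ⟨v, hv⟩ hne⟩
  have hB : ∀ t, t.Nonempty → face t → ∃ F, P.IsProperFace F ∧ ∀ v ∈ t, p v ∈ F := by
    rintro t ⟨v₀, hv₀⟩ ht
    obtain ⟨l, s, hs, hle, heq, -, hts, -⟩ := hsupp t
    have hval : ∀ v ∈ t, l (p v) = 1 := fun v hv => (heq1 l v).2 ((heq v).2 (hts ht hv))
    have hmax : ∀ v ∈ t, p v ∈ {y ∈ P.carrier | ∀ z ∈ P.carrier, l z ≤ l y} := fun v hv =>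
      ⟨hpC v, by
        rw [hval v hv]
        exact hCle l 1 fun w => hle1 l w (hle w)⟩
    refine ⟨{y ∈ P.carrier | ∀ z ∈ P.carrier, l z ≤ l y}, ⟨fun _ => ⟨l, rfl⟩, fun hC => ?_⟩, hmax⟩
    -- If the exposed face were everything, `l` would be at least `1` at every vertex, making `-l`
    -- nonpositive there.
    have h0 : -l = 0 := by
      refine hnonpos (-l) fun w => ?_
      have hw := hpC w
      rw [← hC] at hw
      have := hw.2 _ (hpC v₀)
      rw [hval v₀ hv₀] at this
      simp only [neg_apply]
      linarith
    have h1 := hval v₀ hv₀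
    rw [neg_eq_zero.1 h0] at h1
    simp at h1
  have hbij : Function.Bijective (fun v => (⟨p v, hmem v⟩ : P.verts)) := by
    refine ⟨fun v w h => hinj (congrArg Subtype.val h), ?_⟩
    rintro ⟨y, hy⟩
    obtain ⟨v, -, rfl⟩ := Finset.mem_image.1 hy
    exact ⟨v, rfl⟩
  let e : V ≃ P.verts := Equiv.ofBijective _ hbij
  have he : ∀ v, (e v : E) = p v := fun v => rfl
  refine ⟨P, e, ?_, ?_, ?_⟩
  · rw [Polytope.dim]
    suffices h : (affineSpan ℝ (P.verts : Set E)).direction = ⊤ by rw [h, finrank_top]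
    -- A functional killing the direction is constant on the vertices, so it or its negative is
    -- nonpositive on all of them, hence zero.
    by_contra hne
    obtain ⟨f, hf, hker⟩ := Submodule.exists_le_ker_of_lt_top _ (lt_top_iff_ne_top.2 hne)
    let l : StrongDual ℝ E := LinearMap.toContinuousLinearMap f
    obtain ⟨v₀⟩ := ‹Nonempty V›
    have hconst : ∀ v, l (p v) = l (p v₀) := fun v => by
      have h1 : p v -ᵥ p v₀ ∈ (affineSpan ℝ (P.verts : Set E)).direction :=
        AffineSubspace.vsub_mem_direction (subset_affineSpan ℝ _ (hmem v))
          (subset_affineSpan ℝ _ (hmem v₀))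
      have h2 : f (p v - p v₀) = 0 := hker h1
      rw [map_sub, sub_eq_zero] at h2
      exact h2
    have hl0 : l = 0 := by
      rcases le_total (l (p v₀)) 0 with h | h
      · exact hnonpos l fun v => (hconst v).trans_le h
      · refine neg_eq_zero.1 (hnonpos (-l) fun v => ?_)
        rw [neg_apply, hconst v]
        linarith
    apply hf
    ext y
    exact congrArg (fun g : StrongDual ℝ E => g y) hl0
  · intro F hF
    obtain ⟨s, hs, hFs⟩ := hA F hF
    have hlin : LinearIndependent ℝ (fun v : s => p v) := by
      rw [Fintype.linearIndependent_iff]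
      intro g hg v
      have h1 : ∑ w ∈ s, (if h : w ∈ s then g ⟨w, h⟩ * (φ w)⁻¹ else 0) • x w = 0 := by
        rw [← Finset.sum_coe_sort, ← hg]
        refine Finset.sum_congr rfl fun w _ => ?_
        rw [dif_pos w.2, mul_smul]
      have h2 := hli s hs _ h1 v v.2
      rw [dif_pos v.2] at h2
      exact (mul_eq_zero.1 h2).resolve_right (inv_ne_zero (hφ v).ne')
    have haff := hlin.affineIndependent
    let ι : {y : E // y ∈ P.verts ∧ y ∈ F} ↪ s :=
      { toFun := fun y => ⟨e.symm ⟨y.1, y.2.1⟩, hFs _ (by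
          rw [← he, Equiv.apply_symm_apply]
          exact y.2.2)⟩
        inj' := fun y z h => by
          have h1 : e.symm ⟨y.1, y.2.1⟩ = e.symm ⟨z.1, z.2.1⟩ := congrArg (fun v : s => v.1) h
          have h2 := congrArg (fun v : P.verts => v.1) (e.symm.injective h1)
          exact Subtype.ext h2 }
    have h1 := haff.comp_embedding ι
    have h2 : (fun v : s => p v) ∘ ι = Subtype.val := by
      funext y
      have h3 := he (e.symm ⟨y.1, y.2.1⟩)
      rw [Equiv.apply_symm_apply] at h3
      exact h3.symm
    rwa [h2] at h1
  · intro t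
    constructor
    · rintro ⟨hne, F, hF, h⟩
      obtain ⟨s, hs, hFs⟩ := hA F hF
      refine ⟨by simpa using hne, hsub s t hs fun v hv => hFs v ?_⟩
      exact h (e v) (Finset.mem_map_of_mem _ hv)
    · rintro ⟨hne, ht⟩
      obtain ⟨F, hF, h⟩ := hB t hne ht
      refine ⟨by simpa using hne, F, hF, fun y hy => ?_⟩
      obtain ⟨v, hv, rfl⟩ := Finset.mem_map.1 hy
      exact h v hv

end Abstract

/-! ### Supporting functionals of the triangulated sphere -/

/-- A quadratic polynomial which vanishes exactly at the integers next to `u / m`. -/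
theorem exists_tangent {m u r : ℤ} (hm : 0 < m) (h1 : -(r * m) ≤ u) (h2 : u ≤ r * m) :
    ∃ α β : ℤ, -(2 * r) ≤ α ∧ α ≤ 2 * r ∧ (0 ≤ u → 0 ≤ α) ∧ β ≤ r * r ∧
      ∀ z : ℤ, 0 ≤ z * z - α * z + β ∧ (z * z - α * z + β = 0 ↔ |m * z - u| < m) := by
  obtain ⟨a, ha⟩ : ∃ a, a = u / m := ⟨_, rfl⟩
  obtain ⟨b, hb⟩ : ∃ b, b = -((-u) / m) := ⟨_, rfl⟩
  have ha1 : a * m ≤ u := ha ▸ Int.ediv_mul_le u hm.ne'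
  have ha2 : u < (a + 1) * m := ha ▸ Int.lt_ediv_add_one_mul_self u hm
  have hb1 : u ≤ b * m := by
    have := Int.ediv_mul_le (-u) hm.ne'
    rw [hb]
    linarith
  have hb2 : (b - 1) * m < u := by
    have := Int.lt_ediv_add_one_mul_self (-u) hm
    rw [hb]
    linarith
  have hab : a ≤ b := le_of_mul_le_mul_right (ha1.trans hb1) hm
  have hba : b ≤ a + 1 := by
    have : b - 1 < a + 1 := lt_of_mul_lt_mul_right (hb2.trans ha2) hm.le
    omega
  have hra : -r ≤ a := by
    have : -r < a + 1 := lt_of_mul_lt_mul_right (a := m) (by linarith) hm.le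
    omega
  have hrb : b ≤ r := by
    have : b - 1 < r := lt_of_mul_lt_mul_right (a := m) (by linarith) hm.le
    omega
  -- The polynomial is $(z-a)(z-b)$ with $a=\lfloor u/m\rfloor$ and $b=\lceil u/m\rceil$; no integer
  -- lies strictly between these roots.
  refine ⟨a + b, a * b, by omega, by omega, fun hu => ?_, ?_, fun z => ?_⟩
  · have : 0 ≤ a := ha ▸ Int.ediv_nonneg hu hm.le
    omega
  · nlinarith
  · have hfac : z * z - (a + b) * z + a * b = (z - a) * (z - b) := by ring
    rw [hfac]
    constructor
    · rcases le_or_gt z a with h | h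
      · exact mul_nonneg_of_nonpos_of_nonpos (by omega) (by omega)
      · exact mul_nonneg (by omega) (by omega)
    · rw [mul_eq_zero, abs_lt]
      constructor
      · rintro (h | h)
        · obtain rfl : z = a := by omega
          constructor <;> linarith
        · obtain rfl : z = b := by omega
          constructor <;> linarith
      · rintro ⟨h3, h4⟩
        have h5 : z < b + 1 := lt_of_mul_lt_mul_right (a := m) (by linarith) hm.le
        have h6 : a < z + 1 := lt_of_mul_lt_mul_right (a := m) (by linarith) hm.le
        omega

theorem abs_sub_le_one_of_lt {m u a b : ℤ} (ha : |m * a - u| < m) (hb : |m * b - u| < m) :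
    |a - b| ≤ 1 := by
  rw [abs_lt] at ha hb
  have hm : 0 < m := by linarith
  have h1 : a - b < 2 := lt_of_mul_lt_mul_left (a := m) (by linarith) hm.le
  have h2 : -2 < a - b := lt_of_mul_lt_mul_left (a := m) (by linarith) hm.le
  rw [abs_le]
  omega

/-- A lattice point is close to `(r / m) x` if its coordinates, and the differences of its
coordinates, differ by less than one from those of `(r / m) x`. -/
def IsClose {n : ℕ} (r m : ℕ) (x z : Fin n → ℕ) : Prop :=
  (∀ i, |(m : ℤ) * z i - r * x i| < m) ∧
    ∀ i j, |(m : ℤ) * (z i - z j) - (r * x i - r * x j)| < m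

/-- The entries of $z-w$ lie in $\{-1,0,1\}$ and differ from one another by at most one, so $1$ and
$-1$ cannot both occur. -/
theorem IsClose.adjacent {n r m : ℕ} {x z w : Fin n → ℕ} (hz : IsClose r m x z)
    (hw : IsClose r m x w) : Adjacent z w := by
  have h1 : ∀ i, |(z i : ℤ) - w i| ≤ 1 := fun i => abs_sub_le_one_of_lt (hz.1 i) (hw.1 i)
  have h2 : ∀ i j, |((z i : ℤ) - z j) - (w i - w j)| ≤ 1 := fun i j =>
    abs_sub_le_one_of_lt (hz.2 i j) (hw.2 i j)
  simp only [abs_le] at h1 h2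
  by_cases h : z ≤ w
  · refine Or.inl ⟨h, fun i => ?_⟩
    have := h1 i
    simp only [Pi.add_apply, Pi.one_apply]
    omega
  · obtain ⟨i, hi⟩ : ∃ i, w i < z i := by
      by_contra! hc
      exact h hc
    refine Or.inr ⟨fun j => ?_, fun j => ?_⟩
    · have := h2 i j
      change w j ≤ z j
      omega
    · have := h1 j
      simp only [Pi.add_apply, Pi.one_apply]
      omega

/-- The height of the lattice point `z` above the boundary of the cube. -/
def cubeHeight {n : ℕ} (C : ℤ) (z : Fin n → ℕ) : ℤ :=
  ∑ i, (z i : ℤ) * z i + ∑ i, ∑ j, ((z i : ℤ) - z j) * (z i - z j) + C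

theorem sum_double_eq {n : ℕ} (α : Fin n → Fin n → ℤ) (z : Fin n → ℤ) :
    ∑ i, ∑ j, α i j * (z i - z j) = ∑ k, (∑ j, (α k j - α j k)) * z k := by
  simp only [mul_sub, Finset.sum_sub_distrib, sub_mul, Finset.sum_mul]
  congr 1
  exact Finset.sum_comm

/-- Apply `exists_tangent` to each coordinate and to each difference of coordinates, then add. A sum
of nonnegative terms vanishes only if all vanish, which is exactly closeness. The bounds on `κ` and
`B` are what allow constants in `cubeScale` that do not depend on `x`. -/
theorem exists_cube_functional {n r m : ℕ} (hm : 0 < m) (x : Fin n → ℕ) (hx : ∀ i, x i ≤ m) :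
    ∃ (κ : Fin n → ℤ) (B : ℤ), (∀ i, -(4 * n * r : ℤ) ≤ κ i) ∧ B ≤ (n + n * n) * (r * r) ∧
      ∀ z : Fin n → ℕ, 0 ≤ cubeHeight 0 z - ∑ i, κ i * z i + B ∧
        (cubeHeight 0 z - ∑ i, κ i * z i + B = 0 ↔ IsClose r m x z) := by
  have hm' : (0 : ℤ) < m := by exact_mod_cast hm
  have hrx : ∀ i, (r : ℤ) * x i ≤ r * m := fun i => by exact_mod_cast Nat.mul_le_mul_left r (hx i)
  have hrx0 : ∀ i, 0 ≤ (r : ℤ) * x i := fun i => by positivity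
  choose α β _h1 _h2 h3 h4 h5 using fun i => exists_tangent (u := (r : ℤ) * x i) hm'
    (by have := hrx0 i; have := hrx i; linarith) (hrx i)
  choose α' β' h1' h2' _h3' h4' h5' using fun i j => exists_tangent
    (u := (r : ℤ) * x i - r * x j) (r := r) hm' (by have := hrx0 i; have := hrx j; linarith)
    (by have := hrx0 j; have := hrx i; linarith)
  have hkey : ∀ z : Fin n → ℕ, cubeHeight 0 z - ∑ i, (α i + ∑ j, (α' i j - α' j i)) * z i +
      (∑ i, β i + ∑ i, ∑ j, β' i j) = ∑ i, ((z i : ℤ) * z i - α i * z i + β i) +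
        ∑ i, ∑ j, (((z i : ℤ) - z j) * (z i - z j) - α' i j * (z i - z j) + β' i j) := by
    intro z
    have := sum_double_eq α' (fun i => (z i : ℤ))
    simp only [Finset.sum_add_distrib, Finset.sum_sub_distrib (f := fun i => (z i : ℤ) * z i),
      Finset.sum_sub_distrib (f := fun j => ((z _ : ℤ) - z j) * (z _ - z j)),
      Finset.sum_sub_distrib (f := fun i => ∑ j, ((z i : ℤ) - z j) * (z i - z j)), add_mul, this,
      cubeHeight]
    ring
  have hnn : ∀ (z : Fin n → ℕ) (i : Fin n), i ∈ Finset.univ →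
      0 ≤ (z i : ℤ) * z i - α i * z i + β i := fun z i _ => (h5 i (z i)).1
  have hnn' : ∀ (z : Fin n → ℕ) (i j : Fin n), j ∈ Finset.univ →
      0 ≤ ((z i : ℤ) - z j) * (z i - z j) - α' i j * (z i - z j) + β' i j :=
    fun z i j _ => (h5' i j (z i - z j)).1
  have hnn'' : ∀ (z : Fin n → ℕ) (i : Fin n), i ∈ Finset.univ →
      0 ≤ ∑ j, (((z i : ℤ) - z j) * (z i - z j) - α' i j * (z i - z j) + β' i j) :=
    fun z i _ => Finset.sum_nonneg (hnn' z i)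
  refine ⟨fun i => α i + ∑ j, (α' i j - α' j i), ∑ i, β i + ∑ i, ∑ j, β' i j, fun i => ?_, ?_,
    fun z => ?_⟩
  · have h6 : ∑ _j : Fin n, (-(4 * r) : ℤ) ≤ ∑ j, (α' i j - α' j i) :=
      Finset.sum_le_sum fun j _ => by have := h1' i j; have := h2' j i; linarith
    have h7 := h3 i (hrx0 i)
    simp only [Finset.sum_const, Finset.card_univ, Fintype.card_fin, nsmul_eq_mul] at h6
    linarith
  · have h6 : ∑ i, β i ≤ ∑ _i : Fin n, ((r : ℤ) * r) := Finset.sum_le_sum fun i _ => h4 i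
    have h7 : ∑ i, ∑ j, β' i j ≤ ∑ _i : Fin n, ∑ _j : Fin n, ((r : ℤ) * r) :=
      Finset.sum_le_sum fun i _ => Finset.sum_le_sum fun j _ => h4' i j
    simp only [Finset.sum_const, Finset.card_univ, Fintype.card_fin, nsmul_eq_mul] at h6 h7
    linarith
  · rw [hkey]
    refine ⟨add_nonneg (Finset.sum_nonneg (hnn z)) (Finset.sum_nonneg (hnn'' z)), ?_⟩
    rw [add_eq_zero_iff_of_nonneg (Finset.sum_nonneg (hnn z)) (Finset.sum_nonneg (hnn'' z)),
      Finset.sum_eq_zero_iff_of_nonneg (hnn z), Finset.sum_eq_zero_iff_of_nonneg (hnn'' z), IsClose]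
    refine and_congr (forall_congr' fun i => ?_) (forall_congr' fun i => ?_)
    · simpa using (h5 i (z i)).2
    · rw [Finset.sum_eq_zero_iff_of_nonneg (hnn' z i)]
      simp only [Finset.mem_univ, forall_const]
      exact forall_congr' fun j => (h5' i j (z i - z j)).2

/-! ### The complex of lattice points and new vertices as a polytopal sphere. -/

section CubeSphere

variable {n r : ℕ}

/-- The directions of the vertices of the polytope, in integral coordinates. -/
def cubeCoord : CubeVertex n r → Fin n → ℤ
  | Sum.inl j, i => if i = j then -1 else 0
  | Sum.inr z, i => z.1 i

/-- The directions of the vertices of the polytope. -/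
noncomputable def cubeDir (v : CubeVertex n r) : EuclideanSpace ℝ (Fin n) :=
  WithLp.toLp 2 fun i => (cubeCoord v i : ℝ)

/-- The vertices of the polytope are obtained from their directions by dividing by this number. -/
def cubeScale : CubeVertex n r → ℤ
  -- Both constants exceed by one the bounds of `exists_cube_functional`, on `-κ i` here and on `B`
  -- below, so the inequalities needed later are strict.
  | Sum.inl _ => 4 * n * r + 1
  | Sum.inr z => cubeHeight ((n + n * n) * (r * r) + 1) z.1

theorem cubeHeight_eq (C : ℤ) (z : Fin n → ℕ) : cubeHeight C z = cubeHeight 0 z + C := by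
  simp [cubeHeight]

theorem cubeHeight_zero_nonneg (z : Fin n → ℕ) : 0 ≤ cubeHeight 0 z :=
  add_nonneg (add_nonneg (Finset.sum_nonneg fun _ _ => mul_self_nonneg _)
    (Finset.sum_nonneg fun _ _ => Finset.sum_nonneg fun _ _ => mul_self_nonneg _)) le_rfl

theorem cubeScale_pos (v : CubeVertex n r) : 0 < cubeScale v := by
  rcases v with i | z
  · simp only [cubeScale]
    positivity
  · simp only [cubeScale]
    rw [cubeHeight_eq]
    have := cubeHeight_zero_nonneg z.1
    positivity

/-- The vertices of the smallest face of the triangulated sphere whose cone contains the vector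
`X`, where `m` is the maximum of the coordinates of the positive part of `X`. -/
def InCarrier (X : Fin n → ℤ) (m : ℕ) : CubeVertex n r → Prop
  | Sum.inl i => X i < 0
  | Sum.inr z => IsClose r m (fun i => (X i).toNat) z.1

/-- Where $X_i<0$ the positive part vanishes, so closeness forces $z_i=0$; two lattice points close
to the same point are adjacent. -/
theorem InCarrier.adj {X : Fin n → ℤ} {m : ℕ} {v w : CubeVertex n r} (hv : InCarrier X m v)
    (hw : InCarrier X m w) : CubeAdj v w := by
  have key : ∀ (i : Fin n) (z : CubePoint n r), X i < 0 →
      IsClose r m (fun i => (X i).toNat) z.1 → z.1 i = 0 := by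
    intro i z hi hz
    have h := (hz.1 i)
    simp only [Int.toNat_of_nonpos hi.le, Nat.cast_zero, mul_zero, sub_zero] at h
    have hm : (0 : ℤ) < m := (abs_nonneg _).trans_lt h
    rw [abs_lt] at h
    have : (z.1 i : ℤ) < 1 := lt_of_mul_lt_mul_left (a := (m : ℤ)) (by linarith) hm.le
    omega
  rcases v with i | z <;> rcases w with j | w
  · trivial
  · exact key i w hv hw
  · exact key j z hw hv
  · exact IsClose.adjacent hv hw

/-- The linear functional with given coefficients. -/
noncomputable def coordFunctional (c : Fin n → ℝ) : StrongDual ℝ (EuclideanSpace ℝ (Fin n)) :=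
  ∑ i, c i • EuclideanSpace.proj (𝕜 := ℝ) i

theorem coordFunctional_cubeDir (c : Fin n → ℝ) (v : CubeVertex n r) :
    coordFunctional c (cubeDir v) = ∑ i, c i * cubeCoord v i := by
  simp [coordFunctional, cubeDir]

theorem coordFunctional_inl (c : Fin n → ℝ) (i : Fin n) :
    coordFunctional c (cubeDir (Sum.inl i : CubeVertex n r)) = - c i := by
  rw [coordFunctional_cubeDir]
  simp [cubeCoord]

/-- The case without positive coordinates. For $m=0$ closeness demands an absolute value below zero,
so only new vertices are in the carrier. -/
theorem exists_functional_zero (X : Fin n → ℤ) :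
    ∃ l : StrongDual ℝ (EuclideanSpace ℝ (Fin n)), ∀ v : CubeVertex n r,
      l (cubeDir v) ≤ cubeScale v ∧ (l (cubeDir v) = cubeScale v ↔ InCarrier X 0 v) := by
  have hM : (0 : ℝ) < 4 * n * r + 1 := by positivity
  refine ⟨coordFunctional fun i => if X i < 0 then -(4 * n * r + 1) else 0, ?_⟩
  rintro (i | z)
  · rw [coordFunctional_inl]
    simp only [cubeScale, InCarrier]
    push_cast
    split_ifs with h
    · simp [h]
    · simp only [neg_zero, h, iff_false]
      exact ⟨hM.le, hM.ne⟩
  · have h1 : coordFunctional (fun i => if X i < 0 then -(4 * n * r + 1 : ℝ) else 0)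
        (cubeDir (Sum.inr z)) < cubeScale (Sum.inr z : CubeVertex n r) := by
      refine lt_of_le_of_lt ?_ (Int.cast_pos.2 (cubeScale_pos (Sum.inr z)))
      rw [coordFunctional_cubeDir]
      refine Finset.sum_nonpos fun i _ => ?_
      have h2 : (0 : ℝ) ≤ (cubeCoord (Sum.inr z) i : ℝ) := by
        simp [cubeCoord]
      split_ifs
      · exact mul_nonpos_of_nonpos_of_nonneg (by linarith) h2
      · simp
    refine ⟨h1.le, iff_of_false h1.ne fun h => ?_⟩
    obtain ⟨i, -⟩ := z.2.2
    have h3 := (abs_nonneg _).trans_lt (h.1 i)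
    simp at h3

/-- The affine tangent function must be made linear: the constant $D$ is replaced by $Dz_{i_0}/r$,
which is at most $D$ on the cube and equals $D$ where $z_{i_0}=r$. For $X_i<0$ the coefficient is
lowered until the new vertex becomes tight. -/
theorem exists_functional_of_pos (hr : 0 < r) {X : Fin n → ℤ} {m : ℕ} (hm : 0 < m)
    (hX : ∀ i, X i ≤ m) {i₀ : Fin n} (hi₀ : X i₀ = m) :
    ∃ l : StrongDual ℝ (EuclideanSpace ℝ (Fin n)), ∀ v : CubeVertex n r,
      l (cubeDir v) ≤ cubeScale v ∧ (l (cubeDir v) = cubeScale v ↔ InCarrier X m v) := by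
  obtain ⟨κ, B, hκ, hB, hT⟩ := exists_cube_functional (r := r) hm (fun i => (X i).toNat)
    (fun i => by have := hX i; omega)
  have hr' : (0 : ℝ) < r := by exact_mod_cast hr
  obtain ⟨D, hD⟩ : ∃ D : ℤ, D = (n + n * n) * (r * r) + 1 - B := ⟨_, rfl⟩
  have hDpos : 0 < D := by rw [hD]; linarith
  have hDpos' : (0 : ℝ) < D := by exact_mod_cast hDpos
  have hM : ∀ i, (0 : ℝ) < 4 * n * r + 1 + κ i := fun i => by
    have h1 : (-(4 * n * r : ℤ) : ℝ) ≤ κ i := by exact_mod_cast hκ i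
    push_cast at h1
    linarith
  refine ⟨coordFunctional fun i => if X i < 0 then -(4 * n * r + 1 : ℝ) else
    κ i + if i = i₀ then (D : ℝ) / r else 0, ?_⟩
  rintro (i | z)
  · rw [coordFunctional_inl]
    simp only [cubeScale, InCarrier]
    push_cast
    split_ifs with h h'
    · simp [h]
    · have h1 : (0 : ℝ) ≤ (D : ℝ) / r := by positivity
      have := hM i
      refine ⟨by linarith, iff_of_false (by linarith) h⟩
    · have := hM i
      refine ⟨by linarith, iff_of_false (by linarith) h⟩
  · obtain ⟨h1, h2⟩ := hT z.1
    -- The slack at `z` is a sum of three nonnegative terms: tangency, distance from the facet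
    -- $z_{i_0}=r$, and a penalty for coordinates with $X_i<0$. Closeness makes all three vanish.
    have hval : (cubeScale (Sum.inr z : CubeVertex n r) : ℝ) - coordFunctional
        (fun i => if X i < 0 then -(4 * n * r + 1 : ℝ) else
          κ i + if i = i₀ then (D : ℝ) / r else 0) (cubeDir (Sum.inr z)) =
        ((cubeHeight 0 z.1 - ∑ i, κ i * z.1 i + B : ℤ) : ℝ) + D * (1 - z.1 i₀ / r) +
          ∑ i, if X i < 0 then (4 * n * r + 1 + κ i : ℝ) * z.1 i else 0 := by
      have hsplit : ∀ i, (if X i < 0 then -(4 * n * r + 1 : ℝ) else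
          κ i + if i = i₀ then (D : ℝ) / r else 0) * (z.1 i : ℝ) = κ i * z.1 i +
          (if i = i₀ then (D : ℝ) / r * z.1 i else 0) -
          if X i < 0 then (4 * n * r + 1 + κ i : ℝ) * z.1 i else 0 := by
        intro i
        by_cases h : i = i₀
        · subst h
          have : ¬ X i < 0 := by omega
          simp only [this, if_false, if_true]
          ring
        · simp only [h, if_false]
          split_ifs <;> ring
      rw [coordFunctional_cubeDir]
      simp only [cubeCoord, Int.cast_natCast, hsplit]
      rw [Finset.sum_sub_distrib, Finset.sum_add_distrib, Finset.sum_ite_eq' Finset.univ i₀,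
        if_pos (Finset.mem_univ _), cubeScale, cubeHeight_eq, hD]
      push_cast
      ring
    have hnn1 : (0 : ℝ) ≤ ((cubeHeight 0 z.1 - ∑ i, κ i * z.1 i + B : ℤ) : ℝ) := by
      exact_mod_cast h1
    have hz0 : (z.1 i₀ : ℝ) ≤ r := by exact_mod_cast z.2.1 i₀
    have hnn2 : (0 : ℝ) ≤ D * (1 - z.1 i₀ / r) :=
      mul_nonneg hDpos'.le (sub_nonneg.2 ((div_le_one hr').2 hz0))
    have hnn3 : (0 : ℝ) ≤ ∑ i, if X i < 0 then (4 * n * r + 1 + κ i : ℝ) * z.1 i else 0 := by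
      refine Finset.sum_nonneg fun i _ => ?_
      split_ifs
      · exact mul_nonneg (hM i).le (Nat.cast_nonneg _)
      · exact le_rfl
    refine ⟨by linarith, ⟨fun h => h2.1 ?_, fun h => ?_⟩⟩
    · have : ((cubeHeight 0 z.1 - ∑ i, κ i * z.1 i + B : ℤ) : ℝ) = 0 := by linarith
      exact_mod_cast this
    · have e1 : ((cubeHeight 0 z.1 - ∑ i, κ i * z.1 i + B : ℤ) : ℝ) = 0 := by
        exact_mod_cast h2.2 h
      have hm' : (0 : ℤ) < m := by exact_mod_cast hm
      have e2 : z.1 i₀ = r := by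
        have h3 := (abs_lt.1 (h.1 i₀)).1
        simp only [hi₀, Int.toNat_natCast] at h3
        have h4 : (r : ℤ) < z.1 i₀ + 1 :=
          lt_of_mul_lt_mul_left (a := (m : ℤ)) (by linarith) hm'.le
        have h5 := z.2.1 i₀
        omega
      have e3 : (∑ i, if X i < 0 then (4 * n * r + 1 + κ i : ℝ) * z.1 i else 0) = 0 := by
        refine Finset.sum_eq_zero fun i _ => ?_
        split_ifs with hi
        · have h3 : CubeAdj (Sum.inl i : CubeVertex n r) (Sum.inr z) :=
            InCarrier.adj (X := X) (m := m) hi h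
          have h4 : z.1 i = 0 := h3
          simp [h4]
        · rfl
      rw [e1, e2, e3, div_self hr'.ne'] at hval
      linarith

/-- The positive part of $X$, scaled by $r$, is distributed evenly over $m$ lattice points, all of
them close; the negative part is absorbed by the directions $-e_i$. -/
theorem mem_span_cubeDir (hr : 0 < r) {X : Fin n → ℤ} {m : ℕ} (hX : ∀ i, X i ≤ m)
    (hm : m = 0 ∨ ∃ i, X i = m) :
    (WithLp.toLp 2 fun i => (X i : ℝ) : EuclideanSpace ℝ (Fin n)) ∈
      Submodule.span NNReal (cubeDir '' {v : CubeVertex n r | InCarrier X m v}) := by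
  set x : Fin n → ℕ := fun i => (X i).toNat with hx
  have hxm : ∀ i, x i ≤ m := fun i => by have := hX i; simp only [hx]; omega
  have hmod : ∀ k i, (m : ℤ) * evenPart m (fun i => r * x i) k i =
      r * x i + k - ((r * x i + k) % m : ℕ) := fun k i => by
    have := Nat.div_add_mod (r * x i + k) m
    simp only [evenPart]
    have h2 : ((m * ((r * x i + k) / m) + (r * x i + k) % m : ℕ) : ℤ) = (r * x i + k : ℕ) := by
      rw [this]
    push_cast at h2 ⊢
    linarith
  have hcube : ∀ k < m, (∀ i, evenPart m (fun i => r * x i) k i ≤ r) ∧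
      ∃ i, evenPart m (fun i => r * x i) k i = r := by
    intro k hk
    have hm' : 0 < m := by omega
    refine ⟨fun i => ?_, ?_⟩
    · rw [evenPart, Nat.div_le_iff_le_mul_add_pred hm']
      have := Nat.mul_le_mul_left r (hxm i)
      rw [mul_comm r m] at this
      omega
    · obtain ⟨i, hi⟩ := hm.resolve_left (by omega)
      refine ⟨i, ?_⟩
      have : x i = m := by simp [hx, hi]
      rw [evenPart, this, mul_comm, Nat.mul_add_div hm', Nat.div_eq_of_lt hk, add_zero]
  have hclose : ∀ k < m, IsClose r m x (evenPart m (fun i => r * x i) k) := by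
    intro k hk
    have hlt : ∀ i, ((r * x i + k) % m : ℕ) < m := fun i => Nat.mod_lt _ (by omega)
    refine ⟨fun i => ?_, fun i j => ?_⟩
    · rw [hmod, abs_lt]
      have := hlt i
      constructor <;> omega
    · rw [mul_sub, hmod, hmod, abs_lt]
      have := hlt i
      have := hlt j
      constructor <;> omega
  let z : Fin m → CubeVertex n r := fun k =>
    Sum.inr ⟨evenPart m (fun i => r * x i) k, hcube k k.2⟩
  have hz : ∀ k, InCarrier X m (z k) := fun k => hclose k k.2
  have hsum : (WithLp.toLp 2 fun i => (X i : ℝ) : EuclideanSpace ℝ (Fin n)) =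
      ∑ k, ((r : NNReal)⁻¹) • cubeDir (z k) +
        ∑ i, if X i < 0 then ((-X i).toNat : NNReal) • cubeDir (Sum.inl i : CubeVertex n r)
          else 0 := by
    ext i
    have h1 : ∑ k : Fin m, (evenPart m (fun i => r * x i) k i : ℝ) = r * x i := by
      rcases Nat.eq_zero_or_pos m with hm0 | hm0
      · have : x i = 0 := by have := hxm i; omega
        subst hm0
        simp [this]
      · have h2 := congrFun (sum_evenPart hm0 (fun i => r * x i)) i
        rw [Finset.sum_apply, Finset.sum_range] at h2
        exact_mod_cast h2
    have h3 : (∑ k, ((r : NNReal)⁻¹) • cubeDir (z k)) i = x i := by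
      have hr' : (r : ℝ) ≠ 0 := by exact_mod_cast hr.ne'
      have : ∀ k, (((r : NNReal)⁻¹) • cubeDir (z k)) i =
          (r : ℝ)⁻¹ * (evenPart m (fun i => r * x i) k i : ℝ) := fun k => by
        simp [z, cubeDir, cubeCoord, NNReal.smul_def]
      rw [WithLp.ofLp_sum, Finset.sum_apply, Finset.sum_congr rfl fun k _ => this k,
        ← Finset.mul_sum, h1]
      field_simp
    have h4 : (∑ j, if X j < 0 then ((-X j).toNat : NNReal) •
        cubeDir (Sum.inl j : CubeVertex n r) else 0) i = -((-X i).toNat : ℝ) := by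
      rw [WithLp.ofLp_sum, Finset.sum_apply, Finset.sum_eq_single i]
      · split_ifs with h
        · simp [cubeDir, cubeCoord, NNReal.smul_def]
        · have : (-X i).toNat = 0 := by omega
          simp [this]
      · intro j _ hj
        split_ifs
        · simp [cubeDir, cubeCoord, NNReal.smul_def, hj.symm]
        · simp
      · simp
    rw [PiLp.add_apply, h3, h4]
    simp only [hx]
    have h5 : (X i : ℤ) = ((X i).toNat : ℤ) + -((-X i).toNat : ℤ) := by omega
    exact_mod_cast h5
  rw [hsum]
  refine Submodule.add_mem _ (Submodule.sum_mem _ fun k _ => ?_) (Submodule.sum_mem _ fun i _ => ?_)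
  · exact Submodule.smul_mem _ _ (Submodule.subset_span ⟨_, hz k, rfl⟩)
  · split_ifs with h
    · exact Submodule.smul_mem _ _ (Submodule.subset_span ⟨_, h, rfl⟩)
    · exact Submodule.zero_mem _

theorem isCubeFace_singleton (v : CubeVertex n r) : IsCubeFace {v} := by
  intro u hu w hw
  rw [Finset.mem_singleton.1 hu, Finset.mem_singleton.1 hw]
  rcases v with i | z
  · trivial
  · exact Adjacent.refl _

/-- The sum of the directions of a set of vertices. -/
def coordSum (t : Finset (CubeVertex n r)) (i : Fin n) : ℤ := ∑ v ∈ t, cubeCoord v i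

theorem coordSum_eq (t : Finset (CubeVertex n r)) (i : Fin n) :
    coordSum t i = (∑ z ∈ t.toRight, (z.1 i : ℤ)) - if i ∈ t.toLeft then 1 else 0 := by
  have h : coordSum t i = ∑ v ∈ t.toLeft.disjSum t.toRight, cubeCoord v i := by
    rw [Finset.toLeft_disjSum_toRight, coordSum]
  rw [h, Finset.sum_disjSum]
  simp only [cubeCoord, Finset.sum_ite_eq]
  split_ifs <;> ring

theorem toNat_coordSum {t : Finset (CubeVertex n r)} (ht : IsCubeFace t) (i : Fin n) :
    (coordSum t i).toNat = ∑ z ∈ t.toRight, z.1 i := by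
  rw [coordSum_eq]
  split_ifs with h
  · have : ∑ z ∈ t.toRight, (z.1 i : ℤ) = 0 := Finset.sum_eq_zero fun z hz => by
      rw [((isCubeFace_iff t).1 ht).2 z hz i h]
      rfl
    rw [this, Finset.sum_eq_zero fun z hz => ((isCubeFace_iff t).1 ht).2 z hz i h]
    rfl
  · rw [sub_zero, ← Nat.cast_sum, Int.toNat_natCast]

/-- The difference is a sum of $|G|$ terms of absolute value at most one, and the term of $z$ itself
is zero; this makes the inequality strict. -/
theorem abs_card_mul_sub_sum_lt {ι : Type*} (G : Finset ι) (h : ι → ℤ) {z : ι} (hz : z ∈ G)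
    (hG : ∀ w ∈ G, |h z - h w| ≤ 1) : |(G.card : ℤ) * h z - ∑ w ∈ G, h w| < G.card := by
  have h1 : (G.card : ℤ) * h z - ∑ w ∈ G, h w = ∑ w ∈ G, (h z - h w) := by
    rw [Finset.sum_sub_distrib]
    simp
  rw [h1]
  refine (Finset.abs_sum_le_sum_abs _ _).trans_lt ?_
  have h2 : ∑ w ∈ G, |h z - h w| < ∑ _w ∈ G, (1 : ℤ) :=
    Finset.sum_lt_sum hG ⟨z, hz, by simp⟩
  simpa using h2

/-- The maximum of the positive part of an integral vector. -/
def posMax (X : Fin n → ℤ) : ℕ := Finset.univ.sup fun i => (X i).toNat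

theorem le_posMax (X : Fin n → ℤ) (i : Fin n) : X i ≤ posMax X := by
  have : (X i).toNat ≤ posMax X :=
    Finset.le_sup (f := fun i => (X i).toNat) (Finset.mem_univ i)
  omega

theorem posMax_eq_zero_or (X : Fin n → ℤ) : posMax X = 0 ∨ ∃ i, X i = posMax X := by
  by_cases h : posMax X = 0
  · exact Or.inl h
  · right
    have hne : (Finset.univ : Finset (Fin n)).Nonempty := by
      by_contra hc
      rw [Finset.not_nonempty_iff_eq_empty] at hc
      exact h (by simp [posMax, hc])
    obtain ⟨i, -, hi⟩ := Finset.exists_mem_eq_sup Finset.univ hne fun i => (X i).toNat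
    have hi : posMax X = (X i).toNat := hi
    exact ⟨i, by omega⟩

theorem posMax_coordSum {t : Finset (CubeVertex n r)} (ht : IsCubeFace t)
    (hne : t.toRight.Nonempty) : posMax (coordSum t) = r * t.toRight.card := by
  obtain ⟨i, hi⟩ := exists_common_max t.toRight hne ((isCubeFace_iff t).1 ht).1
  refine le_antisymm (Finset.sup_le fun j _ => ?_) ?_
  · rw [toNat_coordSum ht, mul_comm, ← smul_eq_mul]
    exact Finset.sum_le_card_nsmul _ _ _ fun z _ => z.2.1 j
  · have h1 : (coordSum t i).toNat = r * t.toRight.card := by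
      rw [toNat_coordSum ht, Finset.sum_congr rfl hi]
      simp [mul_comm]
    rw [← h1]
    exact Finset.le_sup (f := fun i => (coordSum t i).toNat) (Finset.mem_univ i)

theorem Adjacent.abs_sub_le {A : Type*} {f g : A → ℕ} (h : Adjacent f g) (a : A) :
    |(f a : ℤ) - g a| ≤ 1 := by
  rw [abs_le]
  rcases h with h | h
  · have h1 : f a ≤ g a := h.1 a
    have h2 : g a ≤ f a + 1 := h.2 a
    omega
  · have h1 : g a ≤ f a := h.1 a
    have h2 : f a ≤ g a + 1 := h.2 a
    omega

theorem Adjacent.abs_sub_sub_le {A : Type*} {f g : A → ℕ} (h : Adjacent f g) (a b : A) :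
    |((f a : ℤ) - f b) - (g a - g b)| ≤ 1 := by
  rw [abs_le]
  rcases h with h | h
  · have h1 : f a ≤ g a := h.1 a
    have h2 : g a ≤ f a + 1 := h.2 a
    have h3 : f b ≤ g b := h.1 b
    have h4 : g b ≤ f b + 1 := h.2 b
    omega
  · have h1 : g a ≤ f a := h.1 a
    have h2 : f a ≤ g a + 1 := h.2 a
    have h3 : g b ≤ f b := h.1 b
    have h4 : f b ≤ g b + 1 := h.2 b
    omega

theorem inCarrier_of_mem (hr : 0 < r) {t : Finset (CubeVertex n r)} (ht : IsCubeFace t)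
    {v : CubeVertex n r} (hv : v ∈ t) : InCarrier (coordSum t) (posMax (coordSum t)) v := by
  obtain ⟨hadj, hzero⟩ := (isCubeFace_iff t).1 ht
  rcases v with i | z
  · have hi : i ∈ t.toLeft := Finset.mem_toLeft.2 hv
    change coordSum t i < 0
    rw [coordSum_eq, if_pos hi, Finset.sum_eq_zero fun z hz => by rw [hzero z hz i hi]; rfl]
    norm_num
  · have hz : z ∈ t.toRight := Finset.mem_toRight.2 hv
    have hr' : (0 : ℤ) < r := by exact_mod_cast hr
    change IsClose _ _ _ _
    rw [posMax_coordSum ht ⟨z, hz⟩]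
    simp only [IsClose, toNat_coordSum ht]
    refine ⟨fun i => ?_, fun i j => ?_⟩
    · have h := abs_card_mul_sub_sum_lt t.toRight (fun w => (w.1 i : ℤ)) hz
        fun w hw => (hadj z hz w hw).abs_sub_le i
      push_cast
      rw [mul_assoc, ← mul_sub, abs_mul, abs_of_pos hr']
      exact mul_lt_mul_of_pos_left h hr'
    · have h := abs_card_mul_sub_sum_lt t.toRight (fun w => (w.1 i : ℤ) - w.1 j) hz
        fun w hw => (hadj z hz w hw).abs_sub_sub_le i j
      push_cast
      rw [mul_assoc, ← mul_sub, ← mul_sub, abs_mul, abs_of_pos hr', ← Finset.sum_sub_distrib]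
      exact mul_lt_mul_of_pos_left h hr'

/-- A single lattice point has $m=r$, and $|rw_i-rz_i|<r$ leaves only $w=z$. This makes every
direction a genuine vertex of the polytope. -/
theorem eq_of_inCarrier_singleton (hr : 0 < r) {v w : CubeVertex n r}
    (h : InCarrier (coordSum {v}) (posMax (coordSum {v})) w) : w = v := by
  have hX : ∀ i, coordSum {v} i = cubeCoord v i := fun i => Finset.sum_singleton _ _
  rcases v with i | z <;> rcases w with j | w
  · have h1 : coordSum {(Sum.inl i : CubeVertex n r)} j < 0 := h
    rw [hX] at h1
    simp only [cubeCoord] at h1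
    split_ifs at h1 with h2
    · rw [h2]
    · omega
  · have h0 : posMax (coordSum {(Sum.inl i : CubeVertex n r)}) = 0 := by
      refine Nat.eq_zero_of_le_zero (Finset.sup_le fun j _ => ?_)
      rw [hX]
      simp only [cubeCoord]
      split_ifs <;> simp
    rw [h0] at h
    have h3 := (abs_nonneg _).trans_lt (h.1 i)
    simp at h3
  · have h1 : coordSum {(Sum.inr z : CubeVertex n r)} j < 0 := h
    rw [hX] at h1
    simp only [cubeCoord] at h1
    omega
  · have hface := isCubeFace_singleton (Sum.inr z : CubeVertex n r)
    have h0 := posMax_coordSum hface ⟨z, by simp⟩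
    rw [h0] at h
    have hone : ({(Sum.inr z : CubeVertex n r)} : Finset (CubeVertex n r)).toRight = {z} := by
      ext
      simp
    congr 1
    ext i
    have h1 := h.1 i
    dsimp only at h1
    rw [hX, hone, Finset.card_singleton, mul_one] at h1
    simp only [cubeCoord, Int.toNat_natCast] at h1
    have hr' : (0 : ℤ) < r := by exact_mod_cast hr
    rw [← mul_sub, abs_mul, abs_of_pos hr'] at h1
    have h2 : |(w.1 i : ℤ) - z.1 i| < 1 := lt_of_mul_lt_mul_left (by linarith) hr'.le
    rw [abs_lt] at h2
    omega

/-- The set `s` is the carrier of the direction sum of `t`; for `t` a face it contains `t`. -/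
theorem exists_support (hr : 0 < r) [Fintype (CubePoint n r)] (t : Finset (CubeVertex n r)) :
    ∃ (l : StrongDual ℝ (EuclideanSpace ℝ (Fin n))) (s : Finset (CubeVertex n r)), IsCubeFace s ∧
      (∀ v : CubeVertex n r, l (cubeDir v) ≤ cubeScale v) ∧
      (∀ v : CubeVertex n r, l (cubeDir v) = cubeScale v ↔ v ∈ s) ∧
      ∑ v ∈ t, cubeDir v ∈ Submodule.span NNReal (cubeDir '' (s : Set (CubeVertex n r))) ∧
      (IsCubeFace t → t ⊆ s) ∧ ∀ v, t = {v} → s = {v} := by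
  classical
  obtain ⟨X, hX⟩ : ∃ X, X = coordSum t := ⟨_, rfl⟩
  obtain ⟨l, hl⟩ : ∃ l : StrongDual ℝ (EuclideanSpace ℝ (Fin n)), ∀ v : CubeVertex n r,
      l (cubeDir v) ≤ cubeScale v ∧ (l (cubeDir v) = cubeScale v ↔ InCarrier X (posMax X) v) := by
    rcases Nat.eq_zero_or_pos (posMax X) with h | h
    · rw [h]
      exact exists_functional_zero X
    · obtain ⟨i, hi⟩ := (posMax_eq_zero_or X).resolve_left h.ne'
      exact exists_functional_of_pos hr h (le_posMax X) hi
  have hs : ((Finset.univ.filter (InCarrier X (posMax X)) : Finset (CubeVertex n r)) :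
      Set (CubeVertex n r)) = {v | InCarrier X (posMax X) v} := by
    ext
    simp
  refine ⟨l, Finset.univ.filter (InCarrier X (posMax X)), ?_, fun v => (hl v).1,
    fun v => by simpa using (hl v).2, ?_, ?_, ?_⟩
  · intro v hv w hw
    exact InCarrier.adj (Finset.mem_filter.1 hv).2 (Finset.mem_filter.1 hw).2
  · rw [hs]
    have : ∑ v ∈ t, cubeDir v = WithLp.toLp 2 fun i => (X i : ℝ) := by
      ext i
      rw [WithLp.ofLp_sum, Finset.sum_apply, hX]
      simp [cubeDir, coordSum]
    rw [this]
    exact mem_span_cubeDir hr (le_posMax X) (posMax_eq_zero_or X)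
  · intro ht v hv
    rw [Finset.mem_filter, hX]
    exact ⟨Finset.mem_univ _, inCarrier_of_mem hr ht hv⟩
  · rintro v rfl
    ext w
    simp only [Finset.mem_filter, Finset.mem_univ, true_and, Finset.mem_singleton]
    constructor
    · intro h
      rw [hX] at h
      exact eq_of_inCarrier_singleton hr h
    · rintro rfl
      rw [hX]
      exact inCarrier_of_mem hr (isCubeFace_singleton w) (Finset.mem_singleton_self w)

/-- Remove the largest point of the chain. A common coordinate $r$ shows that the coefficients sum
to zero; a coordinate where the largest point exceeds all others by exactly one then isolates its
coefficient. -/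
theorem linearIndependent_cubePoints (hr : 0 < r) (G : Finset (CubePoint n r))
    (b : CubePoint n r → ℝ) : (∀ z ∈ G, ∀ w ∈ G, Adjacent z.1 w.1) →
    (∀ i, ∑ z ∈ G, b z * z.1 i = 0) → ∀ z ∈ G, b z = 0 := by
  classical
  have hr' : (r : ℝ) ≠ 0 := by exact_mod_cast hr.ne'
  induction G using Finset.induction_on_max_value (fun z : CubePoint n r => ∑ i, z.1 i) with
  | empty => simp
  | insert z s hz hmax ih =>
    intro hadj hsum
    obtain ⟨j, hj⟩ := exists_common_max (insert z s) ⟨z, Finset.mem_insert_self _ _⟩ hadj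
    have h1 : b z + ∑ w ∈ s, b w = 0 := by
      have h2 := hsum j
      rw [Finset.sum_congr rfl (fun w hw => by rw [hj w hw]), ← Finset.sum_mul,
        Finset.sum_insert hz] at h2
      exact (mul_eq_zero.1 h2).resolve_right hr'
    have hbz : b z = 0 := by
      rcases s.eq_empty_or_nonempty with rfl | hne
      · simpa using h1
      -- Take the largest remaining point $w$. Where $w_i<z_i$, all the remaining points have the
      -- value $z_i-1$, by adjacency to $z$ and by lying below $w$.
      · obtain ⟨w, hw, hwmax⟩ := Finset.exists_max_image s (fun z => ∑ i, z.1 i) hne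
        have hwz : w.1 ≤ z.1 := (hadj w (Finset.mem_insert_of_mem hw) z
          (Finset.mem_insert_self _ _)).le_of_sum_le (hmax w hw)
        obtain ⟨i, hi⟩ : ∃ i, w.1 i < z.1 i := by
          by_contra! hc
          have : w = z := Subtype.ext (le_antisymm hwz hc)
          exact hz (this ▸ hw)
        have hval : ∀ y ∈ s, (y.1 i : ℝ) = z.1 i - 1 := by
          intro y hy
          have hyw : y.1 i ≤ w.1 i := ((hadj y (Finset.mem_insert_of_mem hy) w
            (Finset.mem_insert_of_mem hw)).le_of_sum_le (hwmax y hy)) i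
          have hyz := (hadj y (Finset.mem_insert_of_mem hy) z
            (Finset.mem_insert_self _ _)).abs_sub_le i
          rw [abs_le] at hyz
          have : (y.1 i : ℤ) = z.1 i - 1 := by omega
          exact_mod_cast this
        have h2 := hsum i
        rw [Finset.sum_insert hz, Finset.sum_congr rfl (fun y hy => by rw [hval y hy]),
          ← Finset.sum_mul] at h2
        linear_combination h2 - (z.1 i - 1 : ℝ) * h1
    intro y hy
    rcases Finset.mem_insert.1 hy with rfl | hy
    · exact hbz
    · refine ih (fun a ha c hc => hadj a (Finset.mem_insert_of_mem ha) c
        (Finset.mem_insert_of_mem hc)) (fun i => ?_) y hy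
      have h2 := hsum i
      rwa [Finset.sum_insert hz, hbz, zero_mul, zero_add] at h2

theorem linearIndependent_cubeDir (hr : 0 < r) (s : Finset (CubeVertex n r)) (hs : IsCubeFace s)
    (a : CubeVertex n r → ℝ) (h : ∑ v ∈ s, a v • cubeDir v = 0) : ∀ v ∈ s, a v = 0 := by
  obtain ⟨hadj, hzero⟩ := (isCubeFace_iff s).1 hs
  have hcoord : ∀ i, ∑ z ∈ s.toRight, a (Sum.inr z) * z.1 i -
      (if i ∈ s.toLeft then a (Sum.inl i) else 0) = 0 := by
    intro i
    have h1 : (∑ v ∈ s, a v • cubeDir v) i = 0 := by rw [h]; rfl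
    rw [WithLp.ofLp_sum, Finset.sum_apply] at h1
    have h2 : ∑ v ∈ s.toLeft.disjSum s.toRight, a v * (cubeCoord v i : ℝ) = 0 := by
      rw [Finset.toLeft_disjSum_toRight, ← h1]
      refine Finset.sum_congr rfl fun v _ => ?_
      simp [cubeDir]
    rw [Finset.sum_disjSum] at h2
    have h3 : ∑ j ∈ s.toLeft, a (Sum.inl j) * (cubeCoord (Sum.inl j : CubeVertex n r) i : ℝ) =
        -(if i ∈ s.toLeft then a (Sum.inl i) else 0) := by
      simp only [cubeCoord]
      push_cast
      simp only [mul_ite, mul_zero, Finset.sum_ite_eq]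
      split_ifs <;> ring
    rw [h3] at h2
    simp only [cubeCoord, Int.cast_natCast] at h2
    linarith
  have hleft : ∀ i ∈ s.toLeft, a (Sum.inl i) = 0 := by
    intro i hi
    have h1 := hcoord i
    rw [if_pos hi, Finset.sum_eq_zero fun z hz => by rw [hzero z hz i hi]; simp] at h1
    linarith
  have hright := linearIndependent_cubePoints hr s.toRight (fun z => a (Sum.inr z)) hadj
    fun i => by
      have h1 := hcoord i
      split_ifs at h1 with hi
      · rwa [hleft i hi, sub_zero] at h1
      · rwa [sub_zero] at h1
  rintro (i | z) hv
  · exact hleft i (Finset.mem_toLeft.2 hv)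
  · exact hright z (Finset.mem_toRight.2 hv)

/-- The directions include both $-e_i$ and $re_i$, so they positively span the whole space. -/
theorem eq_zero_of_nonpos (hr : 0 < r) (l : StrongDual ℝ (EuclideanSpace ℝ (Fin n)))
    (hl : ∀ v : CubeVertex n r, l (cubeDir v) ≤ 0) : l = 0 := by
  have hbasis : ∀ i, l (EuclideanSpace.single i 1) = 0 := by
    intro i
    have h1 := hl (Sum.inl i)
    have h2 : (cubeDir (Sum.inl i : CubeVertex n r)) = -EuclideanSpace.single i 1 := by
      ext j
      by_cases h : j = i <;> simp [cubeDir, cubeCoord, h]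
    rw [h2, map_neg] at h1
    have h3 := hl (Sum.inr ⟨fun j => if j = i then r else 0,
      ⟨fun j => by dsimp only; split_ifs <;> omega, i, by simp⟩⟩)
    have h4 : (cubeDir (Sum.inr ⟨fun j => if j = i then r else 0,
      ⟨fun j => by dsimp only; split_ifs <;> omega, i, by simp⟩⟩ : CubeVertex n r)) =
        (r : ℝ) • EuclideanSpace.single i (1 : ℝ) := by
      ext j
      by_cases h : j = i <;> simp [cubeDir, cubeCoord, h]
    rw [h4, map_smul, smul_eq_mul] at h3
    have hr' : (0 : ℝ) < r := by exact_mod_cast hr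
    have h5 : l (EuclideanSpace.single i 1) ≤ 0 := by
      by_contra! hc
      nlinarith
    linarith
  apply ContinuousLinearMap.coe_injective
  refine (EuclideanSpace.basisFun (Fin n) ℝ).toBasis.ext fun i => ?_
  simpa using hbasis i

end CubeSphere

theorem exists_flag_polytope {n r : ℕ} (hn : 0 < n) (hr : 0 < r) :
    ∃ P : Polytope (EuclideanSpace ℝ (Fin n)), P.dim = n ∧ P.IsFlagSimplicial ∧
      hPoly P.boundaryComplex = binomEulerPlus n r := by
  classical
  have := Fintype.ofFinite (CubePoint n r)
  have : Nonempty (CubeVertex n r) := ⟨Sum.inl ⟨0, hn⟩⟩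
  obtain ⟨P, e, hdim, hsimp, hface⟩ := exists_polytope (V := CubeVertex n r) cubeDir
    (fun v => (cubeScale v : ℝ)) (fun v => Int.cast_pos.2 (cubeScale_pos v)) IsCubeFace
    (fun s t hs h => hs.subset h) (exists_support hr) (linearIndependent_cubeDir hr)
    (eq_zero_of_nonpos hr)
  refine ⟨P, by rw [hdim, finrank_euclideanSpace_fin], ⟨hsimp, ?_⟩,
    hPoly_eq_of_isCubeFace hn hr P.boundaryComplex e hface⟩
  -- Faces are cliques of `CubeAdj`, so flagness only has to transport edges along `e`.
  intro s hne hedge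
  obtain ⟨t, rfl⟩ : ∃ t : Finset (CubeVertex n r), t.map e.toEmbedding = s :=
    ⟨s.map e.symm.toEmbedding, by ext; simp⟩
  refine (hface t).2 ⟨by simpa using hne, fun v hv w hw => ?_⟩
  obtain ⟨f, hf, hfvw⟩ := hedge (e v) (Finset.mem_map_of_mem _ hv) (e w)
    (Finset.mem_map_of_mem _ hw)
  obtain ⟨u, rfl⟩ : ∃ u : Finset (CubeVertex n r), u.map e.toEmbedding = f :=
    ⟨f.map e.symm.toEmbedding, by ext; simp⟩
  have hmem : ∀ x, e x ∈ u.map e.toEmbedding → x ∈ u := fun x hx => by simpa using hx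
  refine ((hface u).1 hf).2 v (hmem v ?_) w (hmem w ?_)
  · rw [← Finset.mem_coe, hfvw]
    exact Set.mem_insert _ _
  · rw [← Finset.mem_coe, hfvw]
    exact Set.mem_insert_of_mem _ rfl

end BinomialEulerian

theorem corollary5p3 (n r : ℕ) (hn : 0 < n) (hr : 0 < r) :
    (∀ ord : LinearOrder (BinomialEulerian.BaryVertex n),
      BinomialEulerian.binomEulerPlus n r =
        BinomialEulerian.hPoly
          (BinomialEulerian.gamma n r ord).sphere.toPreAbstractSimplicialComplex) ∧
    ∃ P : BinomialEulerian.Polytope (EuclideanSpace ℝ (Fin n)),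
      P.dim = n ∧ P.IsFlagSimplicial ∧
        BinomialEulerian.binomEulerPlus n r = BinomialEulerian.hPoly P.boundaryComplex := by
  refine ⟨fun ord => (BinomialEulerian.hPoly_sphere_gamma hn hr
    (BinomialEulerian.eulerPlus_eq_shellSeries hr) ord).symm, ?_⟩
  obtain ⟨P, hdim, hflag, hP⟩ := BinomialEulerian.exists_flag_polytope hn hr
  exact ⟨P, hdim, hflag, hP.symm⟩
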